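/- **Setting.** Let $\mathcal C$ be a countable set of contexts with a probability law $(p_c)_{c\in\mathcal C}$, let $[J]$ be the set of actions, let $\phi,\psi:\mathcal C\times[J]\to\mathbb R^d$ be known feature maps and $\theta_*,\mu_*\in\mathbb R^d$ unknown parameters with $\|\phi(c,j)\|,\|\psi(c,j)\|,\|\theta_*\|,\|\mu_*\|\le 1$, $r(c,j)=\langle\theta_*,\phi(c,j)\rangle\in[0,1]$ and $w(c,j)=\langle\mu_*,\psi(c,j)\rangle\in[-1,1]$ for all $c,j$. In round $t=1,\dots,T$ a context $c(t)\sim p$ is drawn independently of the past $\mathcal F_{t-1}=\sigma(c(s),A(s),R(s),W(s):s<t)$, the learner chooses $A(t)\in[J]$, and only then observes the reward $R(t)=r(c(t),A(t))+\eta(t)$ and the cost $W(t)=w(c(t),A(t))+\xi(t)$. Conditionally on $\mathcal F_{t-1},c(t),A(t)$, each of $\eta(t)$ and $\xi(t)$ has mean zero and is $1$-subGaussian ($\mathbb E[e^{\lambda\eta(t)}\mid\mathcal F_{t-1},c(t),A(t)]\le e^{\lambda^2/2}$ for all $\lambda\in\mathbb R$, and likewise for $\xi(t)$). Slater's condition holds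 with a constant $\delta\in(0,1]$ known to the learner: there is $x\ge 0$ with $\sum_j x_{c,j}=1$ for all $c$ and $\sum_{c,j}p_cw(c,j)x_{c,j}\le-\delta$. Let $\mathrm{OPT}$ be the maximum of $\sum_{c,j}p_cr(c,j)x_{c,j}$ over $x\ge0$ with $\sum_jx_{c,j}=1$ for all $c$ and $\sum_{c,j}p_cw(c,j)x_{c,j}\le0$. For $\tau\in[T]$ put $$\mathcal R(\tau)=\tau\,\mathrm{OPT}-\mathbb E\Big[\sum_{t=1}^{\tau}R(t)\Big],\qquad \mathcal V(\tau)=\Big(\mathbb E\Big[\sum_{t=1}^{\tau}W(t)\Big]\Big)^+ .$$ **Algorithm.** Put $\epsilon_t=\frac{4d\log(1+T)}{\sqrt t}$, $V_t=\frac{\delta d\sqrt t\log(1+T)}{4}$, $\sqrt{\beta_t}=1+\sqrt{2\log T+d\log\frac{d+t-1}{d}}$, $\Sigma_{r,t}=I+\sum_{s\le t}\phi(c(s),A(s))\phi(c(s),A(s))^\dagger$, $\hat\theta_t=\Sigma_{r,t}^{-1}\sum_{s\le t}\phi(c(s),A(s))R(s)$, and define $\Sigma_{w,t},\hat\mu_t$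 in the same way from $\psi$ and $W$. Let $\mathcal B_t=\{\theta:\|\theta-\hat\theta_{t-1}\|_{\Sigma_{r,t-1}}\le\sqrt{\beta_t}\}$ and $\mathcal U_t=\{\mu:\|\mu-\hat\mu_{t-1}\|_{\Sigma_{w,t-1}}\le\sqrt{\beta_t}\}$, where $\|v\|_\Sigma=\sqrt{v^\dagger\Sigma v}$, and $$\hat r_t(c,j)=\min\Big\{1,\max_{\theta\in\mathcal B_t}\langle\theta,\phi(c,j)\rangle\Big\},\qquad \check W_t(c,j)=\max\Big\{-1,\min\Big\{1,\min_{\mu\in\mathcal U_t}\langle\mu,\psi(c,j)\rangle\Big\}\Big\}.$$ With $Q(1)=0$, the algorithm plays in round $t$ any maximizer $A(t)$ of $j\mapsto\hat r_t(c(t),j)-\frac1{V_t}\check W_t(c(t),j)Q(t)$ (ties are broken arbitrarily), and sets $Q(t+1)=\big(Q(t)+\check W_t(c(t),A(t))+\epsilon_t\big)^+$. **Theorem.** For every $\tau\in[T]$, $$\mathcal R(\tau)\le\frac{235d^4\log^4(1+T)}{\delta^3}+\frac{(8d+24)\sqrt\tau\log(1+T)}{\delta}+2+10d\sqrt\tau\log(1+T),$$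 $$\mathcal V(\tau)\le\Big(\frac{128d^2\log^2(1+T)}{\delta^2}+\frac{48}{\delta}\log\frac{16}{\delta}+\frac{12}{\delta}+2d(4-\sqrt\tau)\log(1+T)\Big)^+ .$$ Moreover there is a universal constant $\kappa>0$ such that, whenever $T\ge2$, $\mathcal V(\tau)=0$ for all $\tau\in[T]$ with $\tau\ge\kappa\,d^2\log^2T/\delta^4$. -/

import Mathlib

open MeasureTheory ProbabilityTheory

noncomputable section

namespace ConstrainedBandit

/-- Feature space `ℝ^d` with the Euclidean norm. -/
abbrev Vec (d : ℕ) := EuclideanSpace ℝ (Fin d)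

/-! ### The bandit model -/

/-- A stochastic linear bandit with one linear cost: context set `X`, actions `1, …, J`,
context law `p`, reward and cost features, unknown reward and cost parameters. -/
structure Model (X : Type*) (J d : ℕ) where
  p : PMF X
  phi : X → Fin J → Vec d
  psi : X → Fin J → Vec d
  thetaStar : Vec d
  muStar : Vec d

namespace Model

variable {X : Type*} {J d : ℕ} (M : Model X J d)

/-- Mean reward `r(c, j) = ⟨θ_*, φ(c, j)⟩`. -/
def meanReward (c : X) (j : Fin J) : ℝ := inner ℝ M.thetaStar (M.phi c j)

/-- Mean cost `w(c, j) = ⟨μ_*, ψ(c, j)⟩`. -/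
def meanCost (c : X) (j : Fin J) : ℝ := inner ℝ M.muStar (M.psi c j)

/-- Boundedness assumptions on features, parameters, mean rewards and mean costs. -/
structure Bounded : Prop where
  norm_phi_le : ∀ c j, ‖M.phi c j‖ ≤ 1
  norm_psi_le : ∀ c j, ‖M.psi c j‖ ≤ 1
  norm_thetaStar_le : ‖M.thetaStar‖ ≤ 1
  norm_muStar_le : ‖M.muStar‖ ≤ 1
  meanReward_mem : ∀ c j, M.meanReward c j ∈ Set.Icc (0 : ℝ) 1
  meanCost_mem : ∀ c j, M.meanCost c j ∈ Set.Icc (-1 : ℝ) 1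

/-- A stationary randomized policy: `x c j` is the probability of action `j` on context `c`. -/
def IsPolicy (x : X → Fin J → ℝ) : Prop :=
  ∀ c, (∀ j, 0 ≤ x c j) ∧ ∑ j, x c j = 1

/-- `∑_{c,j} p_c r(c,j) x_{c,j}`. -/
def policyReward (x : X → Fin J → ℝ) : ℝ :=
  ∑' c, (M.p c).toReal * ∑ j, M.meanReward c j * x c j

/-- `∑_{c,j} p_c w(c,j) x_{c,j}`. -/
def policyCost (x : X → Fin J → ℝ) : ℝ :=
  ∑' c, (M.p c).toReal * ∑ j, M.meanCost c j * x c j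

/-- The optimal value of the baseline linear program. -/
def baseline : ℝ :=
  sSup (M.policyReward '' {x | IsPolicy x ∧ M.policyCost x ≤ 0})

/-- Slater's condition with constant `δ`. -/
def Slater (δ : ℝ) : Prop := ∃ x, IsPolicy x ∧ M.policyCost x ≤ -δ

end Model

/-! ### The interaction of the learner with the environment

Rounds are numbered `1, 2, …, T`. The random variables `c t`, `A t`, `R t`, `W t` are the context,
the action, the observed reward and the observed cost of round `t`. -/

section Interaction

variable {X Ω : Type*} {J d : ℕ} [MeasurableSpace X] [mΩ : MeasurableSpace Ω]

/-- Information available before round `t`: contexts, actions, rewards and costs of the rounds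
`1, …, t - 1`. -/
@[reducible] def history (c : ℕ → Ω → X) (A : ℕ → Ω → Fin J) (R W : ℕ → Ω → ℝ) (t : ℕ) : MeasurableSpace Ω :=
  ⨆ s ∈ Finset.Ico 1 t,
    MeasurableSpace.comap (fun ω => (c s ω, A s ω, R s ω, W s ω)) inferInstance

/-- Information available in round `t` once context and action are fixed, before the reward and the
cost are revealed. -/
@[reducible] def decisionInfo (c : ℕ → Ω → X) (A : ℕ → Ω → Fin J) (R W : ℕ → Ω → ℝ) (t : ℕ) :
    MeasurableSpace Ω :=
  history c A R W t ⊔ MeasurableSpace.comap (fun ω => (c t ω, A t ω)) inferInstance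

/-- `ξ` has mean zero and is `1`-subGaussian conditionally on the σ-algebra `m`. -/
structure IsCondSubGaussian (P : Measure Ω) (m : MeasurableSpace Ω) (ξ : Ω → ℝ) : Prop where
  integrable : Integrable ξ P
  condExp_eq_zero : P[ξ | m] =ᵐ[P] 0
  integrable_exp : ∀ l : ℝ, Integrable (fun ω => Real.exp (l * ξ ω)) P
  condExp_exp_le : ∀ l : ℝ,
    P[fun ω => Real.exp (l * ξ ω) | m] ≤ᵐ[P] fun _ => Real.exp (l ^ 2 / 2)

/-- The environment over the horizon `T`: contexts are i.i.d. draws from `p` (each one is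
independent of the past), and the observed reward and cost are the means plus
conditionally `1`-subGaussian noise. -/
structure IsInteraction (M : Model X J d) (T : ℕ) (P : Measure Ω)
    (c : ℕ → Ω → X) (A : ℕ → Ω → Fin J) (R W : ℕ → Ω → ℝ) : Prop where
  measurable_context : ∀ t ∈ Finset.Icc 1 T, Measurable (c t)
  measurable_action : ∀ t ∈ Finset.Icc 1 T, Measurable (A t)
  measurable_reward : ∀ t ∈ Finset.Icc 1 T, Measurable (R t)
  measurable_cost : ∀ t ∈ Finset.Icc 1 T, Measurable (W t)
  context_law : ∀ t ∈ Finset.Icc 1 T, P.map (c t) = M.p.toMeasure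
  context_indep : ∀ t ∈ Finset.Icc 1 T,
    Indep (MeasurableSpace.comap (c t) inferInstance) (history c A R W t) P
  reward_noise : ∀ t ∈ Finset.Icc 1 T, IsCondSubGaussian P (decisionInfo c A R W t)
    (fun ω => R t ω - M.meanReward (c t ω) (A t ω))
  cost_noise : ∀ t ∈ Finset.Icc 1 T, IsCondSubGaussian P (decisionInfo c A R W t)
    (fun ω => W t ω - M.meanCost (c t ω) (A t ω))

/-- Regret in round `τ`. -/
def regret (M : Model X J d) (P : Measure Ω) (R : ℕ → Ω → ℝ) (τ : ℕ) : ℝ :=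
  τ * M.baseline - ∫ ω, ∑ t ∈ Finset.Icc 1 τ, R t ω ∂P

/-- Constraint violation in round `τ`. -/
def violation (P : Measure Ω) (W : ℕ → Ω → ℝ) (τ : ℕ) : ℝ :=
  max (∫ ω, ∑ t ∈ Finset.Icc 1 τ, W t ω ∂P) 0

end Interaction

/-! ### Linear confidence sets -/

section Confidence

variable {d : ℕ}

/-- `Σ_t = I + ∑_{s=1}^t f_s f_sᵀ` for the features `f_s` of the actions taken. -/
def gram (f : ℕ → Vec d) (t : ℕ) : Matrix (Fin d) (Fin d) ℝ :=
  1 + ∑ s ∈ Finset.Icc 1 t, Matrix.vecMulVec (f s).ofLp (f s).ofLp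

/-- The estimate `Σ_t⁻¹ ∑_{s=1}^t y_s f_s` from the signals `y_s`. -/
def estimate (f : ℕ → Vec d) (y : ℕ → ℝ) (t : ℕ) : Vec d :=
  WithLp.toLp 2 ((gram f t)⁻¹.mulVec (∑ s ∈ Finset.Icc 1 t, y s • (f s).ofLp))

/-- `‖v‖_S = √(vᵀ S v)`. -/
def weightedNorm (S : Matrix (Fin d) (Fin d) ℝ) (v : Vec d) : ℝ :=
  √(v.ofLp ⬝ᵥ S.mulVec v.ofLp)

/-- The radius `√β_t` of the confidence sets of round `t ≥ 1`. -/
def radius (d T t : ℕ) : ℝ :=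
  1 + √(2 * Real.log T + d * Real.log ((d + ((t : ℝ) - 1)) / d))

/-- The confidence set of round `t ≥ 1`, built from the observations of rounds `1, …, t - 1`. -/
def confidenceSet (T : ℕ) (f : ℕ → Vec d) (y : ℕ → ℝ) (t : ℕ) : Set (Vec d) :=
  {v | weightedNorm (gram f (t - 1)) (v - estimate f y (t - 1)) ≤ radius d T t}

end Confidence

/-! ### The pessimistic-optimistic algorithm along one trajectory -/

section Algorithm

variable {X : Type*} {J d : ℕ}

/-- `V_t = δ d √t log(1+T) / 4`. -/
def weight (d T : ℕ) (δ : ℝ) (t : ℕ) : ℝ := δ * d * √t * Real.log (1 + T) / 4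

/-- `ε_t = 4 d log(1+T) / √t`. -/
def tightness (d T t : ℕ) : ℝ := 4 * d * Real.log (1 + T) / √t

/-- Optimistic reward estimate of round `t`, truncated from above at `1`. -/
def rewardEstimate (M : Model X J d) (T : ℕ) (c : ℕ → X) (A : ℕ → Fin J) (R : ℕ → ℝ)
    (t : ℕ) (x : X) (j : Fin J) : ℝ :=
  min 1 (sSup ((fun θ : Vec d => inner ℝ θ (M.phi x j)) ''
    confidenceSet T (fun s => M.phi (c s) (A s)) R t))

/-- LinUCB estimate of the cost in round `t` (the lower end of the confidence interval), truncated
to `[-1, 1]`. -/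
def costEstimate (M : Model X J d) (T : ℕ) (c : ℕ → X) (A : ℕ → Fin J) (W : ℕ → ℝ)
    (t : ℕ) (x : X) (j : Fin J) : ℝ :=
  max (-1) (min 1 (sInf ((fun μ : Vec d => inner ℝ μ (M.psi x j)) ''
    confidenceSet T (fun s => M.psi (c s) (A s)) W t)))

/-- The dual variable: `Q(1) = 0` and `Q(t+1) = [Q(t) + W̌(c(t), A(t)) + ε_t]⁺` (the value at
round `0` is not used). -/
def dual (M : Model X J d) (T : ℕ) (c : ℕ → X) (A : ℕ → Fin J) (W : ℕ → ℝ) : ℕ → ℝ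
  | 0 => 0
  | 1 => 0
  | t + 2 => max (dual M T c A W (t + 1)
      + costEstimate M T c A W (t + 1) (c (t + 1)) (A (t + 1)) + tightness d T (t + 1)) 0

/-- The pseudo-action-value of action `j` on context `x` in round `t`. -/
def pseudoValue (M : Model X J d) (T : ℕ) (δ : ℝ) (c : ℕ → X) (A : ℕ → Fin J) (R W : ℕ → ℝ)
    (t : ℕ) (x : X) (j : Fin J) : ℝ :=
  rewardEstimate M T c A R t x j
    - 1 / weight d T δ t * costEstimate M T c A W t x j * dual M T c A W t

/-- In every round the action maximizes the pseudo-action-value of the current context; ties are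
broken in any way. -/
def FollowsAlgorithm (M : Model X J d) (T : ℕ) (δ : ℝ)
    (c : ℕ → X) (A : ℕ → Fin J) (R W : ℕ → ℝ) : Prop :=
  ∀ t ∈ Finset.Icc 1 T, ∀ j : Fin J,
    pseudoValue M T δ c A R W t (c t) j ≤ pseudoValue M T δ c A R W t (c t) (A t)

end Algorithm

end ConstrainedBandit

end

/-! Write `u = d log(1+T)`, so that `V_t = δu√t/4` and `ε_t = 4u/√t`.

Confidence. The potential `exp(‖S_t‖²/2)/√(det Σ_t)` of the accumulated noise `S_t`, with the norm
of `Σ_t⁻¹`, is a nonnegative supermartingale: each step is a Gaussian mixture of one-dimensional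
sub-Gaussian bounds. Stopped at level `T` it shows (`measure_expPotential_gt_le`) that both
parameters stay in their confidence sets with probability at least `1 - 2/T`. The good event of
round `t` is determined by the history before `t`, so the new context is independent of it and of
`Q(t)`. On it the estimates are optimistic and miss the truth by at most a confidence width; the
widths sum to at most `5.2 u√τ` once `log(1+T) ≥ 8` (elliptical potential).

Regret. The played action maximizes estimated reward minus `Q/V` times estimated cost, so it beats
every policy in this combined value. The comparison policy mixes a feasible one with the Slater
policy, with weight `min(ε_t/δ, 1)`. Once `ε_t ≤ δ`, its slack `ε_t` cancels the term that the
tightening adds to the drift of `Q²`; in earlier rounds a deterministic bound on `Q` suffices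
(`policyReward_le_of_feasible`). The differences of `Q²` divided by `2V_t` telescope because `V_t`
is nondecreasing.

Violation. Unrolling the recursion of `Q` on the good event bounds the total cost by `Q(τ+1)` plus
the widths minus `∑ ε_t` (`integral_sum_cost_le_dual`). When `Q` is above a multiple of `V_t/δ`, the
Slater policy forces negative drift, and an exponential moment argument gives `E[Q(τ+1)] ≤
max(128u²/δ², (2/3)u√τ + 2 + (36/δ) log(576/δ²))` on the good event (`integral_dualVariable_le`).
Since `∑ ε_t ≥ 8u(√τ - 1)`, the coefficient of `u√τ` is at most `2/3 + 5.2 - 8 < -2`: the tightening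
eventually wins.

Both halves treat `τ ≤ 64u²/δ²` by trivial bounds. Beyond it `T > 64 log²(1+T)`, which forces
`log(1+T) ≥ 8` and makes the numerical constants work. -/

namespace ConstrainedBandit

/-! ### Quadratic forms and rank-one updates of positive definite matrices -/

open Matrix in
theorem quadForm_nonneg {n : Type*} [Fintype n] {S : Matrix n n ℝ} (hS : S.PosSemidef)
    (x : n → ℝ) : 0 ≤ x ⬝ᵥ S *ᵥ x := by
  simpa using hS.dotProduct_mulVec_nonneg x

open Matrix in
theorem dotProduct_mulVec_comm_of_isHermitian {n : Type*} [Fintype n] {S : Matrix n n ℝ}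
    (hS : S.IsHermitian) (x y : n → ℝ) : x ⬝ᵥ S *ᵥ y = y ⬝ᵥ S *ᵥ x := by
  have h : Sᵀ = S := by rw [← conjTranspose_eq_transpose_of_trivial]; exact hS
  rw [dotProduct_mulVec, ← mulVec_transpose, h, dotProduct_comm]

open Matrix in
/-- Cauchy–Schwarz inequality for the form of a positive semidefinite matrix. -/
theorem sq_dotProduct_mulVec_le {n : Type*} [Fintype n] {S : Matrix n n ℝ} (hS : S.PosSemidef)
    (x y : n → ℝ) : (x ⬝ᵥ S *ᵥ y) ^ 2 ≤ (x ⬝ᵥ S *ᵥ x) * (y ⬝ᵥ S *ᵥ y) := by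
  have key : ∀ t : ℝ, 0 ≤ (y ⬝ᵥ S *ᵥ y) * (t * t) + (2 * (x ⬝ᵥ S *ᵥ y)) * t + x ⬝ᵥ S *ᵥ x := by
    intro t
    have h := quadForm_nonneg hS (x + t • y)
    have h2 := dotProduct_mulVec_comm_of_isHermitian hS.isHermitian x y
    simp only [mulVec_add, mulVec_smul, dotProduct_add, add_dotProduct, dotProduct_smul,
      smul_dotProduct, smul_eq_mul] at h
    rw [← h2] at h
    linarith
  have := discrim_le_zero key
  rw [discrim] at this
  nlinarith

-- Minkowski's inequality for the seminorm of `S`, from Cauchy–Schwarz. It separates regularization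
-- bias from noise in `mem_confidenceSet`.
open Matrix in
theorem sqrt_quadForm_add_le {n : Type*} [Fintype n] {S : Matrix n n ℝ} (hS : S.PosSemidef)
    (x y : n → ℝ) :
    √((x + y) ⬝ᵥ S *ᵥ (x + y)) ≤ √(x ⬝ᵥ S *ᵥ x) + √(y ⬝ᵥ S *ᵥ y) := by
  have hx := quadForm_nonneg hS x
  have hy := quadForm_nonneg hS y
  have hxy : x ⬝ᵥ S *ᵥ y ≤ √(x ⬝ᵥ S *ᵥ x) * √(y ⬝ᵥ S *ᵥ y) := by
    rw [← Real.sqrt_mul hx]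
    exact Real.le_sqrt_of_sq_le (sq_dotProduct_mulVec_le hS x y)
  refine Real.sqrt_le_iff.2 ⟨by positivity, ?_⟩
  have h2 := dotProduct_mulVec_comm_of_isHermitian hS.isHermitian x y
  simp only [mulVec_add, dotProduct_add, add_dotProduct]
  rw [← h2, add_sq, Real.sq_sqrt hx, Real.sq_sqrt hy]
  linarith

open Matrix in
/-- The dual pairing is bounded by the norms of a positive definite matrix and its inverse. -/
theorem abs_dotProduct_le_sqrt_mul_sqrt {n : Type*} [Fintype n] [DecidableEq n]
    {S : Matrix n n ℝ} (hS : S.PosDef) (x y : n → ℝ) :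
    |x ⬝ᵥ y| ≤ √(x ⬝ᵥ S *ᵥ x) * √(y ⬝ᵥ S⁻¹ *ᵥ y) := by
  have hdet : IsUnit S.det := (isUnit_iff_isUnit_det S).1 hS.isUnit
  have h := sq_dotProduct_mulVec_le hS.posSemidef x (S⁻¹ *ᵥ y)
  rw [mulVec_mulVec, mul_nonsing_inv _ hdet, one_mulVec, dotProduct_comm (S⁻¹ *ᵥ y)] at h
  rw [← Real.sqrt_mul (quadForm_nonneg hS.posSemidef x)]
  exact Real.le_sqrt_of_sq_le (by rwa [sq_abs])

-- With `z = (1+S)⁻¹x` one has `x = z + Sz`, so the left side is `z·z + z·Sz` and the right side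
-- exceeds it by `z·Sz + |Sz|²`.
open Matrix in
theorem quadForm_inv_one_add_le {n : Type*} [Fintype n] [DecidableEq n] {S : Matrix n n ℝ}
    (hS : S.PosSemidef) (x : n → ℝ) : x ⬝ᵥ (1 + S)⁻¹ *ᵥ x ≤ x ⬝ᵥ x := by
  have hP : (1 + S).PosDef := PosDef.one.add_posSemidef hS
  have hdet : IsUnit (1 + S).det := (isUnit_iff_isUnit_det _).1 hP.isUnit
  set z := (1 + S)⁻¹ *ᵥ x with hz
  have hx : x = z + S *ᵥ z := by
    have : (1 + S) *ᵥ z = x := by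
      rw [hz, mulVec_mulVec, mul_nonsing_inv _ hdet, one_mulVec]
    rw [← this, add_mulVec, one_mulVec]
  have h1 : 0 ≤ z ⬝ᵥ S *ᵥ z := quadForm_nonneg hS z
  have h2 : 0 ≤ (S *ᵥ z) ⬝ᵥ (S *ᵥ z) := by
    simpa using dotProduct_star_self_nonneg (S *ᵥ z)
  calc x ⬝ᵥ z = z ⬝ᵥ z + z ⬝ᵥ S *ᵥ z := by rw [hx, add_dotProduct, dotProduct_comm (S *ᵥ z)]
    _ ≤ z ⬝ᵥ z + z ⬝ᵥ S *ᵥ z + (z ⬝ᵥ S *ᵥ z + (S *ᵥ z) ⬝ᵥ (S *ᵥ z)) := by linarith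
    _ = x ⬝ᵥ x := by
      rw [hx]; simp only [add_dotProduct, dotProduct_add]; rw [dotProduct_comm (S *ᵥ z) z]

open Matrix in
/-- Sherman–Morrison formula. -/
theorem inv_add_vecMulVec_mulVec {n : Type*} [Fintype n] [DecidableEq n] {S : Matrix n n ℝ}
    (hS : S.PosDef) (f y : n → ℝ) :
    (S + vecMulVec f f)⁻¹ *ᵥ y
      = S⁻¹ *ᵥ y - ((f ⬝ᵥ S⁻¹ *ᵥ y) / (1 + f ⬝ᵥ S⁻¹ *ᵥ f)) • (S⁻¹ *ᵥ f) := by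
  have hP : (S + vecMulVec f f).PosDef :=
    hS.add_posSemidef (by simpa using posSemidef_vecMulVec_self_star f)
  have hdet : IsUnit S.det := (isUnit_iff_isUnit_det S).1 hS.isUnit
  have hdet' : IsUnit (S + vecMulVec f f).det := (isUnit_iff_isUnit_det _).1 hP.isUnit
  have hu : 0 ≤ f ⬝ᵥ S⁻¹ *ᵥ f := quadForm_nonneg hS.inv.posSemidef f
  have h : (S + vecMulVec f f) *ᵥ
      (S⁻¹ *ᵥ y - ((f ⬝ᵥ S⁻¹ *ᵥ y) / (1 + f ⬝ᵥ S⁻¹ *ᵥ f)) • (S⁻¹ *ᵥ f)) = y := by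
    have e : ∀ z : n → ℝ, vecMulVec f f *ᵥ z = (f ⬝ᵥ z) • f := by
      intro z; rw [vecMulVec_mulVec]; ext i; simp [mul_comm]
    rw [mulVec_sub, mulVec_smul, add_mulVec, add_mulVec, e, e, mulVec_mulVec, mulVec_mulVec,
      mul_nonsing_inv _ hdet, one_mulVec, one_mulVec]
    ext i
    simp only [Pi.add_apply, Pi.sub_apply, Pi.smul_apply, smul_eq_mul]
    field_simp
    ring
  conv_lhs => rw [← h]
  rw [mulVec_mulVec, nonsing_inv_mul _ hdet', one_mulVec]

-- Matrix determinant lemma. It turns `log det Σ_t` into a sum over rounds, the link between feature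
-- widths and determinants.
open Matrix in
theorem det_add_vecMulVec {n : Type*} [Fintype n] [DecidableEq n] {S : Matrix n n ℝ}
    (hS : S.PosDef) (f : n → ℝ) :
    (S + vecMulVec f f).det = S.det * (1 + f ⬝ᵥ S⁻¹ *ᵥ f) := by
  have hdet : IsUnit S.det := (isUnit_iff_isUnit_det S).1 hS.isUnit
  have h := det_add_replicateCol_mul_replicateRow (ι := Unit) hdet f f
  rw [← vecMulVec_eq] at h
  rw [h, det_unique (n := Unit)]
  congr 2
  rw [Matrix.mul_assoc, ← replicateCol_mulVec]
  simp [Matrix.add_apply, Matrix.mul_apply, dotProduct]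

open Matrix in
/-- Change of the dual quadratic form under a rank-one update of matrix and vector. -/
theorem quadForm_inv_update {n : Type*} [Fintype n] [DecidableEq n] {S : Matrix n n ℝ}
    (hS : S.PosDef) (f s : n → ℝ) (e : ℝ) :
    (s + e • f) ⬝ᵥ (S + vecMulVec f f)⁻¹ *ᵥ (s + e • f)
      = s ⬝ᵥ S⁻¹ *ᵥ s + (2 * e * (f ⬝ᵥ S⁻¹ *ᵥ s) + e ^ 2 * (f ⬝ᵥ S⁻¹ *ᵥ f)
          - (f ⬝ᵥ S⁻¹ *ᵥ s) ^ 2) / (1 + f ⬝ᵥ S⁻¹ *ᵥ f) := by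
  have hu : 0 ≤ f ⬝ᵥ S⁻¹ *ᵥ f := quadForm_nonneg hS.inv.posSemidef f
  have hc := dotProduct_mulVec_comm_of_isHermitian hS.inv.isHermitian s f
  rw [inv_add_vecMulVec_mulVec hS]
  simp only [mulVec_add, mulVec_smul, dotProduct_add, add_dotProduct, dotProduct_smul,
    smul_dotProduct, smul_eq_mul, dotProduct_sub, hc]
  field_simp
  ring

/-! ### The regularized Gram matrix -/

section Gram

variable {d : ℕ} (f : ℕ → Vec d)

theorem gram_zero : gram f 0 = 1 := by simp [gram]

theorem gram_succ (t : ℕ) :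
    gram f (t + 1) = gram f t + Matrix.vecMulVec (f (t + 1)).ofLp (f (t + 1)).ofLp := by
  rw [gram, gram, Finset.sum_Icc_succ_top (by omega), add_assoc]

theorem posSemidef_sum_vecMulVec (t : ℕ) :
    (∑ s ∈ Finset.Icc 1 t, Matrix.vecMulVec (f s).ofLp (f s).ofLp).PosSemidef :=
  Matrix.posSemidef_sum _ fun s _ => by
    simpa using Matrix.posSemidef_vecMulVec_self_star (f s).ofLp

theorem gram_posDef (t : ℕ) : (gram f t).PosDef :=
  Matrix.PosDef.one.add_posSemidef (posSemidef_sum_vecMulVec f t)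

theorem isUnit_det_gram (t : ℕ) : IsUnit (gram f t).det :=
  (Matrix.isUnit_iff_isUnit_det _).1 (gram_posDef f t).isUnit

/-- The squared width `f_tᵀ Σ_{t-1}⁻¹ f_t` of the feature of round `t`. -/
noncomputable def featureWidth (t : ℕ) : ℝ := (f t).ofLp ⬝ᵥ (gram f (t - 1))⁻¹.mulVec (f t).ofLp

theorem quadForm_gram_inv_nonneg (t : ℕ) (x : Fin d → ℝ) :
    0 ≤ x ⬝ᵥ (gram f t)⁻¹.mulVec x :=
  quadForm_nonneg (gram_posDef f t).inv.posSemidef x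

theorem ofLp_dotProduct_self (x : Vec d) : x.ofLp ⬝ᵥ x.ofLp = ‖x‖ ^ 2 := by
  rw [EuclideanSpace.real_norm_sq_eq]
  simp [dotProduct, sq]

theorem quadForm_gram_inv_le (t : ℕ) (x : Vec d) :
    x.ofLp ⬝ᵥ (gram f t)⁻¹.mulVec x.ofLp ≤ ‖x‖ ^ 2 := by
  rw [← ofLp_dotProduct_self]
  exact quadForm_inv_one_add_le (posSemidef_sum_vecMulVec f t) x.ofLp

theorem det_gram_succ (t : ℕ) :
    (gram f (t + 1)).det = (gram f t).det * (1 + featureWidth f (t + 1)) := by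
  rw [gram_succ, det_add_vecMulVec (gram_posDef f t)]; rfl

theorem one_le_det_gram (t : ℕ) : 1 ≤ (gram f t).det := by
  induction t with
  | zero => simp [gram_zero]
  | succ t ih =>
    rw [det_gram_succ]
    have : 0 ≤ featureWidth f (t + 1) := quadForm_gram_inv_nonneg f t _
    nlinarith

theorem log_det_gram (t : ℕ) :
    Real.log (gram f t).det = ∑ s ∈ Finset.Icc 1 t, Real.log (1 + featureWidth f s) := by
  induction t with
  | zero => simp [gram_zero]
  | succ t ih =>
    have : 0 ≤ featureWidth f (t + 1) := quadForm_gram_inv_nonneg f t _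
    rw [det_gram_succ, Real.log_mul (by linarith [one_le_det_gram f t]) (by linarith), ih,
      Finset.sum_Icc_succ_top (by omega)]

theorem trace_gram (t : ℕ) : (gram f t).trace = d + ∑ s ∈ Finset.Icc 1 t, ‖f s‖ ^ 2 := by
  simp only [gram, Matrix.trace_add, Matrix.trace_one, Matrix.trace_sum, Fintype.card_fin,
    Matrix.trace_vecMulVec, ofLp_dotProduct_self]

/-- Determinant-trace inequality. -/
theorem log_det_gram_le (hd : 0 < d) (t : ℕ) (hf : ∀ s ∈ Finset.Icc 1 t, ‖f s‖ ≤ 1) :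
    Real.log (gram f t).det ≤ d * Real.log ((d + t) / d) := by
  have hH := (gram_posDef f t).isHermitian
  have hd' : (0 : ℝ) < d := by exact_mod_cast hd
  have hpos : ∀ i, 0 < hH.eigenvalues i := (gram_posDef f t).eigenvalues_pos
  have hdet : (gram f t).det = ∏ i, hH.eigenvalues i := by
    simpa using hH.det_eq_prod_eigenvalues
  have htr : (gram f t).trace = ∑ i, hH.eigenvalues i := by
    simpa using hH.trace_eq_sum_eigenvalues
  have hle : (gram f t).trace ≤ d + t := by
    rw [trace_gram]
    have : ∑ s ∈ Finset.Icc 1 t, ‖f s‖ ^ 2 ≤ ∑ s ∈ Finset.Icc 1 t, (1 : ℝ) :=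
      Finset.sum_le_sum fun s hs => by
        have := hf s hs
        have := norm_nonneg (f s)
        nlinarith
    simp at this
    linarith
  -- Jensen for `log` over the eigenvalues with equal weights `1/d`, which is the inequality between
  -- arithmetic and geometric means.
  have hjensen := (strictConcaveOn_log_Ioi.concaveOn).le_map_sum (t := Finset.univ)
    (w := fun _ : Fin d => (1 : ℝ) / d) (p := hH.eigenvalues) (fun _ _ => by positivity)
    (by simp; field_simp) (fun i _ => hpos i)
  simp only [smul_eq_mul, ← Finset.mul_sum] at hjensen
  rw [hdet, Real.log_prod fun i _ => (hpos i).ne']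
  have h2 : Real.log (1 / d * ∑ i, hH.eigenvalues i) ≤ Real.log ((d + t) / d) := by
    apply Real.log_le_log
    · have : 0 < ∑ i, hH.eigenvalues i :=
        Finset.sum_pos (fun i _ => hpos i) ⟨⟨0, hd⟩, Finset.mem_univ _⟩
      positivity
    · rw [← htr, div_mul_eq_mul_div, one_mul]; gcongr
  have h3 := hjensen.trans h2
  rw [div_mul_eq_mul_div, one_mul, div_le_iff₀ hd'] at h3
  linarith

/-- Elliptical potential lemma. -/
theorem sum_featureWidth_le (hd : 0 < d) (t : ℕ) (hf : ∀ s ∈ Finset.Icc 1 t, ‖f s‖ ≤ 1) :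
    ∑ s ∈ Finset.Icc 1 t, featureWidth f s ≤ 3 / 2 * (d * Real.log ((d + t) / d)) := by
  refine le_trans ?_ (mul_le_mul_of_nonneg_left (log_det_gram_le f hd t hf) (by norm_num))
  rw [log_det_gram, Finset.mul_sum]
  refine Finset.sum_le_sum fun s hs => ?_
  have h0 : 0 ≤ featureWidth f s := quadForm_gram_inv_nonneg f _ _
  have h1 : featureWidth f s ≤ 1 := by
    have h := quadForm_gram_inv_le f (s - 1) (f s)
    have := hf s hs
    have := norm_nonneg (f s)
    unfold featureWidth
    nlinarith
  have h2 := Real.le_log_one_add_of_nonneg h0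
  -- Widths lie in `[0, 1]`, where `log(1+x) ≥ 2x/(x+2) ≥ 2x/3`; this is the origin of the factor
  -- `3/2`.
  have h3 : 2 / 3 * featureWidth f s ≤ 2 * featureWidth f s / (featureWidth f s + 2) := by
    rw [le_div_iff₀ (by linarith)]
    nlinarith
  linarith

end Gram

/-! ### Mixtures of conditional exponential bounds -/

section Mixture

/-- Averaging `exp(le - l²/2)` over `l ∼ N(v, u)`. The right side is exactly the one-step factor of
`expPotential`, with `v` the projected noise and `u` the feature width, so the vector-valued
supermartingale property reduces to scalar exponents `l`. -/
theorem gaussian_mixture (e v u : ℝ) (hu : 0 ≤ u) :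
    ∫⁻ g, ENNReal.ofReal (Real.exp ((v + √u * g) * e - (v + √u * g) ^ 2 / 2)) ∂(gaussianReal 0 1)
      = ENNReal.ofReal (Real.exp ((2 * e * v + e ^ 2 * u - v ^ 2) / (2 * (1 + u))) / √(1 + u)) := by
  have h1u : 0 < 1 + u := by linarith
  let s : NNReal := Real.toNNReal (1 + u)⁻¹
  have hs0 : s ≠ 0 := (Real.toNNReal_pos.2 (inv_pos.2 h1u)).ne'
  have hsc : (s : ℝ) = (1 + u)⁻¹ := Real.coe_toNNReal _ (inv_pos.2 h1u).le
  rw [gaussianReal_of_var_ne_zero _ one_ne_zero,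
    lintegral_withDensity_eq_lintegral_mul _ (measurable_gaussianPDF 0 1) (by fun_prop)]
  have hpt : ∀ g : ℝ, (gaussianPDF 0 1 * fun g => ENNReal.ofReal
      (Real.exp ((v + √u * g) * e - (v + √u * g) ^ 2 / 2))) g
      = ENNReal.ofReal (Real.exp ((2 * e * v + e ^ 2 * u - v ^ 2) / (2 * (1 + u))) / √(1 + u))
        * gaussianPDF (√u * (e - v) / (1 + u)) s g := by
    intro g
    simp only [Pi.mul_apply, gaussianPDF]
    rw [← ENNReal.ofReal_mul (gaussianPDFReal_nonneg _ _ _), ← ENNReal.ofReal_mul (by positivity)]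
    congr 1
    simp only [gaussianPDFReal, hsc, NNReal.coe_one, mul_one, sub_zero]
    rw [mul_assoc, ← Real.exp_add]
    have h2 : √(2 * Real.pi * (1 + u)⁻¹) = √(2 * Real.pi) / √(1 + u) := by
      rw [← div_eq_mul_inv, Real.sqrt_div (by positivity)]
    have h3 : √(1 + u) ≠ 0 := (Real.sqrt_pos.2 h1u).ne'
    have h4 : √(2 * Real.pi) ≠ 0 := (Real.sqrt_pos.2 (by positivity)).ne'
    rw [h2, inv_div, div_mul_eq_mul_div, mul_left_comm, ← mul_assoc, mul_assoc _ (Real.exp _),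
      ← Real.exp_add]
    -- Completing the square in `g`: the integrand is a constant times the density of a Gaussian of
    -- variance `1/(1+u)`.
    have h5 : -g ^ 2 / 2 + ((v + √u * g) * e - (v + √u * g) ^ 2 / 2)
        = (2 * e * v + e ^ 2 * u - v ^ 2) / (2 * (1 + u)) +
          -(g - √u * (e - v) / (1 + u)) ^ 2 / (2 * (1 + u)⁻¹) := by
      have hsq : √u ^ 2 = u := Real.sq_sqrt hu
      set q := √u with hq
      rw [← hsq]
      have : 1 + q ^ 2 ≠ 0 := by positivity
      field_simp
      ring
    rw [h5]
    field_simp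
  rw [lintegral_congr hpt, lintegral_const_mul _ (measurable_gaussianPDF _ _),
    lintegral_gaussianPDF_eq_one _ hs0, mul_one]

variable {Ω : Type*} {m mΩ : MeasurableSpace Ω} {P : Measure Ω} [IsProbabilityMeasure P]
  {ξ : Ω → ℝ}

/-- Restricted to `m`, the measure with density `exp(lξ - l²/2)` is dominated by `P`: on each set of
`m` this is the integrated conditional moment bound. Integrating an `m`-measurable `F` sees only
these restrictions, so `F` need not be integrable. -/
theorem IsCondSubGaussian.lintegral_mul_exp_const_le (hm : m ≤ mΩ)
    (hξ : IsCondSubGaussian P m ξ) (hξm : Measurable[mΩ] ξ) (l : ℝ) {F : Ω → ENNReal}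
    (hF : Measurable[m] F) :
    ∫⁻ ω, F ω * ENNReal.ofReal (Real.exp (l * ξ ω - l ^ 2 / 2)) ∂P ≤ ∫⁻ ω, F ω ∂P := by
  have hh : Measurable[mΩ] fun ω => ENNReal.ofReal (Real.exp (l * ξ ω - l ^ 2 / 2)) := by fun_prop
  have h1 : ∫⁻ ω, F ω * ENNReal.ofReal (Real.exp (l * ξ ω - l ^ 2 / 2)) ∂P
      = ∫⁻ ω, F ω ∂(P.withDensity fun ω => ENNReal.ofReal (Real.exp (l * ξ ω - l ^ 2 / 2))) := by
    rw [lintegral_withDensity_eq_lintegral_mul _ hh (hF.mono hm le_rfl)]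
    simp only [Pi.mul_apply, mul_comm]
  rw [h1, ← lintegral_trim hm hF, ← lintegral_trim hm hF]
  refine lintegral_mono' ?_ le_rfl
  rw [@Measure.le_iff]
  intro s hs
  rw [trim_measurableSet_eq hm hs, trim_measurableSet_eq hm hs, withDensity_apply _ (hm s hs)]
  have hint : Integrable (fun ω => Real.exp (l * ξ ω - l ^ 2 / 2)) P := by
    simp only [sub_eq_add_neg, Real.exp_add]
    exact (hξ.integrable_exp l).mul_const _
  rw [← ofReal_integral_eq_lintegral_ofReal hint.integrableOn
    (Filter.Eventually.of_forall fun ω => (Real.exp_pos _).le)]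
  have h2 : ∫ ω in s, Real.exp (l * ξ ω - l ^ 2 / 2) ∂P ≤ (P s).toReal := by
    have h3 : ∫ ω in s, Real.exp (l * ξ ω) ∂P ≤ Real.exp (l ^ 2 / 2) * (P s).toReal := by
      rw [← setIntegral_condExp hm (hξ.integrable_exp l) hs]
      calc ∫ ω in s, (P[fun ω => Real.exp (l * ξ ω) | m]) ω ∂P
          ≤ ∫ ω in s, Real.exp (l ^ 2 / 2) ∂P :=
            setIntegral_mono_ae integrable_condExp.integrableOn (integrable_const _).integrableOn
              (hξ.condExp_exp_le l)
        _ = _ := by simp [Measure.real, mul_comm]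
    simp only [sub_eq_add_neg, Real.exp_add]
    rw [integral_mul_const, Real.exp_neg, ← div_eq_mul_inv, div_le_iff₀ (Real.exp_pos _)]
    linarith
  calc ENNReal.ofReal (∫ ω in s, Real.exp (l * ξ ω - l ^ 2 / 2) ∂P)
      ≤ ENNReal.ofReal (P s).toReal := ENNReal.ofReal_le_ofReal h2
    _ = P s := ENNReal.ofReal_toReal (measure_ne_top _ _)

/-- A random exponent with countably many values is constant on each piece of an `m`-measurable
partition. -/
theorem IsCondSubGaussian.lintegral_mul_exp_countable_le {ι : Type*} [Countable ι]
    [MeasurableSpace ι] [MeasurableSingletonClass ι] (hm : m ≤ mΩ)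
    (hξ : IsCondSubGaussian P m ξ) (hξm : Measurable[mΩ] ξ) (l : ι → ℝ) {k : Ω → ι}
    (hk : Measurable[m] k) {F : Ω → ENNReal} (hF : Measurable[m] F) :
    ∫⁻ ω, F ω * ENNReal.ofReal (Real.exp (l (k ω) * ξ ω - l (k ω) ^ 2 / 2)) ∂P
      ≤ ∫⁻ ω, F ω ∂P := by
  have hset : ∀ j, MeasurableSet[m] (k ⁻¹' {j}) := fun j => hk (measurableSet_singleton j)
  have hFj : ∀ j, Measurable[m] ((k ⁻¹' {j}).indicator F) := fun j => hF.indicator (hset j)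
  have hsum : ∀ ω, ∀ w : ι → ENNReal, ∑' j, (k ⁻¹' {j}).indicator F ω * w j = F ω * w (k ω) := by
    intro ω w
    rw [tsum_eq_single (k ω)]
    · simp
    · intro j hj
      simp [Set.indicator, hj.symm]
  calc ∫⁻ ω, F ω * ENNReal.ofReal (Real.exp (l (k ω) * ξ ω - l (k ω) ^ 2 / 2)) ∂P
      = ∫⁻ ω, ∑' j, (k ⁻¹' {j}).indicator F ω
          * ENNReal.ofReal (Real.exp (l j * ξ ω - l j ^ 2 / 2)) ∂P :=
        lintegral_congr fun ω =>
          (hsum ω fun j => ENNReal.ofReal (Real.exp (l j * ξ ω - l j ^ 2 / 2))).symm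
    _ = ∑' j, ∫⁻ ω, (k ⁻¹' {j}).indicator F ω
          * ENNReal.ofReal (Real.exp (l j * ξ ω - l j ^ 2 / 2)) ∂P :=
        lintegral_tsum fun j => (((hFj j).mono hm le_rfl).mul (by fun_prop)).aemeasurable
    _ ≤ ∑' j, ∫⁻ ω, (k ⁻¹' {j}).indicator F ω ∂P :=
        ENNReal.tsum_le_tsum fun j => hξ.lintegral_mul_exp_const_le hm hξm (l j) (hFj j)
    _ = ∫⁻ ω, F ω ∂P := by
        rw [← lintegral_tsum fun j => ((hFj j).mono hm le_rfl).aemeasurable]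
        refine lintegral_congr fun ω => ?_
        simpa using hsum ω fun _ => 1

/-- Rounding `l` down to multiples of `1/(n+1)` gives countably many values; Fatou's lemma passes to
the limit. -/
theorem IsCondSubGaussian.lintegral_mul_exp_le (hm : m ≤ mΩ)
    (hξ : IsCondSubGaussian P m ξ) (hξm : Measurable[mΩ] ξ) {l : Ω → ℝ} (hl : Measurable[m] l)
    {F : Ω → ENNReal} (hF : Measurable[m] F) :
    ∫⁻ ω, F ω * ENNReal.ofReal (Real.exp (l ω * ξ ω - l ω ^ 2 / 2)) ∂P ≤ ∫⁻ ω, F ω ∂P := by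
  let a : ℕ → Ω → ℝ := fun n ω => (⌊((n : ℝ) + 1) * l ω⌋ : ℝ) / (n + 1)
  have ha : ∀ ω, Filter.Tendsto (fun n => a n ω) Filter.atTop (nhds (l ω)) := by
    intro ω
    have h0 : Filter.Tendsto (fun n : ℕ => l ω - 1 / ((n : ℝ) + 1)) Filter.atTop (nhds (l ω)) := by
      simpa using (tendsto_const_nhds (x := l ω)).sub (tendsto_one_div_add_atTop_nhds_zero_nat (𝕜 := ℝ))
    refine tendsto_of_tendsto_of_tendsto_of_le_of_le h0 tendsto_const_nhds (fun n => ?_) fun n => ?_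
    · have hn : (0 : ℝ) < n + 1 := by positivity
      have := Int.lt_floor_add_one (((n : ℝ) + 1) * l ω)
      simp only [a]
      rw [le_div_iff₀ hn, sub_mul, div_mul_cancel₀ _ hn.ne']
      linarith
    · have hn : (0 : ℝ) < n + 1 := by positivity
      have := Int.floor_le (((n : ℝ) + 1) * l ω)
      simp only [a]
      rw [div_le_iff₀ hn]
      linarith
  have hlim : ∀ ω, Filter.Tendsto
      (fun n => F ω * ENNReal.ofReal (Real.exp (a n ω * ξ ω - a n ω ^ 2 / 2))) Filter.atTop
      (nhds (F ω * ENNReal.ofReal (Real.exp (l ω * ξ ω - l ω ^ 2 / 2)))) := by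
    intro ω
    refine ENNReal.Tendsto.const_mul (ENNReal.tendsto_ofReal ?_)
      (Or.inl (ENNReal.ofReal_pos.2 (Real.exp_pos _)).ne')
    exact (Real.continuous_exp.tendsto _).comp
      (((ha ω).mul_const _).sub (((ha ω).pow 2).div_const 2))
  have ham : ∀ n, Measurable[m] (a n) := fun n => by
    have h1 : Measurable[m] fun ω => ((n : ℝ) + 1) * l ω := hl.const_mul _
    exact (measurable_from_top.comp (Int.measurable_floor.comp h1)).div_const _
  calc ∫⁻ ω, F ω * ENNReal.ofReal (Real.exp (l ω * ξ ω - l ω ^ 2 / 2)) ∂P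
      = ∫⁻ ω, Filter.liminf (fun n => F ω * ENNReal.ofReal
          (Real.exp (a n ω * ξ ω - a n ω ^ 2 / 2))) Filter.atTop ∂P :=
        lintegral_congr fun ω => (hlim ω).liminf_eq.symm
    _ ≤ Filter.liminf (fun n => ∫⁻ ω, F ω * ENNReal.ofReal
          (Real.exp (a n ω * ξ ω - a n ω ^ 2 / 2)) ∂P) Filter.atTop := by
        refine lintegral_liminf_le fun n => (hF.mono hm le_rfl).mul ?_
        have := (ham n).mono hm le_rfl
        fun_prop
    _ ≤ ∫⁻ ω, F ω ∂P := by
        refine Filter.liminf_le_of_le (by isBoundedDefault) fun b hb => ?_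
        obtain ⟨n, hn⟩ := hb.exists
        refine hn.trans ?_
        have h1 : Measurable[m] fun ω => ((n : ℝ) + 1) * l ω := hl.const_mul _
        exact hξ.lintegral_mul_exp_countable_le hm hξm (fun j : ℤ => (j : ℝ) / ((n : ℝ) + 1))
          (Int.measurable_floor.comp h1) hF

/-- By Tonelli the Gaussian parameter can be frozen first; the exponent `v + √u g` is then
`m`-measurable. -/
theorem IsCondSubGaussian.lintegral_mul_mixture_le (hm : m ≤ mΩ)
    (hξ : IsCondSubGaussian P m ξ) (hξm : Measurable[mΩ] ξ) {u v : Ω → ℝ} (hu : Measurable[m] u)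
    (hu0 : ∀ ω, 0 ≤ u ω) (hv : Measurable[m] v) {F : Ω → ENNReal} (hF : Measurable[m] F) :
    ∫⁻ ω, F ω * ENNReal.ofReal
      (Real.exp ((2 * ξ ω * v ω + ξ ω ^ 2 * u ω - v ω ^ 2) / (2 * (1 + u ω))) / √(1 + u ω)) ∂P
      ≤ ∫⁻ ω, F ω ∂P := by
  have hu' := hu.mono hm le_rfl
  have hv' := hv.mono hm le_rfl
  have hF' := hF.mono hm le_rfl
  calc _ = ∫⁻ ω, ∫⁻ g, F ω * ENNReal.ofReal (Real.exp ((v ω + √(u ω) * g) * ξ ω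
          - (v ω + √(u ω) * g) ^ 2 / 2)) ∂(gaussianReal 0 1) ∂P := by
        refine lintegral_congr fun ω => ?_
        rw [lintegral_const_mul _ (by fun_prop), gaussian_mixture _ _ _ (hu0 ω)]
    _ = ∫⁻ g, ∫⁻ ω, F ω * ENNReal.ofReal (Real.exp ((v ω + √(u ω) * g) * ξ ω
          - (v ω + √(u ω) * g) ^ 2 / 2)) ∂P ∂(gaussianReal 0 1) := by
        refine lintegral_lintegral_swap (Measurable.aemeasurable ?_)
        simp only [Function.uncurry_def]
        fun_prop
    _ ≤ ∫⁻ _g, ∫⁻ ω, F ω ∂P ∂(gaussianReal 0 1) := by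
        refine lintegral_mono fun g => hξ.lintegral_mul_exp_le hm hξm ?_ hF
        exact hv.add ((Real.continuous_sqrt.measurable.comp hu).mul_const g)
    _ = ∫⁻ ω, F ω ∂P := by simp

theorem IsCondSubGaussian.integral_eq_zero (hm : m ≤ mΩ) (h : IsCondSubGaussian P m ξ) :
    ∫ ω, ξ ω ∂P = 0 := by
  rw [← integral_condExp hm, integral_congr_ae h.condExp_eq_zero]
  simp

end Mixture

/-! ### Measurability of matrix expressions -/

section MatrixMeasurability

variable {α n : Type*} {mα : MeasurableSpace α} [Fintype n]

theorem measurable_dotProduct_mulVec {S : α → Matrix n n ℝ} {x y : α → n → ℝ}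
    (hS : ∀ i j, Measurable fun a => S a i j) (hx : ∀ i, Measurable fun a => x a i)
    (hy : ∀ i, Measurable fun a => y a i) :
    Measurable fun a => x a ⬝ᵥ (S a).mulVec (y a) := by
  simp only [dotProduct, Matrix.mulVec]
  exact Finset.measurable_sum _ fun i _ => (hx i).mul
    (Finset.measurable_sum _ fun j _ => (hS i j).mul (hy j))

variable [DecidableEq n]

theorem measurable_det {A : α → Matrix n n ℝ} (hA : ∀ i j, Measurable fun a => A a i j) :
    Measurable fun a => (A a).det := by
  simp only [Matrix.det_apply]
  refine Finset.measurable_sum _ fun σ _ => ?_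
  exact (Finset.measurable_prod _ fun i _ => hA _ _).const_smul _

/-- The inverse is the adjugate over the determinant, and both are polynomial in the entries. -/
theorem measurable_inv_apply {A : α → Matrix n n ℝ} (hA : ∀ i j, Measurable fun a => A a i j)
    (i j : n) : Measurable fun a => (A a)⁻¹ i j := by
  simp only [Matrix.inv_def, Matrix.smul_apply, Matrix.adjugate_apply, Ring.inverse_eq_inv',
    smul_eq_mul]
  refine (measurable_det hA).inv.mul (measurable_det fun k l => ?_)
  by_cases hk : k = j
  · subst hk
    simp only [Matrix.updateRow_self]
    exact measurable_const
  · simp only [Matrix.updateRow_ne hk]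
    exact hA k l

theorem measurable_gram_apply {d t : ℕ} {f : ℕ → α → Vec d}
    (hf : ∀ s ∈ Finset.Icc 1 t, ∀ i, Measurable fun a => f s a i) (i j : Fin d) :
    Measurable fun a => gram (fun s => f s a) t i j := by
  simp only [gram, Matrix.add_apply, Matrix.sum_apply, Matrix.vecMulVec_apply]
  exact measurable_const.add (Finset.measurable_sum _ fun s hs => (hf s hs i).mul (hf s hs j))

end MatrixMeasurability

/-! ### Self-normalized martingale bound -/

section SelfNormalized

variable {d : ℕ}

/-- The noise accumulated in the directions of the features. -/
def noiseSum (f : ℕ → Vec d) (e : ℕ → ℝ) (t : ℕ) : Fin d → ℝ :=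
  ∑ s ∈ Finset.Icc 1 t, e s • (f s).ofLp

theorem noiseSum_succ (f : ℕ → Vec d) (e : ℕ → ℝ) (t : ℕ) :
    noiseSum f e (t + 1) = noiseSum f e t + e (t + 1) • (f (t + 1)).ofLp := by
  rw [noiseSum, noiseSum, Finset.sum_Icc_succ_top (by omega)]

/-- The exponential potential `exp(‖S_t‖²_{Σ_t⁻¹} / 2) / √(det Σ_t)`. -/
noncomputable def expPotential (f : ℕ → Vec d) (e : ℕ → ℝ) (t : ℕ) : ℝ :=
  Real.exp (noiseSum f e t ⬝ᵥ (gram f t)⁻¹.mulVec (noiseSum f e t) / 2) / √(gram f t).det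

theorem expPotential_zero (f : ℕ → Vec d) (e : ℕ → ℝ) : expPotential f e 0 = 1 := by
  simp [expPotential, noiseSum, gram_zero]

theorem expPotential_nonneg (f : ℕ → Vec d) (e : ℕ → ℝ) (t : ℕ) : 0 ≤ expPotential f e t := by
  unfold expPotential; positivity

/-- The projection of the accumulated noise on the next feature. -/
noncomputable def noiseProj (f : ℕ → Vec d) (e : ℕ → ℝ) (t : ℕ) : ℝ :=
  (f t).ofLp ⬝ᵥ (gram f (t - 1))⁻¹.mulVec (noiseSum f e (t - 1))

theorem featureWidth_nonneg (f : ℕ → Vec d) (t : ℕ) : 0 ≤ featureWidth f t :=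
  quadForm_gram_inv_nonneg f _ _

theorem expPotential_succ (f : ℕ → Vec d) (e : ℕ → ℝ) (t : ℕ) :
    expPotential f e (t + 1) = expPotential f e t *
      (Real.exp ((2 * e (t + 1) * noiseProj f e (t + 1) + e (t + 1) ^ 2 * featureWidth f (t + 1)
        - noiseProj f e (t + 1) ^ 2) / (2 * (1 + featureWidth f (t + 1))))
        / √(1 + featureWidth f (t + 1))) := by
  have hu := featureWidth_nonneg f (t + 1)
  unfold expPotential
  rw [det_gram_succ, noiseSum_succ, gram_succ, quadForm_inv_update (gram_posDef f t),
    Real.sqrt_mul (by linarith [one_le_det_gram f t]), div_mul_div_comm, ← Real.exp_add]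
  congr 2
  simp only [featureWidth, noiseProj, Nat.add_sub_cancel] at hu ⊢
  field_simp

/-- A bound on the potential is a bound on the self-normalized noise. -/
theorem quadForm_noiseSum_le {f : ℕ → Vec d} {e : ℕ → ℝ} {t : ℕ} {a : ℝ} (ha : 0 < a)
    (h : expPotential f e t ≤ a) :
    noiseSum f e t ⬝ᵥ (gram f t)⁻¹.mulVec (noiseSum f e t)
      ≤ 2 * Real.log a + Real.log (gram f t).det := by
  have hdet : 0 < (gram f t).det := by linarith [one_le_det_gram f t]
  unfold expPotential at h
  rw [div_le_iff₀ (Real.sqrt_pos.2 hdet)] at h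
  have h2 := Real.log_le_log (Real.exp_pos _) h
  rw [Real.log_exp, Real.log_mul ha.ne' (Real.sqrt_pos.2 hdet).ne', Real.log_sqrt hdet.le] at h2
  linarith

section Measurability

variable {α : Type*} {mα : MeasurableSpace α} {f : ℕ → α → Vec d} {e : ℕ → α → ℝ} {t : ℕ}

theorem measurable_noiseSum_apply
    (hf : ∀ s ∈ Finset.Icc 1 t, ∀ i, Measurable fun a => f s a i)
    (he : ∀ s ∈ Finset.Icc 1 t, Measurable (e s)) (i : Fin d) :
    Measurable fun a => noiseSum (fun s => f s a) (fun s => e s a) t i := by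
  simp only [noiseSum, Finset.sum_apply, Pi.smul_apply, smul_eq_mul]
  exact Finset.measurable_sum _ fun s hs => (he s hs).mul (hf s hs i)

theorem measurable_gram_inv_apply
    (hf : ∀ s ∈ Finset.Icc 1 t, ∀ i, Measurable fun a => f s a i) (i j : Fin d) :
    Measurable fun a => (gram (fun s => f s a) t)⁻¹ i j :=
  measurable_inv_apply (measurable_gram_apply hf) i j

theorem measurable_expPotential
    (hf : ∀ s ∈ Finset.Icc 1 t, ∀ i, Measurable fun a => f s a i)
    (he : ∀ s ∈ Finset.Icc 1 t, Measurable (e s)) :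
    Measurable fun a => expPotential (fun s => f s a) (fun s => e s a) t := by
  unfold expPotential
  have h1 := measurable_noiseSum_apply hf he
  exact ((measurable_dotProduct_mulVec (measurable_gram_inv_apply hf) h1 h1).div_const 2).exp.div
    (Real.continuous_sqrt.measurable.comp (measurable_det (measurable_gram_apply hf)))

theorem measurable_featureWidth
    (hf : ∀ s ∈ Finset.Icc 1 (t + 1), ∀ i, Measurable fun a => f s a i) :
    Measurable fun a => featureWidth (fun s => f s a) (t + 1) := by
  have h1 : ∀ i, Measurable fun a => f (t + 1) a i := hf (t + 1) (by simp)
  exact measurable_dotProduct_mulVec (measurable_gram_inv_apply fun s hs =>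
    hf s (by simp only [Finset.mem_Icc] at hs ⊢; omega)) h1 h1

theorem measurable_noiseProj
    (hf : ∀ s ∈ Finset.Icc 1 (t + 1), ∀ i, Measurable fun a => f s a i)
    (he : ∀ s ∈ Finset.Icc 1 t, Measurable (e s)) :
    Measurable fun a => noiseProj (fun s => f s a) (fun s => e s a) (t + 1) := by
  have h1 : ∀ i, Measurable fun a => f (t + 1) a i := hf (t + 1) (by simp)
  have h2 : ∀ s ∈ Finset.Icc 1 t, ∀ i, Measurable fun a => f s a i := fun s hs =>
    hf s (by simp only [Finset.mem_Icc] at hs ⊢; omega)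
  exact measurable_dotProduct_mulVec (measurable_gram_inv_apply h2) h1
    (measurable_noiseSum_apply h2 he)

end Measurability

/-- Maximal inequality for the exponential potential of conditionally sub-Gaussian noise. -/
theorem measure_expPotential_gt_le {Ω : Type*} [mΩ : MeasurableSpace Ω] {P : Measure Ω}
    [IsProbabilityMeasure P] {n : ℕ} (m : ℕ → MeasurableSpace Ω) (f : ℕ → Ω → Vec d)
    (e : ℕ → Ω → ℝ) (hm : ∀ t ∈ Finset.Icc 1 n, m t ≤ mΩ)
    (hf : ∀ t ∈ Finset.Icc 1 n, ∀ s ∈ Finset.Icc 1 t, ∀ i, Measurable[m t] fun ω => f s ω i)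
    (he : ∀ t ∈ Finset.Icc 1 n, ∀ s ∈ Finset.Icc 1 (t - 1), Measurable[m t] (e s))
    (he' : ∀ t ∈ Finset.Icc 1 n, Measurable (e t))
    (hsub : ∀ t ∈ Finset.Icc 1 n, IsCondSubGaussian P (m t) (e t)) {a : ℝ} (ha : 1 ≤ a) :
    ENNReal.ofReal a *
      P {ω | ∃ t ≤ n, a < expPotential (fun s => f s ω) (fun s => e s ω) t} ≤ 1 := by
  let M : ℕ → Ω → ℝ := fun t ω => expPotential (fun s => f s ω) (fun s => e s ω) t
  let N : ℕ → Set Ω := fun k => {ω | ∀ t ≤ k, M t ω ≤ a}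
  have hN0 : N 0 = Set.univ := by
    ext ω
    simp only [N, Set.mem_ofPred_eq, Set.mem_univ, iff_true]
    intro t ht
    obtain rfl : t = 0 := by omega
    simp only [M, expPotential_zero]; exact ha
  have hNsucc : ∀ k, N (k + 1) = N k ∩ {ω | M (k + 1) ω ≤ a} := by
    intro k
    ext ω
    simp only [N, Set.mem_ofPred_eq, Set.mem_inter_iff]
    constructor
    · exact fun h => ⟨fun t ht => h t (by omega), h _ le_rfl⟩
    · rintro ⟨h1, h2⟩ t ht
      rcases Nat.lt_or_ge t (k + 1) with h | h
      · exact h1 t (by omega)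
      · obtain rfl : t = k + 1 := by omega
        exact h2
  have hMm : ∀ k, k + 1 ≤ n → ∀ t ≤ k, Measurable[m (k + 1)] (M t) := by
    intro k hk t ht
    refine measurable_expPotential (fun s hs i => hf (k + 1) ?_ s ?_ i) fun s hs => he (k + 1) ?_ s ?_
    all_goals simp only [Finset.mem_Icc] at *; omega
  have hNm : ∀ k, k + 1 ≤ n → MeasurableSet[m (k + 1)] (N k) := by
    intro k hk
    have : N k = ⋂ t, ⋂ (_ : t ≤ k), {ω | M t ω ≤ a} := by
      ext ω; simp [N]
    rw [this]
    exact MeasurableSet.iInter fun t => MeasurableSet.iInter fun ht =>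
      measurableSet_le (hMm k hk t ht) measurable_const
  have hMm' : ∀ k ≤ n, Measurable (M k) := by
    intro k hk
    refine measurable_expPotential (fun s hs i => (hf s ?_ s ?_ i).mono (hm s ?_) le_rfl)
      fun s hs => he' s ?_
    all_goals simp only [Finset.mem_Icc] at *; omega
  -- Ville's inequality by induction, with the stopped process unfolded: `N k` is the event that
  -- level `a` has not been exceeded up to time `k`, and the mass that leaves it is charged at value
  -- `a`.
  have key : ∀ k ≤ n, ∫⁻ ω in N k, ENNReal.ofReal (M k ω) ∂P + ENNReal.ofReal a * P (N k)ᶜ ≤ 1 := by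
    intro k
    induction k with
    | zero =>
      intro _
      simp [hN0, M, expPotential_zero]
    | succ k ih =>
      intro hk
      have hk1 : k + 1 ∈ Finset.Icc 1 n := by simp; omega
      refine le_trans ?_ (ih (by omega))
      have hNk := hm _ hk1 _ (hNm k hk)
      have hG : MeasurableSet {ω | M (k + 1) ω ≤ a} := measurableSet_le (hMm' _ hk) measurable_const
      -- Supermartingale step: `N k`, the feature of round `k + 1` and the earlier noise are all `m
      -- (k + 1)`-measurable, so only the new noise is averaged.
      have step : ∫⁻ ω in N k, ENNReal.ofReal (M (k + 1) ω) ∂P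
          ≤ ∫⁻ ω in N k, ENNReal.ofReal (M k ω) ∂P := by
        rw [← lintegral_indicator hNk, ← lintegral_indicator hNk]
        have h := (hsub _ hk1).lintegral_mul_mixture_le (hm _ hk1) (he' _ hk1)
          (measurable_featureWidth (t := k) fun s hs i => hf (k + 1) hk1 s hs i)
          (fun ω => featureWidth_nonneg _ _)
          (measurable_noiseProj (t := k) (fun s hs i => hf (k + 1) hk1 s hs i)
            fun s hs => he (k + 1) hk1 s hs)
          (F := (N k).indicator fun ω => ENNReal.ofReal (M k ω))
          ((ENNReal.measurable_ofReal.comp (hMm k hk k le_rfl)).indicator (hNm k hk))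
        refine le_trans (lintegral_mono fun ω => ?_) h
        by_cases hω : ω ∈ N k
        · simp only [Set.indicator_of_mem hω, M]
          rw [expPotential_succ, ENNReal.ofReal_mul (expPotential_nonneg _ _ _)]
        · simp [hω]
      have hsplit : (N (k + 1))ᶜ = (N k)ᶜ ∪ (N k \ {ω | M (k + 1) ω ≤ a}) := by
        rw [hNsucc]; ext ω; simp; tauto
      have hcross : ENNReal.ofReal a * P (N k \ {ω | M (k + 1) ω ≤ a})
          ≤ ∫⁻ ω in N k \ {ω | M (k + 1) ω ≤ a}, ENNReal.ofReal (M (k + 1) ω) ∂P := by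
        rw [← setLIntegral_const]
        refine setLIntegral_mono' (hNk.diff hG) fun ω hω => ENNReal.ofReal_le_ofReal ?_
        have := hω.2
        simp only [Set.mem_ofPred_eq, not_le] at this
        exact this.le
      calc ∫⁻ ω in N (k + 1), ENNReal.ofReal (M (k + 1) ω) ∂P + ENNReal.ofReal a * P (N (k + 1))ᶜ
          ≤ ∫⁻ ω in N k ∩ {ω | M (k + 1) ω ≤ a}, ENNReal.ofReal (M (k + 1) ω) ∂P
            + (ENNReal.ofReal a * P (N k)ᶜ
              + ∫⁻ ω in N k \ {ω | M (k + 1) ω ≤ a}, ENNReal.ofReal (M (k + 1) ω) ∂P) := by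
            rw [hsplit, ← hNsucc]
            gcongr
            refine (mul_le_mul_right (measure_union_le _ _) _).trans ?_
            rw [mul_add]
            gcongr
        _ = ∫⁻ ω in N k, ENNReal.ofReal (M (k + 1) ω) ∂P + ENNReal.ofReal a * P (N k)ᶜ := by
            rw [← lintegral_inter_add_sdiff _ (N k) hG]; ring
        _ ≤ _ := by gcongr
  have h := key n le_rfl
  have hset : {ω | ∃ t ≤ n, a < expPotential (fun s => f s ω) (fun s => e s ω) t} = (N n)ᶜ := by
    ext ω; simp [N, M]
  rw [hset]
  exact le_trans le_add_self h

end SelfNormalized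

/-! ### Confidence sets -/

section ConfidenceSet

variable {d : ℕ}

theorem inner_eq_dotProduct (x y : Vec d) : inner ℝ x y = x.ofLp ⬝ᵥ y.ofLp := by
  rw [EuclideanSpace.inner_eq_star_dotProduct, dotProduct_comm]; simp

/-- The width `‖x‖_{Σ_{t-1}⁻¹}` of the confidence interval of round `t` in direction `x`. -/
noncomputable def confWidth (f : ℕ → Vec d) (t : ℕ) (x : Vec d) : ℝ :=
  √(x.ofLp ⬝ᵥ (gram f (t - 1))⁻¹.mulVec x.ofLp)

theorem confWidth_nonneg (f : ℕ → Vec d) (t : ℕ) (x : Vec d) : 0 ≤ confWidth f t x :=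
  Real.sqrt_nonneg _

theorem radius_nonneg (d T t : ℕ) : 0 ≤ radius d T t := by unfold radius; positivity

/-- Substituting `y_s = ⟨θ, f_s⟩ + e_s` and `∑ f_s f_sᵀ = Σ_t - I`. The leftover `-θ` is the bias
caused by regularization. -/
theorem sum_smul_eq (f : ℕ → Vec d) (y : ℕ → ℝ) (θ : Vec d) (t : ℕ) :
    ∑ s ∈ Finset.Icc 1 t, y s • (f s).ofLp
      = noiseSum f (fun s => y s - inner ℝ θ (f s)) t + (gram f t).mulVec θ.ofLp - θ.ofLp := by
  have h : (gram f t).mulVec θ.ofLp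
      = θ.ofLp + ∑ s ∈ Finset.Icc 1 t, (inner ℝ θ (f s)) • (f s).ofLp := by
    rw [gram, Matrix.add_mulVec, Matrix.one_mulVec, Matrix.sum_mulVec]
    congr 1
    refine Finset.sum_congr rfl fun s _ => ?_
    rw [Matrix.vecMulVec_mulVec, inner_eq_dotProduct, dotProduct_comm]
    ext i; simp [mul_comm]
  rw [h, noiseSum]
  simp only [sub_smul, Finset.sum_sub_distrib]
  abel

open Matrix in
theorem quadForm_gram_inv_mulVec (f : ℕ → Vec d) (t : ℕ) (z : Fin d → ℝ) :
    ((gram f t)⁻¹ *ᵥ z) ⬝ᵥ gram f t *ᵥ ((gram f t)⁻¹ *ᵥ z) = z ⬝ᵥ (gram f t)⁻¹ *ᵥ z := by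
  rw [mulVec_mulVec, mul_nonsing_inv _ (isUnit_det_gram f t), one_mulVec, dotProduct_comm]

open Matrix in
/-- The parameter lies in the confidence set as long as the exponential potential is at most `T`. -/
theorem mem_confidenceSet {T t : ℕ} (hd : 0 < d) (hT : 0 < T) (ht : 1 ≤ t) {f : ℕ → Vec d}
    {y : ℕ → ℝ} {θ : Vec d} (hθ : ‖θ‖ ≤ 1) (hf : ∀ s ∈ Finset.Icc 1 (t - 1), ‖f s‖ ≤ 1)
    (h : expPotential f (fun s => y s - inner ℝ θ (f s)) (t - 1) ≤ T) :
    θ ∈ confidenceSet T f y t := by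
  have hS := quadForm_noiseSum_le (by exact_mod_cast hT) h
  have hdet := log_det_gram_le f hd (t - 1) hf
  set S := noiseSum f (fun s => y s - inner ℝ θ (f s)) (t - 1) with hSdef
  -- Hence the error has `Σ`-norm at most `‖θ‖ + ‖S‖`, both in the norm of `Σ⁻¹`. The first part is
  -- at most `1`; the second is controlled by the potential at level `T` and the determinant, which
  -- together give the radius.
  have hdiff : (θ - estimate f y (t - 1)).ofLp = (gram f (t - 1))⁻¹ *ᵥ (θ.ofLp + -S) := by
    rw [estimate, sum_smul_eq f y θ, ← hSdef]
    simp only [WithLp.ofLp_sub, mulVec_sub, mulVec_add, mulVec_mulVec,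
      nonsing_inv_mul _ (isUnit_det_gram f (t - 1)), one_mulVec, mulVec_neg]
    abel
  have hcast : ((t - 1 : ℕ) : ℝ) = (t : ℝ) - 1 := by push_cast [ht]; ring
  change weightedNorm _ _ ≤ _
  rw [weightedNorm, hdiff, quadForm_gram_inv_mulVec]
  refine (sqrt_quadForm_add_le (gram_posDef f _).inv.posSemidef _ _).trans ?_
  unfold radius
  gcongr
  · rw [Real.sqrt_le_one]
    have := quadForm_gram_inv_le f (t - 1) θ
    have := norm_nonneg θ
    nlinarith
  · simp only [mulVec_neg, dotProduct_neg, neg_dotProduct, neg_neg]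
    rw [← hcast]
    linarith

open Matrix in
theorem abs_inner_sub_le {T t : ℕ} {f : ℕ → Vec d} {y : ℕ → ℝ} {v : Vec d}
    (hv : v ∈ confidenceSet T f y t) (x : Vec d) :
    |inner ℝ v x - inner ℝ (estimate f y (t - 1)) x| ≤ radius d T t * confWidth f t x := by
  rw [← inner_sub_left, inner_eq_dotProduct]
  refine (abs_dotProduct_le_sqrt_mul_sqrt (gram_posDef f (t - 1)) _ _).trans ?_
  exact mul_le_mul_of_nonneg_right hv (confWidth_nonneg f t x)

open Matrix in
/-- The ends of the confidence interval are attained. -/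
theorem exists_mem_confidenceSet_inner_eq (T t : ℕ) (f : ℕ → Vec d) (y : ℕ → ℝ) (x : Vec d)
    {σ : ℝ} (hσ : σ ^ 2 = 1) :
    ∃ v ∈ confidenceSet T f y t, inner ℝ v x
      = inner ℝ (estimate f y (t - 1)) x + σ * (radius d T t * confWidth f t x) := by
  have hq := quadForm_gram_inv_nonneg f (t - 1) x.ofLp
  have hρ := radius_nonneg d T t
  have hw := confWidth_nonneg f t x
  have hw2 : confWidth f t x ^ 2 = x.ofLp ⬝ᵥ (gram f (t - 1))⁻¹ *ᵥ x.ofLp := Real.sq_sqrt hq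
  -- The extreme point of the ellipsoid in direction `±x`. If the width is zero, division by zero
  -- returns `0` and the center itself serves.
  refine ⟨estimate f y (t - 1) + (σ * (radius d T t / confWidth f t x)) •
    WithLp.toLp 2 ((gram f (t - 1))⁻¹ *ᵥ x.ofLp), ?_, ?_⟩
  · change weightedNorm _ _ ≤ _
    rw [add_sub_cancel_left, weightedNorm]
    simp only [WithLp.ofLp_smul, mulVec_smul, dotProduct_smul, smul_dotProduct, smul_eq_mul]
    rw [quadForm_gram_inv_mulVec, ← hw2]
    refine Real.sqrt_le_iff.2 ⟨hρ, ?_⟩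
    rcases hw.eq_or_lt with h | h
    · rw [← h]; simp; positivity
    · have : σ * (radius d T t / confWidth f t x) * (σ * (radius d T t / confWidth f t x)
          * confWidth f t x ^ 2) = σ ^ 2 * radius d T t ^ 2 := by field_simp
      rw [this, hσ, one_mul]
  · rw [inner_add_left, inner_smul_left, inner_eq_dotProduct (WithLp.toLp 2 ((gram f (t - 1))⁻¹ *ᵥ x.ofLp))]
    simp only [conj_trivial]
    rw [dotProduct_comm ((gram f (t - 1))⁻¹ *ᵥ x.ofLp), ← hw2]
    rcases hw.eq_or_lt with h | h
    · rw [← h]; simp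
    · field_simp

theorem sSup_inner_confidenceSet (T t : ℕ) (f : ℕ → Vec d) (y : ℕ → ℝ) (x : Vec d) :
    sSup ((fun v : Vec d => inner ℝ v x) '' confidenceSet T f y t)
      = inner ℝ (estimate f y (t - 1)) x + radius d T t * confWidth f t x := by
  refine IsGreatest.csSup_eq ⟨?_, ?_⟩
  · obtain ⟨v, hv, h⟩ := exists_mem_confidenceSet_inner_eq T t f y x (σ := 1) (by norm_num)
    exact ⟨v, hv, h.trans (by rw [one_mul])⟩
  · rintro _ ⟨v, hv, rfl⟩
    have := (abs_le.1 (abs_inner_sub_le hv x)).2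
    dsimp only
    linarith

theorem sInf_inner_confidenceSet (T t : ℕ) (f : ℕ → Vec d) (y : ℕ → ℝ) (x : Vec d) :
    sInf ((fun v : Vec d => inner ℝ v x) '' confidenceSet T f y t)
      = inner ℝ (estimate f y (t - 1)) x - radius d T t * confWidth f t x := by
  refine IsLeast.csInf_eq ⟨?_, ?_⟩
  · obtain ⟨v, hv, h⟩ := exists_mem_confidenceSet_inner_eq T t f y x (σ := -1) (by norm_num)
    exact ⟨v, hv, h.trans (by ring)⟩
  · rintro _ ⟨v, hv, rfl⟩
    have := (abs_le.1 (abs_inner_sub_le hv x)).1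
    dsimp only
    linarith

section Measurability

variable {α : Type*} {mα : MeasurableSpace α} {f : ℕ → α → Vec d} {y : ℕ → α → ℝ} {t : ℕ}

theorem measurable_inner_estimate
    (hf : ∀ s ∈ Finset.Icc 1 (t - 1), ∀ i, Measurable fun a => f s a i)
    (hy : ∀ s ∈ Finset.Icc 1 (t - 1), Measurable (y s)) (x : Vec d) :
    Measurable fun a => (inner ℝ (estimate (fun s => f s a) (fun s => y s a) (t - 1)) x : ℝ) := by
  simp only [inner_eq_dotProduct, estimate]
  simp only [dotProduct_comm _ x.ofLp]
  refine measurable_dotProduct_mulVec (measurable_gram_inv_apply hf) (fun _ => measurable_const)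
    fun i => ?_
  simp only [Finset.sum_apply, Pi.smul_apply, smul_eq_mul]
  exact Finset.measurable_sum _ fun s hs => (hy s hs).mul (hf s hs i)

theorem measurable_confWidth
    (hf : ∀ s ∈ Finset.Icc 1 (t - 1), ∀ i, Measurable fun a => f s a i) (x : Vec d) :
    Measurable fun a => confWidth (fun s => f s a) t x :=
  Real.continuous_sqrt.measurable.comp (measurable_dotProduct_mulVec
    (measurable_gram_inv_apply hf) (fun _ => measurable_const) fun _ => measurable_const)

theorem measurable_sInf_inner_confidenceSet (T : ℕ)
    (hf : ∀ s ∈ Finset.Icc 1 (t - 1), ∀ i, Measurable fun a => f s a i)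
    (hy : ∀ s ∈ Finset.Icc 1 (t - 1), Measurable (y s)) (x : Vec d) :
    Measurable fun a => sInf ((fun v : Vec d => (inner ℝ v x : ℝ)) ''
      confidenceSet T (fun s => f s a) (fun s => y s a) t) := by
  simp only [sInf_inner_confidenceSet]
  exact (measurable_inner_estimate hf hy x).sub ((measurable_confWidth hf x).const_mul _)

end Measurability

/-- The confidence widths along a trajectory add up to at most `O(d √t log t)`. -/
theorem sum_radius_mul_confWidth_le (hd : 0 < d) {T n : ℕ} (hn : n ≤ T) (f : ℕ → Vec d)
    (hf : ∀ s ∈ Finset.Icc 1 n, ‖f s‖ ≤ 1) :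
    ∑ t ∈ Finset.Icc 1 n, 2 * (radius d T t * confWidth f t (f t))
      ≤ 2 * ((1 + √((2 + d) * Real.log (1 + T))) * √(3 / 2 * (d * n * Real.log (1 + T)))) := by
  have hd1 : (1 : ℝ) ≤ d := by exact_mod_cast hd
  have hL : 0 ≤ Real.log (1 + T) := Real.log_nonneg (by linarith [Nat.cast_nonneg (α := ℝ) T])
  have hlog : ∀ a : ℝ, 0 ≤ a → a ≤ T → Real.log ((d + a) / d) ≤ Real.log (1 + T) := by
    intro a ha haT
    refine Real.log_le_log (by positivity) ?_
    rw [add_div, div_self (by positivity)]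
    have : a / d ≤ a := div_le_self ha hd1
    linarith
  have hrad : ∀ t ∈ Finset.Icc 1 n, radius d T t ≤ 1 + √((2 + d) * Real.log (1 + T)) := by
    intro t ht
    rw [Finset.mem_Icc] at ht
    have h1 : (1 : ℝ) ≤ t := by exact_mod_cast ht.1
    have h2 : (t : ℝ) ≤ T := by exact_mod_cast ht.2.trans hn
    unfold radius
    gcongr
    have h3 : Real.log T ≤ Real.log (1 + T) := Real.log_le_log (by linarith) (by linarith)
    have h4 := hlog ((t : ℝ) - 1) (by linarith) (by linarith)
    nlinarith
  have hcs : ∑ t ∈ Finset.Icc 1 n, confWidth f t (f t)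
      ≤ √(3 / 2 * (d * n * Real.log (1 + T))) := by
    apply Real.le_sqrt_of_sq_le
    -- Cauchy–Schwarz trades the sum of widths for the sum of their squares, which the elliptical
    -- potential lemma bounds.
    have h1 := sq_sum_le_card_mul_sum_sq (s := Finset.Icc 1 n) (f := fun t => confWidth f t (f t))
    have h2 : ∀ t, confWidth f t (f t) ^ 2 = featureWidth f t := fun t =>
      Real.sq_sqrt (featureWidth_nonneg f t)
    simp only [h2, Nat.card_Icc, Nat.add_sub_cancel] at h1
    have h3 := sum_featureWidth_le f hd n hf
    have h4 := hlog n (by positivity) (by exact_mod_cast hn)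
    calc _ ≤ (n : ℝ) * ∑ t ∈ Finset.Icc 1 n, featureWidth f t := h1
      _ ≤ n * (3 / 2 * (d * Real.log (1 + T))) := by
        gcongr
        exact h3.trans (by gcongr)
      _ = _ := by ring
  calc ∑ t ∈ Finset.Icc 1 n, 2 * (radius d T t * confWidth f t (f t))
      ≤ ∑ t ∈ Finset.Icc 1 n, 2 * ((1 + √((2 + d) * Real.log (1 + T))) * confWidth f t (f t)) := by
        refine Finset.sum_le_sum fun t ht => ?_
        have := confWidth_nonneg f t (f t)
        have := hrad t ht
        gcongr
    _ = 2 * ((1 + √((2 + d) * Real.log (1 + T))) * ∑ t ∈ Finset.Icc 1 n, confWidth f t (f t)) := by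
        simp only [Finset.mul_sum]
    _ ≤ _ := by gcongr

end ConfidenceSet

/-! ### The algorithm along one trajectory -/

section Trajectory

variable {X : Type*} {J d : ℕ} (M : Model X J d) (T : ℕ)

theorem log_one_add_nonneg (T : ℕ) : 0 ≤ Real.log (1 + T) :=
  Real.log_nonneg (by linarith [Nat.cast_nonneg (α := ℝ) T])

theorem tightness_nonneg (d T t : ℕ) : 0 ≤ tightness d T t := by
  have := log_one_add_nonneg T
  unfold tightness; positivity

theorem weight_pos {d T t : ℕ} {δ : ℝ} (hd : 0 < d) (hT : 0 < T) (hδ : 0 < δ) (ht : 1 ≤ t) :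
    0 < weight d T δ t := by
  have h1 : (0 : ℝ) < T := by exact_mod_cast hT
  have := Real.log_pos (x := 1 + (T : ℝ)) (by linarith)
  have h2 : (0 : ℝ) < t := by exact_mod_cast ht
  have h3 : (0 : ℝ) < d := by exact_mod_cast hd
  unfold weight; positivity

theorem weight_mono {d T : ℕ} {δ : ℝ} (hδ : 0 ≤ δ) {s t : ℕ} (hst : s ≤ t) :
    weight d T δ s ≤ weight d T δ t := by
  have := log_one_add_nonneg T
  unfold weight
  gcongr

/-- The confidence sets of the rounds `1, …, t` contain the parameters because both noise potentials
have stayed below `T` in the rounds before `t`. -/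
def IsGood (c : ℕ → X) (A : ℕ → Fin J) (R W : ℕ → ℝ) (t : ℕ) : Prop :=
  ∀ s < t,
    expPotential (fun s => M.phi (c s) (A s)) (fun s => R s - M.meanReward (c s) (A s)) s ≤ T ∧
    expPotential (fun s => M.psi (c s) (A s)) (fun s => W s - M.meanCost (c s) (A s)) s ≤ T

variable {M T} {c : ℕ → X} {A : ℕ → Fin J} {R W : ℕ → ℝ}

theorem IsGood.anti {s t : ℕ} (hst : s ≤ t) (h : IsGood M T c A R W t) : IsGood M T c A R W s :=
  fun k hk => h k (hk.trans_le hst)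

theorem IsGood.thetaStar_mem (hM : M.Bounded) (hd : 0 < d) (hT : 0 < T) {t : ℕ} (ht : 1 ≤ t)
    (h : IsGood M T c A R W t) :
    M.thetaStar ∈ confidenceSet T (fun s => M.phi (c s) (A s)) R t :=
  mem_confidenceSet hd hT ht hM.norm_thetaStar_le (fun _ _ => hM.norm_phi_le _ _)
    (h (t - 1) (by omega)).1

theorem IsGood.muStar_mem (hM : M.Bounded) (hd : 0 < d) (hT : 0 < T) {t : ℕ} (ht : 1 ≤ t)
    (h : IsGood M T c A R W t) :
    M.muStar ∈ confidenceSet T (fun s => M.psi (c s) (A s)) W t :=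
  mem_confidenceSet hd hT ht hM.norm_muStar_le (fun _ _ => hM.norm_psi_le _ _)
    (h (t - 1) (by omega)).2

theorem rewardEstimate_le_one (t : ℕ) (x : X) (j : Fin J) : rewardEstimate M T c A R t x j ≤ 1 :=
  min_le_left _ _

theorem neg_one_le_costEstimate (t : ℕ) (x : X) (j : Fin J) :
    -1 ≤ costEstimate M T c A W t x j := le_max_left _ _

theorem costEstimate_le_one (t : ℕ) (x : X) (j : Fin J) : costEstimate M T c A W t x j ≤ 1 :=
  max_le (by norm_num) (min_le_left _ _)

theorem IsGood.meanReward_le_rewardEstimate (hM : M.Bounded) (hd : 0 < d) (hT : 0 < T) {t : ℕ}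
    (ht : 1 ≤ t) (h : IsGood M T c A R W t) (x : X) (j : Fin J) :
    M.meanReward x j ≤ rewardEstimate M T c A R t x j := by
  refine le_min (hM.meanReward_mem x j).2 ?_
  rw [sSup_inner_confidenceSet]
  have := (abs_le.1 (abs_inner_sub_le (h.thetaStar_mem hM hd hT ht) (M.phi x j))).2
  unfold Model.meanReward
  linarith

theorem IsGood.rewardEstimate_le (hM : M.Bounded) (hd : 0 < d) (hT : 0 < T) {t : ℕ}
    (ht : 1 ≤ t) (h : IsGood M T c A R W t) (x : X) (j : Fin J) :
    rewardEstimate M T c A R t x j ≤ M.meanReward x j +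
      2 * (radius d T t * confWidth (fun s => M.phi (c s) (A s)) t (M.phi x j)) := by
  refine (min_le_right _ _).trans ?_
  rw [sSup_inner_confidenceSet]
  have := (abs_le.1 (abs_inner_sub_le (h.thetaStar_mem hM hd hT ht) (M.phi x j))).1
  unfold Model.meanReward
  linarith

theorem IsGood.costEstimate_le_meanCost (hM : M.Bounded) (hd : 0 < d) (hT : 0 < T) {t : ℕ}
    (ht : 1 ≤ t) (h : IsGood M T c A R W t) (x : X) (j : Fin J) :
    costEstimate M T c A W t x j ≤ M.meanCost x j := by
  refine max_le (hM.meanCost_mem x j).1 ((min_le_right _ _).trans ?_)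
  rw [sInf_inner_confidenceSet]
  have := (abs_le.1 (abs_inner_sub_le (h.muStar_mem hM hd hT ht) (M.psi x j))).1
  unfold Model.meanCost
  linarith

/-- Truncation of the estimate at `1` does no harm since the mean cost is at most `1`; truncation at
`-1` only raises the estimate. -/
theorem IsGood.meanCost_le (hM : M.Bounded) (hd : 0 < d) (hT : 0 < T) {t : ℕ}
    (ht : 1 ≤ t) (h : IsGood M T c A R W t) (x : X) (j : Fin J) :
    M.meanCost x j ≤ costEstimate M T c A W t x j +
      2 * (radius d T t * confWidth (fun s => M.psi (c s) (A s)) t (M.psi x j)) := by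
  have hw : 0 ≤ radius d T t * confWidth (fun s => M.psi (c s) (A s)) t (M.psi x j) :=
    mul_nonneg (radius_nonneg _ _ _) (confWidth_nonneg _ _ _)
  have h1 := (abs_le.1 (abs_inner_sub_le (h.muStar_mem hM hd hT ht) (M.psi x j))).2
  have h2 := (hM.meanCost_mem x j).2
  rw [← sub_le_iff_le_add]
  refine le_trans (le_min ?_ ?_) (le_max_right _ _)
  · linarith
  · rw [sInf_inner_confidenceSet]
    unfold Model.meanCost at h2 ⊢
    linarith

theorem dual_nonneg (t : ℕ) : 0 ≤ dual M T c A W t := by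
  match t with
  | 0 => simp [dual]
  | 1 => simp [dual]
  | t + 2 => exact le_max_right _ _

theorem dual_succ {t : ℕ} (ht : 1 ≤ t) : dual M T c A W (t + 1) = max (dual M T c A W t
    + costEstimate M T c A W t (c t) (A t) + tightness d T t) 0 := by
  obtain ⟨t, rfl⟩ := Nat.exists_eq_add_of_le' ht
  rfl

/-! ### Sums of the tightness and growth of the dual variable -/

theorem one_div_sqrt_le (t : ℕ) : 1 / √((t : ℝ) + 1) ≤ 2 * (√((t : ℝ) + 1) - √(t : ℝ)) := by
  have h1 : 0 < √((t : ℝ) + 1) := by positivity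
  have h2 := Real.sq_sqrt (show (0 : ℝ) ≤ (t : ℝ) + 1 by positivity)
  have h3 := Real.sq_sqrt (show (0 : ℝ) ≤ (t : ℝ) by positivity)
  rw [div_le_iff₀ h1]
  nlinarith [sq_nonneg (√((t : ℝ) + 1) - √(t : ℝ))]

theorem two_mul_sub_sqrt_le (t : ℕ) :
    2 * (√((t : ℝ) + 2) - √((t : ℝ) + 1)) ≤ 1 / √((t : ℝ) + 1) := by
  have h1 : 0 < √((t : ℝ) + 1) := by positivity
  have h2 := Real.sq_sqrt (show (0 : ℝ) ≤ (t : ℝ) + 1 by positivity)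
  have h3 := Real.sq_sqrt (show (0 : ℝ) ≤ (t : ℝ) + 2 by positivity)
  rw [le_div_iff₀ h1]
  nlinarith [sq_nonneg (√((t : ℝ) + 2) - √((t : ℝ) + 1))]

theorem sum_one_div_sqrt_le (n : ℕ) : ∑ t ∈ Finset.Icc 1 n, 1 / √(t : ℝ) ≤ 2 * √(n : ℝ) := by
  induction n with
  | zero => simp
  | succ n ih =>
    rw [Finset.sum_Icc_succ_top (by omega)]
    have := one_div_sqrt_le n
    push_cast at this ⊢
    linarith

theorem le_sum_one_div_sqrt (n : ℕ) :
    2 * (√(n : ℝ) - 1) ≤ ∑ t ∈ Finset.Icc 1 n, 1 / √(t : ℝ) := by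
  -- The induction closes for the stronger bound with `n + 1` under the root, as `1/√t` dominates
  -- the increment from `t` to `t + 1`.
  have h : 2 * (√((n : ℝ) + 1) - 1) ≤ ∑ t ∈ Finset.Icc 1 n, 1 / √(t : ℝ) := by
    induction n with
    | zero => simp
    | succ n ih =>
      rw [Finset.sum_Icc_succ_top (by omega)]
      have := two_mul_sub_sqrt_le n
      push_cast at this ⊢
      rw [add_assoc, one_add_one_eq_two]
      linarith
  refine le_trans ?_ h
  gcongr
  linarith

theorem tightness_eq (d T t : ℕ) : tightness d T t = 4 * d * Real.log (1 + T) * (1 / √(t : ℝ)) := by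
  rw [tightness, mul_one_div]

theorem sum_tightness_le (d T n : ℕ) :
    ∑ t ∈ Finset.Icc 1 n, tightness d T t ≤ 8 * d * Real.log (1 + T) * √n := by
  simp only [tightness_eq, ← Finset.mul_sum]
  have h := sum_one_div_sqrt_le n
  have hL := log_one_add_nonneg T
  calc _ ≤ 4 * d * Real.log (1 + T) * (2 * √(n : ℝ)) := by gcongr
    _ = _ := by ring

theorem le_sum_tightness (d T n : ℕ) :
    8 * d * Real.log (1 + T) * (√n - 1) ≤ ∑ t ∈ Finset.Icc 1 n, tightness d T t := by
  simp only [tightness_eq, ← Finset.mul_sum]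
  have h := le_sum_one_div_sqrt n
  have hL := log_one_add_nonneg T
  calc _ = 4 * d * Real.log (1 + T) * (2 * (√(n : ℝ) - 1)) := by ring
    _ ≤ _ := by gcongr

/-- Crude bound valid on every trajectory: estimated costs are at most `1`. It makes moments of `Q`
finite and covers the rounds where no drift is available. -/
theorem dual_succ_le (t : ℕ) :
    dual M T c A W (t + 1) ≤ t + 8 * d * Real.log (1 + T) * √(t : ℝ) := by
  refine le_trans ?_ (add_le_add_right (sum_tightness_le d T t) _)
  induction t with
  | zero => simp [dual]
  | succ t ih =>
    rw [dual_succ (by omega), Finset.sum_Icc_succ_top (by omega)]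
    have h1 := costEstimate_le_one (M := M) (T := T) (c := c) (A := A) (W := W) (t + 1) (c (t + 1))
      (A (t + 1))
    have h2 : 0 ≤ ∑ s ∈ Finset.Icc 1 t, tightness d T s :=
      Finset.sum_nonneg fun _ _ => tightness_nonneg _ _ _
    have h3 := tightness_nonneg d T (t + 1)
    push_cast
    refine max_le (by linarith) (by positivity)

theorem dual_le {t : ℕ} (ht : 1 ≤ t) :
    dual M T c A W t ≤ t + 8 * d * Real.log (1 + T) * √(t : ℝ) := by
  obtain ⟨t, rfl⟩ := Nat.exists_eq_add_of_le' ht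
  refine (dual_succ_le t).trans ?_
  have hL := log_one_add_nonneg T
  push_cast
  gcongr <;> linarith

/-- Quadratic drift of the dual variable. -/
theorem sq_dual_succ_le {t : ℕ} (ht : 1 ≤ t) :
    dual M T c A W (t + 1) ^ 2 ≤ dual M T c A W t ^ 2
      + 2 * dual M T c A W t * (costEstimate M T c A W t (c t) (A t) + tightness d T t)
      + (1 + tightness d T t) ^ 2 := by
  rw [dual_succ ht]
  have h1 := neg_one_le_costEstimate (M := M) (T := T) (c := c) (A := A) (W := W) t (c t) (A t)
  have h2 := costEstimate_le_one (M := M) (T := T) (c := c) (A := A) (W := W) t (c t) (A t)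
  have h3 := tightness_nonneg d T t
  have h4 : (max (dual M T c A W t + costEstimate M T c A W t (c t) (A t) + tightness d T t) 0) ^ 2
      ≤ (dual M T c A W t + costEstimate M T c A W t (c t) (A t) + tightness d T t) ^ 2 := by
    rcases max_choice (dual M T c A W t + costEstimate M T c A W t (c t) (A t)
      + tightness d T t) 0 with h | h <;> rw [h]
    simp only [ne_eq, OfNat.ofNat_ne_zero, not_false_eq_true, zero_pow]
    positivity
  nlinarith

/-! ### Policies on a single context -/

namespace Model

/-- Mean reward of a policy on a context. -/
noncomputable def contextReward (M : Model X J d) (x : X → Fin J → ℝ) (C : X) : ℝ :=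
  ∑ j, M.meanReward C j * x C j

/-- Mean cost of a policy on a context. -/
noncomputable def contextCost (M : Model X J d) (x : X → Fin J → ℝ) (C : X) : ℝ :=
  ∑ j, M.meanCost C j * x C j

theorem contextReward_mem (hM : M.Bounded) {x : X → Fin J → ℝ} (hx : IsPolicy x) (C : X) :
    M.contextReward x C ∈ Set.Icc (0 : ℝ) 1 := by
  constructor
  · exact Finset.sum_nonneg fun j _ => mul_nonneg (hM.meanReward_mem C j).1 ((hx C).1 j)
  · rw [← (hx C).2]
    exact Finset.sum_le_sum fun j _ =>
      mul_le_of_le_one_left ((hx C).1 j) (hM.meanReward_mem C j).2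

theorem contextCost_mem (hM : M.Bounded) {x : X → Fin J → ℝ} (hx : IsPolicy x) (C : X) :
    M.contextCost x C ∈ Set.Icc (-1 : ℝ) 1 := by
  constructor
  · rw [← (hx C).2, ← Finset.sum_neg_distrib]
    refine Finset.sum_le_sum fun j _ => ?_
    have := mul_le_mul_of_nonneg_right (hM.meanCost_mem C j).1 ((hx C).1 j)
    linarith
  · rw [← (hx C).2]
    exact Finset.sum_le_sum fun j _ =>
      mul_le_of_le_one_left ((hx C).1 j) (hM.meanCost_mem C j).2

end Model

/-- In a good round the action of the algorithm is at least as good, for the estimated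
action-values, as any policy for the true ones. -/
theorem IsGood.le_pseudoValue (hM : M.Bounded) (hd : 0 < d) (hT : 0 < T) {δ : ℝ} (hδ : 0 < δ)
    {t : ℕ} (ht : t ∈ Finset.Icc 1 T) (h : IsGood M T c A R W t)
    (hA : FollowsAlgorithm M T δ c A R W) {x : X → Fin J → ℝ} (hx : Model.IsPolicy x) :
    M.contextReward x (c t) - dual M T c A W t / weight d T δ t * M.contextCost x (c t)
      ≤ rewardEstimate M T c A R t (c t) (A t)
        - dual M T c A W t / weight d T δ t * costEstimate M T c A W t (c t) (A t) := by
  have ht1 : 1 ≤ t := (Finset.mem_Icc.1 ht).1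
  have hq : 0 ≤ dual M T c A W t / weight d T δ t :=
    div_nonneg (dual_nonneg t) (weight_pos hd hT hδ ht1).le
  set q := dual M T c A W t / weight d T δ t with hqdef
  have hpv : ∀ j, pseudoValue M T δ c A R W t (c t) j
      = rewardEstimate M T c A R t (c t) j - q * costEstimate M T c A W t (c t) j := by
    intro j
    rw [pseudoValue, hqdef]; ring
  rw [← hpv]
  calc M.contextReward x (c t) - q * M.contextCost x (c t)
      = ∑ j, (M.meanReward (c t) j - q * M.meanCost (c t) j) * x (c t) j := by
        rw [Model.contextReward, Model.contextCost, Finset.mul_sum, ← Finset.sum_sub_distrib]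
        exact Finset.sum_congr rfl fun j _ => by ring
    _ ≤ ∑ j, pseudoValue M T δ c A R W t (c t) (A t) * x (c t) j := by
        refine Finset.sum_le_sum fun j _ => mul_le_mul_of_nonneg_right ?_ ((hx (c t)).1 j)
        refine le_trans ?_ (hA t ht j)
        rw [hpv]
        have h1 := h.meanReward_le_rewardEstimate hM hd hT ht1 (c t) j
        have h2 := h.costEstimate_le_meanCost hM hd hT ht1 (c t) j
        have h3 := mul_le_mul_of_nonneg_left h2 hq
        linarith
    _ = pseudoValue M T δ c A R W t (c t) (A t) := by rw [← Finset.mul_sum, (hx (c t)).2, mul_one]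

end Trajectory

/-! ### Measurability with respect to the history -/

section History

variable {X Ω : Type*} {J d : ℕ} [MeasurableSpace X] {c : ℕ → Ω → X} {A : ℕ → Ω → Fin J}
  {R W : ℕ → Ω → ℝ}

theorem comap_le_history {s t : ℕ} (hs : s ∈ Finset.Ico 1 t) :
    MeasurableSpace.comap (fun ω => (c s ω, A s ω, R s ω, W s ω)) inferInstance
      ≤ history c A R W t :=
  le_iSup₂_of_le s hs le_rfl

theorem measurable_history_tuple {s t : ℕ} (hs : s ∈ Finset.Ico 1 t) :
    Measurable[history c A R W t] fun ω => (c s ω, A s ω, R s ω, W s ω) :=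
  measurable_iff_comap_le.2 (comap_le_history hs)

theorem measurable_history_context {s t : ℕ} (hs : s ∈ Finset.Ico 1 t) :
    Measurable[history c A R W t] (c s) := (measurable_history_tuple hs).fst

theorem measurable_history_action {s t : ℕ} (hs : s ∈ Finset.Ico 1 t) :
    Measurable[history c A R W t] (A s) := (measurable_history_tuple hs).snd.fst

theorem measurable_history_reward {s t : ℕ} (hs : s ∈ Finset.Ico 1 t) :
    Measurable[history c A R W t] (R s) := (measurable_history_tuple hs).snd.snd.fst

theorem measurable_history_cost {s t : ℕ} (hs : s ∈ Finset.Ico 1 t) :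
    Measurable[history c A R W t] (W s) := (measurable_history_tuple hs).snd.snd.snd

theorem history_mono {s t : ℕ} (hst : s ≤ t) : history c A R W s ≤ history c A R W t :=
  iSup₂_le fun k hk => comap_le_history (by simp only [Finset.mem_Ico] at hk ⊢; omega)

theorem history_le_decisionInfo (t : ℕ) : history c A R W t ≤ decisionInfo c A R W t := le_sup_left

theorem measurable_decisionInfo_context {s t : ℕ} (hs : s ∈ Finset.Icc 1 t) :
    Measurable[decisionInfo c A R W t] (c s) := by
  rcases eq_or_ne s t with rfl | h
  · exact (measurable_iff_comap_le.2 le_sup_right :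
      Measurable[decisionInfo c A R W s] fun ω => (c s ω, A s ω)).fst
  · exact (measurable_history_context (by simp only [Finset.mem_Icc, Finset.mem_Ico] at *; omega)).mono
      (history_le_decisionInfo t) le_rfl

theorem measurable_decisionInfo_action {s t : ℕ} (hs : s ∈ Finset.Icc 1 t) :
    Measurable[decisionInfo c A R W t] (A s) := by
  rcases eq_or_ne s t with rfl | h
  · exact (measurable_iff_comap_le.2 le_sup_right :
      Measurable[decisionInfo c A R W s] fun ω => (c s ω, A s ω)).snd
  · exact (measurable_history_action (by simp only [Finset.mem_Icc, Finset.mem_Ico] at *; omega)).mono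
      (history_le_decisionInfo t) le_rfl

variable [Countable X] [MeasurableSingletonClass X] {M : Model X J d} {T : ℕ}

theorem measurable_comp_context_action {α : Type*} {mα : MeasurableSpace α} (g : X → Fin J → ℝ)
    {C : α → X} {a : α → Fin J} (hC : Measurable C) (ha : Measurable a) :
    Measurable fun ω => g (C ω) (a ω) :=
  (measurable_of_countable fun p : X × Fin J => g p.1 p.2).comp (hC.prodMk ha)

/-- There are only countably many context-action pairs, so a random function may be evaluated at a
random pair. -/
theorem measurable_apply_context_action {α : Type*} {mα : MeasurableSpace α}
    {g : α → X → Fin J → ℝ} (hg : ∀ x j, Measurable fun ω => g ω x j)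
    {C : α → X} {a : α → Fin J} (hC : Measurable C) (ha : Measurable a) :
    Measurable fun ω => g ω (C ω) (a ω) := by
  have h : Measurable fun p : α × (X × Fin J) => g p.1 p.2.1 p.2.2 :=
    measurable_from_prod_countable_left fun y => hg y.1 y.2
  exact h.comp (measurable_id.prodMk (hC.prodMk ha))

theorem measurable_costEstimate (t : ℕ) (x : X) (j : Fin J) :
    Measurable[history c A R W t] fun ω => costEstimate M T (fun s => c s ω) (fun s => A s ω)
      (fun s => W s ω) t x j := by
  have hs : ∀ s ∈ Finset.Icc 1 (t - 1), s ∈ Finset.Ico 1 t := by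
    intro s hs; simp only [Finset.mem_Icc, Finset.mem_Ico] at *; omega
  exact measurable_const.max (measurable_const.min (measurable_sInf_inner_confidenceSet
    (f := fun s ω => M.psi (c s ω) (A s ω)) T
    (fun s h i => measurable_comp_context_action (fun x j => M.psi x j i)
      (measurable_history_context (hs s h)) (measurable_history_action (hs s h)))
    (fun s h => measurable_history_cost (hs s h)) _))

theorem measurable_costEstimate_played {t : ℕ} (ht : 1 ≤ t) :
    Measurable[history c A R W (t + 1)] fun ω => costEstimate M T (fun s => c s ω)
      (fun s => A s ω) (fun s => W s ω) t (c t ω) (A t ω) :=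
  measurable_apply_context_action
    (fun x j => (measurable_costEstimate t x j).mono (history_mono (by omega)) le_rfl)
    (measurable_history_context (by simp; omega)) (measurable_history_action (by simp; omega))

theorem measurable_dual {t : ℕ} (ht : 1 ≤ t) :
    Measurable[history c A R W t] fun ω => dual M T (fun s => c s ω) (fun s => A s ω)
      (fun s => W s ω) t := by
  induction t, ht using Nat.le_induction with
  | base => simp only [dual]; exact measurable_const
  | succ t ht ih =>
    simp only [dual_succ ht]
    exact (((ih.mono (history_mono (by omega)) le_rfl).add
      (measurable_costEstimate_played ht)).add measurable_const).max measurable_const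

/-- The event that the first `t` rounds are good. -/
def goodEvent (M : Model X J d) (T : ℕ) (c : ℕ → Ω → X) (A : ℕ → Ω → Fin J) (R W : ℕ → Ω → ℝ)
    (t : ℕ) : Set Ω :=
  {ω | IsGood M T (fun s => c s ω) (fun s => A s ω) (fun s => R s ω) (fun s => W s ω) t}

omit [MeasurableSpace X] [Countable X] [MeasurableSingletonClass X] in
theorem goodEvent_anti {s t : ℕ} (hst : s ≤ t) :
    goodEvent M T c A R W t ⊆ goodEvent M T c A R W s := fun _ h => IsGood.anti hst h

/-- Being decided before the context of round `t` is drawn is what allows restricting to this event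
while still using independence of that context. -/
theorem measurableSet_goodEvent (t : ℕ) :
    MeasurableSet[history c A R W t] (goodEvent M T c A R W t) := by
  have h : goodEvent M T c A R W t = ⋂ k, ⋂ (_ : k < t),
      ({ω | expPotential (fun s => M.phi (c s ω) (A s ω))
          (fun s => R s ω - M.meanReward (c s ω) (A s ω)) k ≤ T} ∩
        {ω | expPotential (fun s => M.psi (c s ω) (A s ω))
          (fun s => W s ω - M.meanCost (c s ω) (A s ω)) k ≤ T}) := by
    ext ω; simp [goodEvent, IsGood]
  rw [h]
  refine MeasurableSet.iInter fun k => MeasurableSet.iInter fun hk => ?_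
  have hs : ∀ s ∈ Finset.Icc 1 k, s ∈ Finset.Ico 1 t := by
    intro s hs; simp only [Finset.mem_Icc, Finset.mem_Ico] at *; omega
  refine MeasurableSet.inter (measurableSet_le ?_ measurable_const)
    (measurableSet_le ?_ measurable_const)
  · exact measurable_expPotential (f := fun s ω => M.phi (c s ω) (A s ω))
      (e := fun s ω => R s ω - M.meanReward (c s ω) (A s ω))
      (fun s h i => measurable_comp_context_action (fun x j => M.phi x j i)
        (measurable_history_context (hs s h)) (measurable_history_action (hs s h)))
      (fun s h => (measurable_history_reward (hs s h)).sub (measurable_comp_context_action _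
        (measurable_history_context (hs s h)) (measurable_history_action (hs s h))))
  · exact measurable_expPotential (f := fun s ω => M.psi (c s ω) (A s ω))
      (e := fun s ω => W s ω - M.meanCost (c s ω) (A s ω))
      (fun s h i => measurable_comp_context_action (fun x j => M.psi x j i)
        (measurable_history_context (hs s h)) (measurable_history_action (hs s h)))
      (fun s h => (measurable_history_cost (hs s h)).sub (measurable_comp_context_action _
        (measurable_history_context (hs s h)) (measurable_history_action (hs s h))))

end History

/-! ### Consequences of the interaction model -/

section InteractionFacts

variable {X Ω : Type*} {J d : ℕ} [Countable X] [MeasurableSpace X] [MeasurableSingletonClass X]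
  [mΩ : MeasurableSpace Ω] {P : Measure Ω} [IsProbabilityMeasure P] {M : Model X J d} {T : ℕ}
  {c : ℕ → Ω → X} {A : ℕ → Ω → Fin J} {R W : ℕ → Ω → ℝ}

namespace IsInteraction

omit [Countable X] [MeasurableSingletonClass X] [IsProbabilityMeasure P] in
theorem history_le (h : IsInteraction M T P c A R W) {t : ℕ} (ht : t ≤ T + 1) :
    history c A R W t ≤ mΩ := by
  refine iSup₂_le fun s hs => measurable_iff_comap_le.1 ?_
  have hs' : s ∈ Finset.Icc 1 T := by simp only [Finset.mem_Icc, Finset.mem_Ico] at *; omega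
  exact (h.measurable_context s hs').prodMk ((h.measurable_action s hs').prodMk
    ((h.measurable_reward s hs').prodMk (h.measurable_cost s hs')))

omit [Countable X] [MeasurableSingletonClass X] [IsProbabilityMeasure P] in
theorem decisionInfo_le (h : IsInteraction M T P c A R W) {t : ℕ} (ht : t ∈ Finset.Icc 1 T) :
    decisionInfo c A R W t ≤ mΩ :=
  sup_le (h.history_le (by simp only [Finset.mem_Icc] at ht; omega))
    (measurable_iff_comap_le.1 ((h.measurable_context t ht).prodMk (h.measurable_action t ht)))

omit [IsProbabilityMeasure P] in
theorem measurable_comp (h : IsInteraction M T P c A R W) {t : ℕ} (ht : t ∈ Finset.Icc 1 T)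
    (g : X → Fin J → ℝ) : Measurable fun ω => g (c t ω) (A t ω) :=
  measurable_comp_context_action g (h.measurable_context t ht) (h.measurable_action t ht)

theorem integrable_comp (h : IsInteraction M T P c A R W) {t : ℕ} (ht : t ∈ Finset.Icc 1 T)
    {g : X → Fin J → ℝ} {B : ℝ} (hg : ∀ x j, |g x j| ≤ B) :
    Integrable (fun ω => g (c t ω) (A t ω)) P :=
  Integrable.of_bound (h.measurable_comp ht g).aestronglyMeasurable B
    (Filter.Eventually.of_forall fun _ => hg _ _)

theorem integrable_meanReward (h : IsInteraction M T P c A R W) (hM : M.Bounded) {t : ℕ}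
    (ht : t ∈ Finset.Icc 1 T) : Integrable (fun ω => M.meanReward (c t ω) (A t ω)) P :=
  h.integrable_comp ht (B := 1) fun x j =>
    abs_le.2 ⟨by linarith [(hM.meanReward_mem x j).1], (hM.meanReward_mem x j).2⟩

theorem integrable_meanCost (h : IsInteraction M T P c A R W) (hM : M.Bounded) {t : ℕ}
    (ht : t ∈ Finset.Icc 1 T) : Integrable (fun ω => M.meanCost (c t ω) (A t ω)) P :=
  h.integrable_comp ht (B := 1) fun x j => abs_le.2 (hM.meanCost_mem x j)

theorem integral_sum_reward (h : IsInteraction M T P c A R W) (hM : M.Bounded) {n : ℕ}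
    (hn : n ≤ T) : ∫ ω, ∑ t ∈ Finset.Icc 1 n, R t ω ∂P
      = ∑ t ∈ Finset.Icc 1 n, ∫ ω, M.meanReward (c t ω) (A t ω) ∂P := by
  have hmem : ∀ t ∈ Finset.Icc 1 n, t ∈ Finset.Icc 1 T := by
    intro t ht; simp only [Finset.mem_Icc] at *; omega
  have hR : ∀ t ∈ Finset.Icc 1 n, Integrable (R t) P := fun t ht => by
    exact ((h.reward_noise t (hmem t ht)).integrable.add (h.integrable_meanReward hM (hmem t ht))).congr
      (Filter.Eventually.of_forall fun ω => sub_add_cancel _ _)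
  rw [integral_finsetSum _ hR]
  refine Finset.sum_congr rfl fun t ht => ?_
  have h0 := (h.reward_noise t (hmem t ht)).integral_eq_zero (h.decisionInfo_le (hmem t ht))
  rw [integral_sub (hR t ht) (h.integrable_meanReward hM (hmem t ht))] at h0
  linarith

theorem integral_sum_cost (h : IsInteraction M T P c A R W) (hM : M.Bounded) {n : ℕ}
    (hn : n ≤ T) : ∫ ω, ∑ t ∈ Finset.Icc 1 n, W t ω ∂P
      = ∑ t ∈ Finset.Icc 1 n, ∫ ω, M.meanCost (c t ω) (A t ω) ∂P := by
  have hmem : ∀ t ∈ Finset.Icc 1 n, t ∈ Finset.Icc 1 T := by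
    intro t ht; simp only [Finset.mem_Icc] at *; omega
  have hW : ∀ t ∈ Finset.Icc 1 n, Integrable (W t) P := fun t ht => by
    exact ((h.cost_noise t (hmem t ht)).integrable.add (h.integrable_meanCost hM (hmem t ht))).congr
      (Filter.Eventually.of_forall fun ω => sub_add_cancel _ _)
  rw [integral_finsetSum _ hW]
  refine Finset.sum_congr rfl fun t ht => ?_
  have h0 := (h.cost_noise t (hmem t ht)).integral_eq_zero (h.decisionInfo_le (hmem t ht))
  rw [integral_sub (hW t ht) (h.integrable_meanCost hM (hmem t ht))] at h0
  linarith

omit [IsProbabilityMeasure P] in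
/-- A function of the context of a round is independent of what the history determines. -/
theorem integral_context_mul (h : IsInteraction M T P c A R W) {t : ℕ} (ht : t ∈ Finset.Icc 1 T)
    {g : X → ℝ} {B : ℝ} (hg : ∀ x, |g x| ≤ B) {U : Ω → ℝ} (hU : Measurable[history c A R W t] U) :
    ∫ ω, g (c t ω) * U ω ∂P = (∑' x, (M.p x).toReal * g x) * ∫ ω, U ω ∂P := by
  have hgm : Measurable g := measurable_of_countable g
  have hle : history c A R W t ≤ mΩ := h.history_le (by simp only [Finset.mem_Icc] at ht; omega)
  have hind : IndepFun (fun ω => g (c t ω)) U P := by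
    have h1 := h.context_indep t ht
    refine indep_of_indep_of_le_left (indep_of_indep_of_le_right h1 hU.comap_le) ?_
    exact measurable_iff_comap_le.1 (hgm.comp (comap_measurable (c t)))
  have hgc : Measurable fun ω => g (c t ω) := hgm.comp (h.measurable_context t ht)
  rw [hind.integral_fun_mul_eq_mul_integral hgc.aestronglyMeasurable
    (hU.mono hle le_rfl).aestronglyMeasurable]
  congr 1
  have h2 : ∫ ω, g (c t ω) ∂P = ∫ x, g x ∂M.p.toMeasure := by
    rw [← h.context_law t ht, integral_map (h.measurable_context t ht).aemeasurable
      hgm.aestronglyMeasurable]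
  rw [h2, PMF.integral_eq_tsum _ _ (Integrable.of_bound hgm.aestronglyMeasurable B
    (Filter.Eventually.of_forall hg))]
  simp

/-- All rounds are good with probability at least `1 - 2 / T`. -/
theorem measure_compl_goodEvent_le (h : IsInteraction M T P c A R W) (hT : 0 < T) {t : ℕ}
    (ht : t ≤ T + 1) : (P (goodEvent M T c A R W t)ᶜ).toReal ≤ 2 / T := by
  have hT1 : (1 : ℝ) ≤ T := by exact_mod_cast hT
  -- The level is `a = T`, so each of the two noise processes fails with probability at most `1/T`.
  have hR := measure_expPotential_gt_le (P := P) (n := T) (decisionInfo c A R W)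
    (fun s ω => M.phi (c s ω) (A s ω)) (fun s ω => R s ω - M.meanReward (c s ω) (A s ω))
    (fun s hs => h.decisionInfo_le hs)
    (fun k _ s hs i => measurable_comp_context_action (fun x j => M.phi x j i)
        (measurable_decisionInfo_context hs) (measurable_decisionInfo_action hs))
    (fun k _ s hs => by
      have hs1 : s ∈ Finset.Ico 1 k := by simp only [Finset.mem_Icc, Finset.mem_Ico] at *; omega
      exact ((measurable_history_reward hs1).sub (measurable_comp_context_action _
        (measurable_history_context hs1) (measurable_history_action hs1))).mono
          (history_le_decisionInfo k) le_rfl)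
    (fun s hs => (h.measurable_reward s hs).sub (h.measurable_comp hs _)) h.reward_noise hT1
  have hW := measure_expPotential_gt_le (P := P) (n := T) (decisionInfo c A R W)
    (fun s ω => M.psi (c s ω) (A s ω)) (fun s ω => W s ω - M.meanCost (c s ω) (A s ω))
    (fun s hs => h.decisionInfo_le hs)
    (fun k _ s hs i => measurable_comp_context_action (fun x j => M.psi x j i)
        (measurable_decisionInfo_context hs) (measurable_decisionInfo_action hs))
    (fun k _ s hs => by
      have hs1 : s ∈ Finset.Ico 1 k := by simp only [Finset.mem_Icc, Finset.mem_Ico] at *; omega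
      exact ((measurable_history_cost hs1).sub (measurable_comp_context_action _
        (measurable_history_context hs1) (measurable_history_action hs1))).mono
          (history_le_decisionInfo k) le_rfl)
    (fun s hs => (h.measurable_cost s hs).sub (h.measurable_comp hs _)) h.cost_noise hT1
  have key : ∀ S : Set Ω, ENNReal.ofReal T * P S ≤ 1 → P.real S ≤ 1 / T := by
    intro S hS
    have := ENNReal.toReal_mono ENNReal.one_ne_top hS
    rw [ENNReal.toReal_mul, ENNReal.toReal_ofReal (by linarith), ENNReal.toReal_one] at this
    rw [le_div_iff₀ (by linarith), mul_comm]
    exact this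
  have hsub : (goodEvent M T c A R W t)ᶜ ⊆
      {ω | ∃ k ≤ T, (T : ℝ) < expPotential (fun s => M.phi (c s ω) (A s ω))
        (fun s => R s ω - M.meanReward (c s ω) (A s ω)) k} ∪
      {ω | ∃ k ≤ T, (T : ℝ) < expPotential (fun s => M.psi (c s ω) (A s ω))
        (fun s => W s ω - M.meanCost (c s ω) (A s ω)) k} := by
    intro ω hω
    simp only [goodEvent, IsGood, Set.mem_compl_iff, Set.mem_ofPred_eq, not_forall] at hω
    obtain ⟨k, hk, hk2⟩ := hω
    rw [not_and_or, not_le, not_le] at hk2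
    rcases hk2 with h1 | h1
    · exact Or.inl ⟨k, by omega, h1⟩
    · exact Or.inr ⟨k, by omega, h1⟩
  calc P.real (goodEvent M T c A R W t)ᶜ ≤ _ := measureReal_mono hsub
    _ ≤ _ := measureReal_union_le _ _
    _ ≤ 1 / T + 1 / T := add_le_add (key _ hR) (key _ hW)
    _ = 2 / T := by ring

end IsInteraction

end InteractionFacts

/-! ### Policies -/

namespace Model

variable {X : Type*} {J d : ℕ} {M : Model X J d}

theorem summable_toReal (p : PMF X) : Summable fun x => (p x).toReal :=
  ENNReal.summable_toReal p.tsum_coe_ne_top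

theorem tsum_toReal (p : PMF X) : ∑' x, (p x).toReal = 1 := by
  rw [← ENNReal.tsum_toReal_eq fun x => p.apply_ne_top x, p.tsum_coe, ENNReal.toReal_one]

theorem summable_toReal_mul (p : PMF X) {g : X → ℝ} {B : ℝ} (hg : ∀ x, |g x| ≤ B) :
    Summable fun x => (p x).toReal * g x := by
  refine Summable.of_norm_bounded ((summable_toReal p).mul_right B) fun x => ?_
  rw [norm_mul, Real.norm_eq_abs, Real.norm_eq_abs, abs_of_nonneg ENNReal.toReal_nonneg]
  exact mul_le_mul_of_nonneg_left (hg x) ENNReal.toReal_nonneg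

/-- Convex combination of two policies. -/
def mixPolicy (a : ℝ) (x y : X → Fin J → ℝ) : X → Fin J → ℝ :=
  fun C j => (1 - a) * x C j + a * y C j

theorem IsPolicy.mix {x y : X → Fin J → ℝ} (hx : IsPolicy x) (hy : IsPolicy y) {a : ℝ}
    (ha0 : 0 ≤ a) (ha1 : a ≤ 1) : IsPolicy (mixPolicy a x y) := by
  refine fun C => ⟨fun j => ?_, ?_⟩
  · have := (hx C).1 j
    have := (hy C).1 j
    have : 0 ≤ 1 - a := by linarith
    unfold mixPolicy; positivity
  · simp only [mixPolicy, Finset.sum_add_distrib, ← Finset.mul_sum, (hx C).2, (hy C).2]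
    ring

theorem abs_contextReward_le (hM : M.Bounded) {x : X → Fin J → ℝ} (hx : IsPolicy x) (C : X) :
    |M.contextReward x C| ≤ 1 :=
  abs_le.2 ⟨by linarith [(contextReward_mem hM hx C).1], (contextReward_mem hM hx C).2⟩

theorem abs_contextCost_le (hM : M.Bounded) {x : X → Fin J → ℝ} (hx : IsPolicy x) (C : X) :
    |M.contextCost x C| ≤ 1 :=
  abs_le.2 (contextCost_mem hM hx C)

theorem policyReward_mem (hM : M.Bounded) {x : X → Fin J → ℝ} (hx : IsPolicy x) :
    M.policyReward x ∈ Set.Icc (0 : ℝ) 1 := by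
  constructor
  · exact tsum_nonneg fun C => mul_nonneg ENNReal.toReal_nonneg (contextReward_mem hM hx C).1
  · rw [← tsum_toReal M.p]
    refine (summable_toReal_mul M.p (abs_contextReward_le hM hx)).tsum_le_tsum (fun C => ?_)
      (summable_toReal M.p)
    exact mul_le_of_le_one_right ENNReal.toReal_nonneg (contextReward_mem hM hx C).2

theorem policyReward_mix (hM : M.Bounded) {x y : X → Fin J → ℝ} (hx : IsPolicy x)
    (hy : IsPolicy y) (a : ℝ) : M.policyReward (mixPolicy a x y)
      = (1 - a) * M.policyReward x + a * M.policyReward y := by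
  have h1 := (summable_toReal_mul M.p (abs_contextReward_le hM hx)).mul_left (1 - a)
  have h2 := (summable_toReal_mul M.p (abs_contextReward_le hM hy)).mul_left a
  simp only [policyReward]
  rw [← tsum_mul_left, ← tsum_mul_left]
  refine Eq.trans ?_ (h1.tsum_add h2)
  refine tsum_congr fun C => ?_
  simp only [mixPolicy, contextReward, mul_add, Finset.sum_add_distrib, Finset.mul_sum]
  congr 1 <;> exact Finset.sum_congr rfl fun j _ => by ring

theorem policyCost_mix (hM : M.Bounded) {x y : X → Fin J → ℝ} (hx : IsPolicy x)
    (hy : IsPolicy y) (a : ℝ) : M.policyCost (mixPolicy a x y)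
      = (1 - a) * M.policyCost x + a * M.policyCost y := by
  have h1 := (summable_toReal_mul M.p (abs_contextCost_le hM hx)).mul_left (1 - a)
  have h2 := (summable_toReal_mul M.p (abs_contextCost_le hM hy)).mul_left a
  simp only [policyCost]
  rw [← tsum_mul_left, ← tsum_mul_left]
  refine Eq.trans ?_ (h1.tsum_add h2)
  refine tsum_congr fun C => ?_
  simp only [mixPolicy, contextCost, mul_add, Finset.sum_add_distrib, Finset.mul_sum]
  congr 1 <;> exact Finset.sum_congr rfl fun j _ => by ring

/-- In dimension zero all costs vanish, which contradicts a strictly negative policy cost. -/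
theorem Slater.pos_dim {δ : ℝ} (hδ : 0 < δ) (h : M.Slater δ) : 0 < d := by
  rcases Nat.eq_zero_or_pos d with rfl | hd
  · obtain ⟨x, _, hx⟩ := h
    have h0 : M.policyCost x = 0 := by
      have : ∀ C j, M.meanCost C j = 0 := fun C j => by
        rw [meanCost, Subsingleton.elim M.muStar 0, inner_zero_left]
      simp [policyCost, this]
    linarith
  · exact hd

end Model

/-! ### The expected reward of one round -/

section RewardRound

variable {X Ω : Type*} {J d : ℕ} [Countable X] [MeasurableSpace X] [MeasurableSingletonClass X]
  [mΩ : MeasurableSpace Ω] {P : Measure Ω} [IsProbabilityMeasure P] {M : Model X J d} {T : ℕ}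
  {c : ℕ → Ω → X} {A : ℕ → Ω → Fin J} {R W : ℕ → Ω → ℝ}

/-- The dual variable as a stochastic process. -/
noncomputable def dualVariable (M : Model X J d) (T : ℕ) (c : ℕ → Ω → X) (A : ℕ → Ω → Fin J)
    (W : ℕ → Ω → ℝ) (t : ℕ) (ω : Ω) : ℝ :=
  dual M T (fun s => c s ω) (fun s => A s ω) (fun s => W s ω) t

/-- The width of the confidence interval of the played action. -/
noncomputable def playedWidth (T : ℕ) (g : X → Fin J → Vec d) (c : ℕ → Ω → X)
    (A : ℕ → Ω → Fin J) (t : ℕ) (ω : Ω) : ℝ :=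
  2 * (radius d T t * confWidth (fun s => g (c s ω) (A s ω)) t (g (c t ω) (A t ω)))

omit [Countable X] [MeasurableSpace X] [MeasurableSingletonClass X] mΩ in
theorem playedWidth_nonneg (g : X → Fin J → Vec d) (t : ℕ) (ω : Ω) :
    0 ≤ playedWidth T g c A t ω :=
  mul_nonneg (by norm_num) (mul_nonneg (radius_nonneg _ _ _) (confWidth_nonneg _ _ _))

namespace IsInteraction

theorem integrable_playedWidth (h : IsInteraction M T P c A R W) {g : X → Fin J → Vec d}
    (hg : ∀ x j, ‖g x j‖ ≤ 1) {t : ℕ} (ht : t ∈ Finset.Icc 1 T) :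
    Integrable (playedWidth T g c A t) P := by
  obtain ⟨t, rfl⟩ := Nat.exists_eq_add_of_le' (Finset.mem_Icc.1 ht).1
  have hmeas : Measurable (playedWidth T g c A (t + 1)) := by
    refine measurable_const.mul (measurable_const.mul
      (Real.continuous_sqrt.measurable.comp (measurable_featureWidth
        (f := fun s ω => g (c s ω) (A s ω)) fun s hs i => ?_)))
    exact h.measurable_comp (by simp only [Finset.mem_Icc] at *; omega) fun x j => g x j i
  refine Integrable.of_bound hmeas.aestronglyMeasurable (2 * (radius d T (t + 1) * 1))
    (Filter.Eventually.of_forall fun ω => ?_)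
  rw [Real.norm_of_nonneg (playedWidth_nonneg _ _ _)]
  refine mul_le_mul_of_nonneg_left (mul_le_mul_of_nonneg_left ?_ (radius_nonneg _ _ _))
    (by norm_num)
  refine Real.sqrt_le_one.2 ((quadForm_gram_inv_le _ _ _).trans ?_)
  exact pow_le_one₀ (norm_nonneg _) (hg _ _)

/-- The expected widths of the confidence intervals of the played actions are summable. -/
theorem sum_integral_playedWidth_le (h : IsInteraction M T P c A R W) (hd : 0 < d)
    {g : X → Fin J → Vec d} (hg : ∀ x j, ‖g x j‖ ≤ 1) {n : ℕ} (hn : n ≤ T) :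
    ∑ t ∈ Finset.Icc 1 n, ∫ ω, playedWidth T g c A t ω ∂P
      ≤ 2 * ((1 + √((2 + d) * Real.log (1 + T))) * √(3 / 2 * (d * n * Real.log (1 + T)))) := by
  have hI : ∀ t ∈ Finset.Icc 1 n, Integrable (playedWidth T g c A t) P := fun t ht =>
    h.integrable_playedWidth hg (by simp only [Finset.mem_Icc] at *; omega)
  rw [← integral_finsetSum _ hI]
  refine (integral_mono (integrable_finsetSum _ hI) (integrable_const _) fun ω =>
    sum_radius_mul_confWidth_le hd hn (fun s => g (c s ω) (A s ω)) fun _ _ => hg _ _).trans ?_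
  simp

omit [IsProbabilityMeasure P] in
theorem measurable_dualVariable (h : IsInteraction M T P c A R W) {t : ℕ} (ht : t ∈ Finset.Icc 1 (T + 1)) :
    Measurable (dualVariable M T c A W t) := by
  rw [Finset.mem_Icc] at ht
  exact (measurable_dual (R := R) ht.1).mono (h.history_le ht.2) le_rfl

omit [Countable X] [MeasurableSpace X] [MeasurableSingletonClass X] mΩ in
theorem _root_.ConstrainedBandit.dualVariable_mem {t : ℕ} (ht : 1 ≤ t) (ω : Ω) :
    dualVariable M T c A W t ω ∈ Set.Icc 0 (t + 8 * d * Real.log (1 + T) * √(t : ℝ)) :=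
  ⟨dual_nonneg t, dual_le ht⟩

theorem integrable_dualVariable_pow (h : IsInteraction M T P c A R W) {t : ℕ}
    (ht : t ∈ Finset.Icc 1 (T + 1)) (k : ℕ) :
    Integrable (fun ω => dualVariable M T c A W t ω ^ k) P := by
  refine Integrable.of_bound ((h.measurable_dualVariable ht).pow_const k).aestronglyMeasurable
    ((t + 8 * d * Real.log (1 + T) * √(t : ℝ)) ^ k) (Filter.Eventually.of_forall fun ω => ?_)
  have hq := dualVariable_mem (M := M) (T := T) (c := c) (A := A) (W := W) (Finset.mem_Icc.1 ht).1 ω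
  rw [Real.norm_of_nonneg (pow_nonneg hq.1 k)]
  exact pow_le_pow_left₀ hq.1 hq.2 k

/-- One-round reward comparison of the algorithm with an arbitrary policy. -/
theorem policyReward_le (h : IsInteraction M T P c A R W) (hM : M.Bounded) (hd : 0 < d)
    {δ : ℝ} (hδ : 0 < δ)
    (hA : ∀ᵐ ω ∂P, FollowsAlgorithm M T δ (fun t => c t ω) (fun t => A t ω) (fun t => R t ω)
      (fun t => W t ω)) {t : ℕ} (ht : t ∈ Finset.Icc 1 T) {x : X → Fin J → ℝ}
    (hx : Model.IsPolicy x) :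
    M.policyReward x * P.real (goodEvent M T c A R W t)
        - M.policyCost x / weight d T δ t
          * ∫ ω in goodEvent M T c A R W t, dualVariable M T c A W t ω ∂P
      ≤ ∫ ω, M.meanReward (c t ω) (A t ω) ∂P + ∫ ω, playedWidth T M.phi c A t ω ∂P
        + (∫ ω in goodEvent M T c A R W t, dualVariable M T c A W t ω ^ 2 ∂P
          - ∫ ω in goodEvent M T c A R W (t + 1), dualVariable M T c A W (t + 1) ω ^ 2 ∂P)
          / (2 * weight d T δ t)
        + tightness d T t / weight d T δ t
          * ∫ ω in goodEvent M T c A R W t, dualVariable M T c A W t ω ∂P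
        + (1 + tightness d T t) ^ 2 / (2 * weight d T δ t) := by
  have ht' := Finset.mem_Icc.1 ht
  have hT : 0 < T := by omega
  set V := weight d T δ t with hV
  set ε := tightness d T t with hε
  set H := goodEvent M T c A R W t with hH
  have hVpos : 0 < V := weight_pos hd hT hδ ht'.1
  have hle : history c A R W t ≤ mΩ := h.history_le (by omega)
  have hHm' : MeasurableSet[history c A R W t] H := measurableSet_goodEvent t
  have hHm : MeasurableSet H := hle _ hHm'
  have hH2m : MeasurableSet (goodEvent M T c A R W (t + 1)) :=
    h.history_le (by omega) _ (measurableSet_goodEvent (t + 1))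
  have hQm' : Measurable[history c A R W t] (dualVariable M T c A W t) := measurable_dual ht'.1
  have ht1 : t ∈ Finset.Icc 1 (T + 1) := by simp; omega
  have ht2 : t + 1 ∈ Finset.Icc 1 (T + 1) := by simp; omega
  have iQ : Integrable (dualVariable M T c A W t) P := by
    simpa using h.integrable_dualVariable_pow ht1 1
  have iQ2 := h.integrable_dualVariable_pow ht1 2
  have iQ2' := h.integrable_dualVariable_pow ht2 2
  have ir := h.integrable_meanReward hM ht
  have ig := h.integrable_playedWidth hM.norm_phi_le ht
  have hcm : Measurable (c t) := h.measurable_context t ht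
  have icr : Integrable (fun ω => M.contextReward x (c t ω)) P :=
    Integrable.of_bound ((measurable_of_countable (M.contextReward x)).comp hcm).aestronglyMeasurable 1
      (Filter.Eventually.of_forall fun ω => Model.abs_contextReward_le hM hx _)
  have icQ : Integrable (fun ω => M.contextCost x (c t ω) * dualVariable M T c A W t ω) P :=
    iQ.bdd_mul (c := 1) ((measurable_of_countable (M.contextCost x)).comp hcm).aestronglyMeasurable
      (Filter.Eventually.of_forall fun ω => Model.abs_contextCost_le hM hx _)
  have hpt : ∀ᵐ ω ∂P.restrict H,
      M.contextReward x (c t ω) - V⁻¹ * (M.contextCost x (c t ω) * dualVariable M T c A W t ω)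
        ≤ M.meanReward (c t ω) (A t ω) + playedWidth T M.phi c A t ω
          + (2 * V)⁻¹ * (dualVariable M T c A W t ω ^ 2 - dualVariable M T c A W (t + 1) ω ^ 2)
          + ε / V * dualVariable M T c A W t ω + (1 + ε) ^ 2 / (2 * V) := by
    filter_upwards [ae_restrict_mem hHm, ae_restrict_of_ae hA] with ω hω hAω
    have h1 := IsGood.le_pseudoValue hM hd hT hδ ht hω hAω hx
    have h2 := IsGood.rewardEstimate_le hM hd hT ht'.1 hω (c t ω) (A t ω)
    have h3 := sq_dual_succ_le (M := M) (T := T) (c := fun s => c s ω) (A := fun s => A s ω)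
      (W := fun s => W s ω) ht'.1
    simp only [dualVariable, playedWidth]
    rw [← hV] at h1
    rw [← hε] at h3
    set Q := dual M T (fun s => c s ω) (fun s => A s ω) (fun s => W s ω) t
    set Q' := dual M T (fun s => c s ω) (fun s => A s ω) (fun s => W s ω) (t + 1)
    set w := costEstimate M T (fun s => c s ω) (fun s => A s ω) (fun s => W s ω) t (c t ω) (A t ω)
    -- The quadratic drift divided by `2V` pays for the weighted cost of the played action.
    have h4 : -(Q / V * w) ≤ (2 * V)⁻¹ * (Q ^ 2 - Q' ^ 2) + ε / V * Q + (1 + ε) ^ 2 / (2 * V) := by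
      have : (2 * V)⁻¹ * (Q ^ 2 - Q' ^ 2) + ε / V * Q + (1 + ε) ^ 2 / (2 * V) + Q / V * w
          = (2 * V)⁻¹ * (Q ^ 2 + 2 * Q * (w + ε) + (1 + ε) ^ 2 - Q' ^ 2) := by
        field_simp; ring
      have h5 : 0 ≤ (2 * V)⁻¹ * (Q ^ 2 + 2 * Q * (w + ε) + (1 + ε) ^ 2 - Q' ^ 2) :=
        mul_nonneg (by positivity) (by linarith)
      linarith
    have h6 : V⁻¹ * (M.contextCost x (c t ω) * Q) = Q / V * M.contextCost x (c t ω) := by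
      field_simp
    rw [h6]
    linarith
  have j1 : Integrable (fun ω => M.meanReward (c t ω) (A t ω) + playedWidth T M.phi c A t ω)
      (P.restrict H) := (ir.add ig).restrict
  have j2 : Integrable (fun ω => (2 * V)⁻¹ * (dualVariable M T c A W t ω ^ 2
      - dualVariable M T c A W (t + 1) ω ^ 2)) (P.restrict H) :=
    ((iQ2.sub iQ2').const_mul (2 * V)⁻¹).restrict
  have j3 : Integrable (fun ω => ε / V * dualVariable M T c A W t ω) (P.restrict H) :=
    (iQ.const_mul (ε / V)).restrict
  have j4 : Integrable (fun ω => M.meanReward (c t ω) (A t ω) + playedWidth T M.phi c A t ω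
      + (2 * V)⁻¹ * (dualVariable M T c A W t ω ^ 2 - dualVariable M T c A W (t + 1) ω ^ 2))
      (P.restrict H) := j1.add j2
  have j5 : Integrable (fun ω => M.meanReward (c t ω) (A t ω) + playedWidth T M.phi c A t ω
      + (2 * V)⁻¹ * (dualVariable M T c A W t ω ^ 2 - dualVariable M T c A W (t + 1) ω ^ 2)
      + ε / V * dualVariable M T c A W t ω) (P.restrict H) := j4.add j3
  have hint := integral_mono_ae (icr.restrict.sub (icQ.restrict.const_mul V⁻¹))
    (j5.add (integrable_const ((1 + ε) ^ 2 / (2 * V)))) hpt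
  simp only [Pi.add_apply, Pi.sub_apply] at hint
  rw [integral_sub icr.restrict (icQ.restrict.const_mul V⁻¹),
    integral_add j5 (integrable_const ((1 + ε) ^ 2 / (2 * V))), integral_add j4 j3,
    integral_add j1 j2, integral_add ir.restrict ig.restrict, integral_const_mul,
    integral_const_mul, integral_const_mul, integral_sub iQ2.restrict iQ2'.restrict] at hint
  -- Independence of the new context from the history factors out the policy value; the same is done
  -- for the cost weighted by `Q`.
  have e1 : ∫ ω in H, M.contextReward x (c t ω) ∂P = M.policyReward x * P.real H := by
    have := h.integral_context_mul ht (Model.abs_contextReward_le hM hx)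
      (U := H.indicator fun _ => (1 : ℝ)) (measurable_const.indicator hHm')
    rw [integral_indicator hHm] at this
    rw [← integral_indicator hHm]
    simp only [integral_const, MeasurableSet.univ, measureReal_restrict_apply, Set.univ_inter,
      smul_eq_mul, mul_one] at this
    refine Eq.trans (integral_congr_ae (Filter.Eventually.of_forall fun ω => ?_)) this
    by_cases hω : ω ∈ H <;> simp [hω]
  have e2 : ∫ ω in H, M.contextCost x (c t ω) * dualVariable M T c A W t ω ∂P
      = M.policyCost x * ∫ ω in H, dualVariable M T c A W t ω ∂P := by
    have := h.integral_context_mul ht (Model.abs_contextCost_le hM hx)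
      (U := H.indicator (dualVariable M T c A W t)) (hQm'.indicator hHm')
    rw [integral_indicator hHm] at this
    rw [← integral_indicator hHm]
    refine Eq.trans (integral_congr_ae (Filter.Eventually.of_forall fun ω => ?_)) this
    by_cases hω : ω ∈ H <;> simp [hω]
  have e3 : ∫ ω in H, M.meanReward (c t ω) (A t ω) ∂P ≤ ∫ ω, M.meanReward (c t ω) (A t ω) ∂P :=
    setIntegral_le_integral ir (Filter.Eventually.of_forall fun ω => (hM.meanReward_mem _ _).1)
  have e4 : ∫ ω in H, playedWidth T M.phi c A t ω ∂P ≤ ∫ ω, playedWidth T M.phi c A t ω ∂P :=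
    setIntegral_le_integral ig (Filter.Eventually.of_forall fun ω => playedWidth_nonneg _ _ _)
  -- Good events shrink and `Q² ≥ 0`; passing to the event of round `t + 1` makes the right side
  -- telescope.
  have e5 : ∫ ω in goodEvent M T c A R W (t + 1), dualVariable M T c A W (t + 1) ω ^ 2 ∂P
      ≤ ∫ ω in H, dualVariable M T c A W (t + 1) ω ^ 2 ∂P :=
    setIntegral_mono_set iQ2'.integrableOn (Filter.Eventually.of_forall fun ω => sq_nonneg _)
      (goodEvent_anti (Nat.le_succ t)).eventuallyLE
  have e6 : ∫ _ω in H, (1 + ε) ^ 2 / (2 * V) ∂P ≤ (1 + ε) ^ 2 / (2 * V) := by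
    rw [setIntegral_const, smul_eq_mul]
    exact mul_le_of_le_one_left (by positivity) measureReal_le_one
  rw [e1, e2] at hint
  have e7 : (2 * V)⁻¹ * (∫ ω in H, dualVariable M T c A W t ω ^ 2 ∂P
      - ∫ ω in H, dualVariable M T c A W (t + 1) ω ^ 2 ∂P)
      ≤ (∫ ω in H, dualVariable M T c A W t ω ^ 2 ∂P
        - ∫ ω in goodEvent M T c A R W (t + 1), dualVariable M T c A W (t + 1) ω ^ 2 ∂P) / (2 * V) := by
    rw [div_eq_inv_mul]
    exact mul_le_mul_of_nonneg_left (by linarith) (by positivity)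
  have e8 : V⁻¹ * (M.policyCost x * ∫ ω in H, dualVariable M T c A W t ω ∂P)
      = M.policyCost x / V * ∫ ω in H, dualVariable M T c A W t ω ∂P := by ring
  rw [e8] at hint
  linarith

end IsInteraction

end RewardRound

/-! ### Elementary estimates -/

section Estimates

/-- Summation by parts: since `V` is nondecreasing, each leftover `l (t+1) (1/V (t+1) - 1/V t)` is
nonpositive. It is applied to `l t = E[Q(t)²]` on the good event. -/
theorem sum_sub_succ_div_le {l V : ℕ → ℝ} (hl : ∀ t, 0 ≤ l t) (hV : ∀ t, 1 ≤ t → 0 < V t)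
    (hmono : ∀ t, 1 ≤ t → V t ≤ V (t + 1)) (n : ℕ) :
    ∑ t ∈ Finset.Icc 1 n, (l t - l (t + 1)) / V t ≤ l 1 / V 1 := by
  have h1 : 0 ≤ l 1 / V 1 := div_nonneg (hl 1) (hV 1 le_rfl).le
  rcases Nat.eq_zero_or_pos n with rfl | hn
  · simpa using h1
  have key : ∑ t ∈ Finset.Icc 1 n, (l t - l (t + 1)) / V t + l (n + 1) / V n ≤ l 1 / V 1 := by
    induction n, hn using Nat.le_induction with
    | base => simp [sub_div]
    | succ n hn ih =>
      rw [Finset.sum_Icc_succ_top (by omega)]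
      have h2 : l (n + 1) / V (n + 1) ≤ l (n + 1) / V n :=
        div_le_div_of_nonneg_left (hl _) (hV n hn) (hmono n hn)
      rw [sub_div]
      linarith
  have := div_nonneg (hl (n + 1)) (hV n hn).le
  linarith

theorem sum_one_div_mul_sqrt_le (n : ℕ) :
    ∑ t ∈ Finset.Icc 1 n, 1 / ((t : ℝ) * √(t : ℝ)) ≤ 3 := by
  rcases Nat.eq_zero_or_pos n with rfl | hn
  · simp
  -- Comparison with the telescoping increments of `-2/√t`.
  have key : ∑ t ∈ Finset.Icc 1 n, 1 / ((t : ℝ) * √(t : ℝ)) ≤ 3 - 2 / √(n : ℝ) := by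
    induction n, hn using Nat.le_induction with
    | base => norm_num
    | succ n hn ih =>
      rw [Finset.sum_Icc_succ_top (by omega)]
      push_cast
      have hn' : (0 : ℝ) < n := by exact_mod_cast hn
      have hp : 0 < √(n : ℝ) := Real.sqrt_pos.2 hn'
      have hq : 0 < √((n : ℝ) + 1) := by positivity
      have hp2 := Real.sq_sqrt hn'.le
      have hq2 := Real.sq_sqrt (show (0 : ℝ) ≤ (n : ℝ) + 1 by positivity)
      have hpq : √(n : ℝ) ≤ √((n : ℝ) + 1) := Real.sqrt_le_sqrt (by linarith)
      have h2 : 1 / (((n : ℝ) + 1) * √((n : ℝ) + 1)) ≤ 2 / √(n : ℝ) - 2 / √((n : ℝ) + 1) := by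
        set p := √(n : ℝ)
        set q := √((n : ℝ) + 1)
        have e : 2 / p - 2 / q = 2 * (q - p) / (p * q) := by field_simp
        rw [e, ← hq2, div_le_div_iff₀ (by positivity) (by positivity)]
        have h3 : (q - p) * (q + p) = 1 := by nlinarith
        have h4 : 1 ≤ (q - p) * (2 * q) := by nlinarith
        nlinarith [mul_pos hp hq, mul_le_mul_of_nonneg_left h4 (sq_nonneg q), sq_nonneg (q - p)]
      linarith
  have : 0 ≤ 2 / √(n : ℝ) := by positivity
  linarith

/-- Total charge of the early rounds `t ≤ K²`. It is used with `K = 4u/δ`, beyond which the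
tightness is at most `δ`. -/
theorem sum_ite_one_add_one_div_sqrt_le {K a b : ℝ} (hK : 0 ≤ K) (ha : 0 ≤ a) (hb : 0 ≤ b)
    (n : ℕ) : ∑ t ∈ Finset.Icc 1 n, (if (t : ℝ) ≤ K ^ 2 then a + b * (1 / √(t : ℝ)) else 0)
      ≤ a * K ^ 2 + 2 * b * K := by
  rw [← Finset.sum_filter]
  have hsub : {t ∈ Finset.Icc 1 n | ((t : ℕ) : ℝ) ≤ K ^ 2} ⊆ Finset.Icc 1 ⌊K ^ 2⌋₊ := by
    intro t ht
    simp only [Finset.mem_filter, Finset.mem_Icc] at ht ⊢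
    exact ⟨ht.1.1, Nat.le_floor ht.2⟩
  refine (Finset.sum_le_sum_of_subset_of_nonneg hsub fun t _ _ => by positivity).trans ?_
  rw [Finset.sum_add_distrib, ← Finset.mul_sum]
  have h1 : ((⌊K ^ 2⌋₊ : ℕ) : ℝ) ≤ K ^ 2 := Nat.floor_le (by positivity)
  have h2 : √((⌊K ^ 2⌋₊ : ℕ) : ℝ) ≤ K := Real.sqrt_le_iff.2 ⟨hK, h1⟩
  have h3 := sum_one_div_sqrt_le ⌊K ^ 2⌋₊
  simp only [Finset.sum_const, Nat.card_Icc, Nat.add_sub_cancel, nsmul_eq_mul]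
  nlinarith [mul_le_mul_of_nonneg_left (h3.trans (mul_le_mul_of_nonneg_left h2 zero_le_two)) hb,
    mul_le_mul_of_nonneg_right h1 ha]

/-- If `L = log(1+T)` were below `8`, then `e^L ≤ 64L²` on all of `[0.69, 8]`, a contradiction. Each
subinterval compares `e` to its right end with `64` times the square of its left end; the last
comparison, `e⁸ < 64·7²`, is the tightest. -/
theorem eight_le_log_of_lt {T : ℕ} (hT : 1 ≤ T) (h : 64 * Real.log (1 + T) ^ 2 < T) :
    8 ≤ Real.log (1 + T) := by
  by_contra hlt
  rw [not_le] at hlt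
  have hT' : (1 : ℝ) ≤ T := by exact_mod_cast hT
  have hexp : Real.exp (Real.log (1 + T)) = 1 + T := Real.exp_log (by linarith)
  have h2 : 0.69 < Real.log (1 + T) :=
    lt_of_lt_of_le (by linarith [Real.log_two_gt_d9]) (Real.log_le_log (by norm_num)
      (by linarith : (2 : ℝ) ≤ 1 + T))
  have he := Real.exp_one_lt_d9
  have hpow : ∀ k : ℕ, Real.log (1 + T) ≤ k → 1 + (T : ℝ) ≤ 2.7182818286 ^ k := by
    intro k hk
    rw [← hexp]
    calc Real.exp (Real.log (1 + T)) ≤ Real.exp k := Real.exp_le_exp.2 hk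
      _ = Real.exp 1 ^ k := by rw [← Real.exp_nat_mul, mul_one]
      _ ≤ _ := pow_le_pow_left₀ (Real.exp_pos _).le he.le k
  set L := Real.log (1 + T)
  rcases le_total L 2 with h3 | h3
  · have := hpow 2 (by exact_mod_cast h3)
    norm_num at this
    nlinarith
  rcases le_total L 4 with h4 | h4
  · have := hpow 4 (by exact_mod_cast h4)
    norm_num at this
    nlinarith
  rcases le_total L 6 with h5 | h5
  · have := hpow 6 (by exact_mod_cast h5)
    norm_num at this
    nlinarith
  rcases le_total L 7 with h6 | h6
  · have := hpow 7 (by exact_mod_cast h6)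
    norm_num at this
    nlinarith
  · have := hpow 8 (by exact_mod_cast hlt.le)
    norm_num at this
    nlinarith

/-- Since `d ≥ 1`, `(2+d)L ≤ 3dL`, and `dL ≥ 8` absorbs the lower-order term through `√(dL) ≤ 0.354
dL`. The decimals are `√3`, `√(3/2)` and `1/√8` rounded up. A constant below `5 + 1/3` is essential
for the violation bound. -/
theorem confidence_sum_le {d L n : ℝ} (hd : 1 ≤ d) (hL : 8 ≤ L) (hn : 0 ≤ n) :
    2 * ((1 + √((2 + d) * L)) * √(3 / 2 * (d * n * L))) ≤ 5.2 * (d * L) * √n := by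
  have hu8 : 8 ≤ d * L := by nlinarith
  set u := d * L with hu
  have hs0 : 0 ≤ √u := Real.sqrt_nonneg _
  have hs2 : √u ^ 2 = u := Real.sq_sqrt (by linarith)
  have h1 : √((2 + d) * L) ≤ 1.7321 * √u := by
    rw [Real.sqrt_le_iff]
    refine ⟨by positivity, ?_⟩
    rw [mul_pow, hs2]
    nlinarith
  have h2 : √(3 / 2 * (d * n * L)) ≤ 1.2248 * √u * √n := by
    rw [Real.sqrt_le_iff]
    refine ⟨by positivity, ?_⟩
    rw [mul_pow, mul_pow, hs2, Real.sq_sqrt hn]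
    have : d * n * L = u * n := by rw [hu]; ring
    rw [this]
    nlinarith [mul_nonneg (by linarith : (0 : ℝ) ≤ u) hn]
  have h3 : √u ≤ 0.354 * u := by
    rw [Real.sqrt_le_iff]
    constructor
    · positivity
    · nlinarith
  calc 2 * ((1 + √((2 + d) * L)) * √(3 / 2 * (d * n * L)))
      ≤ 2 * ((1 + 1.7321 * √u) * (1.2248 * √u * √n)) := by gcongr
    _ = 2.4496 * (√u + 1.7321 * √u ^ 2) * √n := by ring
    _ ≤ 5.2 * u * √n := by
      refine mul_le_mul_of_nonneg_right ?_ (Real.sqrt_nonneg n)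
      rw [hs2]
      linarith

/-- Mixing with weight `a` loses at most `a` of reward, and an event of probability at least `1 - b`
loses at most `b` more. -/
theorem mix_mul_ge {a b p x y : ℝ} (ha : a ∈ Set.Icc (0 : ℝ) 1) (hb : 0 ≤ b) (hp : 1 - b ≤ p)
    (hx : x ∈ Set.Icc (0 : ℝ) 1) (hy : y ∈ Set.Icc (0 : ℝ) 1) :
    x - a - b ≤ ((1 - a) * x + a * y) * p := by
  have h1 : x - a ≤ (1 - a) * x + a * y := by
    have := mul_le_mul_of_nonneg_left hx.2 ha.1
    have := mul_nonneg ha.1 hy.1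
    linarith
  have h4 : 0 ≤ (1 - a) * x + a * y :=
    add_nonneg (mul_nonneg (sub_nonneg.2 ha.2) hx.1) (mul_nonneg ha.1 hy.1)
  have h2 : (1 - a) * x + a * y ≤ 1 := by
    have := mul_le_mul_of_nonneg_left hx.2 (sub_nonneg.2 ha.2)
    have := mul_le_mul_of_nonneg_left hy.2 ha.1
    linarith
  have h5 := mul_le_mul_of_nonneg_left hp h4
  have h6 := mul_le_mul_of_nonneg_right h2 hb
  linarith

section Parameters

variable {d T t : ℕ} {δ : ℝ}

theorem tightness_eq_div (d T t : ℕ) :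
    tightness d T t = 4 * (d * Real.log (1 + T)) / √(t : ℝ) := by rw [tightness]; ring

theorem weight_eq (d T t : ℕ) (δ : ℝ) :
    weight d T δ t = δ * (d * Real.log (1 + T)) * √(t : ℝ) / 4 := by rw [weight]; ring

/-- Cost of an early round: the tightening term when `Q` is replaced by its deterministic bound. -/
theorem tightness_div_weight_mul (hδ : 0 < δ) (hu : 0 < d * Real.log (1 + T)) (ht : 1 ≤ t) :
    tightness d T t / weight d T δ t * (t + 8 * (d * Real.log (1 + T)) * √(t : ℝ))
      = 16 / δ + 128 * (d * Real.log (1 + T)) / δ * (1 / √(t : ℝ)) := by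
  have ht0 : (0 : ℝ) < t := by exact_mod_cast ht
  have hst : 0 < √(t : ℝ) := Real.sqrt_pos.2 ht0
  have hst2 : √(t : ℝ) ^ 2 = t := Real.sq_sqrt ht0.le
  rw [tightness_eq_div, weight_eq]
  generalize d * Real.log (1 + T) = u at *
  generalize √(t : ℝ) = q at *
  rw [← hst2]
  field_simp
  ring

/-- `(1+ε)² ≤ 2(1+ε²)` separates a part that sums to order `√n` from a part with bounded sum. -/
theorem one_add_tightness_sq_div_le (hδ : 0 < δ) (hu : 0 < d * Real.log (1 + T)) (ht : 1 ≤ t) :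
    (1 + tightness d T t) ^ 2 / (2 * weight d T δ t)
      ≤ 4 / (δ * (d * Real.log (1 + T))) * (1 / √(t : ℝ))
        + 64 * (d * Real.log (1 + T)) / δ * (1 / ((t : ℝ) * √(t : ℝ))) := by
  have ht0 : (0 : ℝ) < t := by exact_mod_cast ht
  have hst : 0 < √(t : ℝ) := Real.sqrt_pos.2 ht0
  have hst2 : √(t : ℝ) ^ 2 = t := Real.sq_sqrt ht0.le
  rw [tightness_eq_div, weight_eq]
  generalize d * Real.log (1 + T) = u at *
  generalize √(t : ℝ) = q at *
  rw [← hst2]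
  calc (1 + 4 * u / q) ^ 2 / (2 * (δ * u * q / 4))
      ≤ (2 * (1 + (4 * u / q) ^ 2)) / (2 * (δ * u * q / 4)) := by
        gcongr
        linarith [sq_nonneg (1 - 4 * u / q)]
    _ = _ := by field_simp; ring

theorem tightness_le_of_sq_lt (hδ : 0 < δ) (ht : 1 ≤ t)
    (h : (4 * (d * Real.log (1 + T)) / δ) ^ 2 < t) : tightness d T t ≤ δ := by
  have ht0 : (0 : ℝ) < t := by exact_mod_cast ht
  have hst : 0 < √(t : ℝ) := Real.sqrt_pos.2 ht0
  have h5 : 4 * (d * Real.log (1 + T)) / δ < √(t : ℝ) := Real.lt_sqrt_of_sq_lt h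
  rw [div_lt_iff₀ hδ] at h5
  rw [tightness_eq_div, div_le_iff₀ hst]
  linarith

end Parameters

theorem regret_constants_le {u δ : ℝ} (hδ : 0 < δ) (hδ1 : δ ≤ 1) (hu : 8 ≤ u) :
    16 / δ * (4 * u / δ) ^ 2 + 2 * (128 * u / δ) * (4 * u / δ) + 192 * u / δ
      ≤ 235 * u ^ 4 / δ ^ 3 := by
  have e : 16 / δ * (4 * u / δ) ^ 2 + 2 * (128 * u / δ) * (4 * u / δ) + 192 * u / δ
      = (256 * u ^ 2 + 1024 * u ^ 2 * δ + 192 * u * δ ^ 2) / δ ^ 3 := by field_simp; ring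
  rw [e]
  gcongr
  have h1 : δ ^ 2 ≤ 1 := pow_le_one₀ hδ.le hδ1
  have h2 : 1024 * u ^ 2 * δ ≤ 1024 * u ^ 2 := mul_le_of_le_one_right (by positivity) hδ1
  have h3 : 192 * u * δ ^ 2 ≤ 192 * u := mul_le_of_le_one_right (by positivity) h1
  have h4 : 64 ≤ u ^ 2 := by nlinarith
  nlinarith

end Estimates

/-! ### Regret -/

section Regret

variable {X Ω : Type*} {J d : ℕ} [Countable X] [MeasurableSpace X] [MeasurableSingletonClass X]
  [mΩ : MeasurableSpace Ω] {P : Measure Ω} [IsProbabilityMeasure P] {M : Model X J d} {T : ℕ}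
  {c : ℕ → Ω → X} {A : ℕ → Ω → Fin J} {R W : ℕ → Ω → ℝ}

namespace IsInteraction

theorem one_sub_le_measureReal_goodEvent (h : IsInteraction M T P c A R W) (hT : 0 < T) {t : ℕ}
    (ht : t ≤ T + 1) : 1 - 2 / T ≤ P.real (goodEvent M T c A R W t) := by
  have hm : MeasurableSet (goodEvent M T c A R W t) :=
    h.history_le ht _ (measurableSet_goodEvent t)
  have h1 := h.measure_compl_goodEvent_le hT ht
  have h2 := probReal_compl_eq_one_sub (μ := P) hm
  change P.real _ ≤ _ at h1
  linarith

/-- The expected reward of one round compared with any feasible policy. -/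
theorem policyReward_le_of_feasible (h : IsInteraction M T P c A R W) (hM : M.Bounded)
    (hd : 0 < d) {δ : ℝ} (hδ : 0 < δ) (hS : M.Slater δ)
    (hA : ∀ᵐ ω ∂P, FollowsAlgorithm M T δ (fun t => c t ω) (fun t => A t ω) (fun t => R t ω)
      (fun t => W t ω)) {t : ℕ} (ht : t ∈ Finset.Icc 1 T) {x : X → Fin J → ℝ}
    (hx : Model.IsPolicy x) (hx0 : M.policyCost x ≤ 0) :
    M.policyReward x ≤ ∫ ω, M.meanReward (c t ω) (A t ω) ∂P + ∫ ω, playedWidth T M.phi c A t ω ∂P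
        + (∫ ω in goodEvent M T c A R W t, dualVariable M T c A W t ω ^ 2 ∂P
          - ∫ ω in goodEvent M T c A R W (t + 1), dualVariable M T c A W (t + 1) ω ^ 2 ∂P)
          / (2 * weight d T δ t)
        + 2 / T + 4 * (d * Real.log (1 + T)) / δ * (1 / √(t : ℝ))
        + (if (t : ℝ) ≤ (4 * (d * Real.log (1 + T)) / δ) ^ 2
            then 16 / δ + 128 * (d * Real.log (1 + T)) / δ * (1 / √(t : ℝ)) else 0)
        + (4 / (δ * (d * Real.log (1 + T))) * (1 / √(t : ℝ))
          + 64 * (d * Real.log (1 + T)) / δ * (1 / ((t : ℝ) * √(t : ℝ)))) := by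
  obtain ⟨y, hy, hyδ⟩ := hS
  have ht' := Finset.mem_Icc.1 ht
  have hT : 0 < T := by omega
  have hT1 : (0 : ℝ) < T := by exact_mod_cast hT
  have hd1 : (0 : ℝ) < d := by exact_mod_cast hd
  have hL : 0 < Real.log (1 + T) := Real.log_pos (by linarith)
  have ht0 : (0 : ℝ) < t := by exact_mod_cast ht'.1
  have hVpos : 0 < weight d T δ t := weight_pos hd hT hδ ht'.1
  have hε0 := tightness_nonneg d T t
  have hu0 : 0 < d * Real.log (1 + T) := by positivity
  have hεV := tightness_div_weight_mul (d := d) (T := T) hδ hu0 ht'.1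
  have hsq := one_add_tightness_sq_div_le (d := d) (T := T) hδ hu0 ht'.1
  have haε : tightness d T t / δ = 4 * (d * Real.log (1 + T)) / δ * (1 / √(t : ℝ)) := by
    rw [tightness_eq_div]; ring
  have hεδ := tightness_le_of_sq_lt (d := d) (T := T) hδ ht'.1
  set u := d * Real.log (1 + T) with hu
  set ε := tightness d T t
  set V := weight d T δ t
  -- The smallest weight of the Slater policy whose slack `aδ` offsets `ε`, capped at `1` for early
  -- rounds with `ε > δ`.
  set a := min (ε / δ) 1 with ha
  have ha0 : 0 ≤ a := le_min (by positivity) zero_le_one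
  have ha1 : a ≤ 1 := min_le_right _ _
  have hround := h.policyReward_le hM hd hδ hA ht (hx.mix hy ha0 ha1)
  rw [Model.policyReward_mix hM hx hy, Model.policyCost_mix hM hx hy] at hround
  set H := goodEvent M T c A R W t
  set EQ := ∫ ω in H, dualVariable M T c A W t ω ∂P with hEQ
  have hrx := Model.policyReward_mem hM hx
  have hry := Model.policyReward_mem hM hy
  have hPH := h.one_sub_le_measureReal_goodEvent hT (t := t) (by omega)
  have hEQ0 : 0 ≤ EQ := integral_nonneg fun ω => (dualVariable_mem ht'.1 ω).1
  have hEQ1 : EQ ≤ t + 8 * u * √(t : ℝ) := by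
    have hint : Integrable (dualVariable M T c A W t) P := by
      simpa using h.integrable_dualVariable_pow (M := M) (t := t) (by simp; omega) 1
    calc EQ ≤ ∫ ω, dualVariable M T c A W t ω ∂P :=
          setIntegral_le_integral hint
            (Filter.Eventually.of_forall fun ω => (dualVariable_mem ht'.1 ω).1)
      _ ≤ ∫ _ω, (t + 8 * u * √(t : ℝ)) ∂P := by
          refine integral_mono hint (integrable_const _) fun ω => ?_
          have := (dualVariable_mem (M := M) (T := T) (c := c) (A := A) (W := W) ht'.1 ω).2
          rw [hu, ← mul_assoc]
          exact this
      _ = _ := by simp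
  have hreward := mix_mul_ge ⟨ha0, ha1⟩ (by positivity) hPH hrx hry
  have hcost : a * δ / V * EQ
      ≤ -(((1 - a) * M.policyCost x + a * M.policyCost y) / V * EQ) := by
    rw [← neg_mul, ← neg_div]
    refine mul_le_mul_of_nonneg_right (div_le_div_of_nonneg_right ?_ hVpos.le) hEQ0
    have h1 := mul_le_mul_of_nonneg_left hyδ ha0
    have h2 := mul_nonneg (sub_nonneg.2 ha1) (neg_nonneg.2 hx0)
    linarith
  have haε' : a ≤ 4 * u / δ * (1 / √(t : ℝ)) := haε ▸ min_le_left _ _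
  -- Late rounds: `aδ = ε` and the two terms cancel exactly. Early rounds: the slack is dropped and
  -- `Q` is bounded deterministically.
  have hextra : ε / V * EQ - a * δ / V * EQ ≤ if (t : ℝ) ≤ (4 * u / δ) ^ 2
      then 16 / δ + 128 * u / δ * (1 / √(t : ℝ)) else 0 := by
    split_ifs with hK
    · have h1 : ε / V * EQ ≤ ε / V * (t + 8 * u * √(t : ℝ)) :=
        mul_le_mul_of_nonneg_left hEQ1 (by positivity)
      have h3 : 0 ≤ a * δ / V * EQ := by positivity
      linarith
    · have h1 : a * δ = ε := by
        rw [ha, min_eq_left ((div_le_one hδ).2 (hεδ (not_le.1 hK))), div_mul_cancel₀ _ hδ.ne']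
      rw [h1, sub_self]
  linarith

omit [Countable X] [MeasurableSpace X] [MeasurableSingletonClass X] [IsProbabilityMeasure P] in
theorem integral_meanReward_nonneg (hM : M.Bounded) (t : ℕ) :
    0 ≤ ∫ ω, M.meanReward (c t ω) (A t ω) ∂P :=
  integral_nonneg fun _ => (hM.meanReward_mem _ _).1

/-- A bound for every feasible policy is a bound for the baseline. -/
theorem regret_le_of_forall (h : IsInteraction M T P c A R W) (hM : M.Bounded) {δ : ℝ}
    (hδ : 0 < δ) (hS : M.Slater δ) {n : ℕ} (hn : n ∈ Finset.Icc 1 T) {B : ℝ}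
    (hB : ∀ x, Model.IsPolicy x → M.policyCost x ≤ 0 → n * M.policyReward x
      ≤ ∑ t ∈ Finset.Icc 1 n, ∫ ω, M.meanReward (c t ω) (A t ω) ∂P + B) :
    regret M P R n ≤ B := by
  rw [Finset.mem_Icc] at hn
  have hn0 : (0 : ℝ) < n := by exact_mod_cast hn.1
  obtain ⟨y, hy, hyδ⟩ := hS
  rw [regret, h.integral_sum_reward hM hn.2, sub_le_iff_le_add']
  have hle : M.baseline
      ≤ (∑ t ∈ Finset.Icc 1 n, ∫ ω, M.meanReward (c t ω) (A t ω) ∂P + B) / n := by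
    refine csSup_le ⟨_, y, ⟨hy, by linarith⟩, rfl⟩ ?_
    rintro _ ⟨x, ⟨hx, hx0⟩, rfl⟩
    rw [le_div_iff₀ hn0, mul_comm]
    exact hB x hx hx0
  rw [le_div_iff₀ hn0, mul_comm] at hle
  exact hle

theorem regret_le_self (h : IsInteraction M T P c A R W) (hM : M.Bounded) {δ : ℝ}
    (hδ : 0 < δ) (hS : M.Slater δ) {n : ℕ} (hn : n ∈ Finset.Icc 1 T) : regret M P R n ≤ n := by
  refine h.regret_le_of_forall hM hδ hS hn fun x hx _ => ?_
  have h1 := (Model.policyReward_mem hM hx).2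
  have h2 : 0 ≤ ∑ t ∈ Finset.Icc 1 n, ∫ ω, M.meanReward (c t ω) (A t ω) ∂P :=
    Finset.sum_nonneg fun t _ => integral_meanReward_nonneg hM t
  have h3 : (0 : ℝ) ≤ n := Nat.cast_nonneg n
  nlinarith

theorem regret_le (h : IsInteraction M T P c A R W) (hM : M.Bounded) {δ : ℝ} (hδ : 0 < δ)
    (hδ1 : δ ≤ 1) (hS : M.Slater δ)
    (hA : ∀ᵐ ω ∂P, FollowsAlgorithm M T δ (fun t => c t ω) (fun t => A t ω) (fun t => R t ω)
      (fun t => W t ω)) {n : ℕ} (hn : n ∈ Finset.Icc 1 T) :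
    regret M P R n ≤ 235 * (d : ℝ) ^ 4 * Real.log (1 + T) ^ 4 / δ ^ 3
      + (8 * d + 24) * √(n : ℝ) * Real.log (1 + T) / δ
      + 2 + 10 * d * √(n : ℝ) * Real.log (1 + T) := by
  have hd := hS.pos_dim hδ
  have hn' := Finset.mem_Icc.1 hn
  have hT : 0 < T := by omega
  have hT1 : (1 : ℝ) ≤ T := by exact_mod_cast hT
  have hnT : (n : ℝ) ≤ T := by exact_mod_cast hn'.2
  have hd1 : (1 : ℝ) ≤ d := by exact_mod_cast hd
  have hL : 0 < Real.log (1 + T) := Real.log_pos (by linarith)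
  have hn0 : (0 : ℝ) < n := by exact_mod_cast hn'.1
  have hsn : 0 < √(n : ℝ) := Real.sqrt_pos.2 hn0
  have hsn2 : √(n : ℝ) ^ 2 = n := Real.sq_sqrt hn0.le
  set L := Real.log (1 + T) with hLdef
  have hLu : L ≤ d * L := by nlinarith
  have e1 : 235 * (d : ℝ) ^ 4 * L ^ 4 / δ ^ 3 = 235 * (d * L) ^ 4 / δ ^ 3 := by ring
  have e2 : (8 * d + 24) * √(n : ℝ) * L / δ
      = 8 * (d * L) * √(n : ℝ) / δ + 24 * L * √(n : ℝ) / δ := by ring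
  have e3 : 10 * d * √(n : ℝ) * L = 10 * (d * L) * √(n : ℝ) := by ring
  rw [e1, e2, e3]
  -- For short horizons the trivial bound `n = √n·√n ≤ 8u√n/δ` is already one of the stated terms.
  rcases le_or_gt (n : ℝ) (64 * (d * L) ^ 2 / δ ^ 2) with hsmall | hlarge
  · refine (h.regret_le_self hM hδ hS hn).trans ?_
    have h1 : √(n : ℝ) ≤ 8 * (d * L) / δ := by
      rw [Real.sqrt_le_iff]
      refine ⟨by positivity, hsmall.trans (le_of_eq ?_)⟩
      rw [div_pow]; ring
    have h2 : (n : ℝ) ≤ 8 * (d * L) * √(n : ℝ) / δ := by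
      calc (n : ℝ) = √(n : ℝ) * √(n : ℝ) := by rw [← sq, hsn2]
        _ ≤ 8 * (d * L) / δ * √(n : ℝ) := by gcongr
        _ = _ := by ring
    have h3 : 0 ≤ 235 * (d * L) ^ 4 / δ ^ 3 := by positivity
    have h4 : 0 ≤ 24 * L * √(n : ℝ) / δ := by positivity
    have h5 : 0 ≤ 10 * (d * L) * √(n : ℝ) := by positivity
    linarith
  have hL8 : 8 ≤ L := by
    refine eight_le_log_of_lt hT (lt_of_le_of_lt ?_ (hlarge.trans_le hnT))
    rw [le_div_iff₀ (by positivity)]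
    have h1 : δ ^ 2 ≤ 1 := pow_le_one₀ hδ.le hδ1
    have h2 : L ^ 2 ≤ (d * L) ^ 2 := pow_le_pow_left₀ hL.le hLu 2
    nlinarith [sq_nonneg L]
  refine h.regret_le_of_forall hM hδ hS hn fun x hx hx0 => ?_
  have hmem : ∀ t ∈ Finset.Icc 1 n, t ∈ Finset.Icc 1 T := by
    intro t ht; simp only [Finset.mem_Icc] at *; omega
  have hsum := Finset.sum_le_sum fun t ht =>
    h.policyReward_le_of_feasible hM hd hδ hS hA (hmem t ht) hx hx0
  simp only [Finset.sum_add_distrib, ← Finset.mul_sum, Finset.sum_const, Nat.card_Icc,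
    Nat.add_sub_cancel, nsmul_eq_mul] at hsum
  rw [← hLdef] at hsum
  set u := d * L with hu
  have hu8 : 8 ≤ u := by linarith
  have hconf := (h.sum_integral_playedWidth_le hd hM.norm_phi_le hn'.2).trans
    (confidence_sum_le hd1 hL8 hn0.le)
  have htel := sum_sub_succ_div_le
    (l := fun t => ∫ ω in goodEvent M T c A R W t, dualVariable M T c A W t ω ^ 2 ∂P)
    (V := fun t => 2 * weight d T δ t) (fun t => integral_nonneg fun ω => sq_nonneg _)
    (fun t ht => mul_pos two_pos (weight_pos hd hT hδ ht))
    (fun t _ => mul_le_mul_of_nonneg_left (weight_mono hδ.le (Nat.le_succ t)) zero_le_two) n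
  have hl1 : ∫ ω in goodEvent M T c A R W 1, dualVariable M T c A W 1 ω ^ 2 ∂P = 0 := by
    simp [dualVariable, dual]
  rw [hl1, zero_div] at htel
  have hbad : (n : ℝ) * (2 / T) ≤ 2 := by
    rw [mul_div_assoc', div_le_iff₀ (by linarith)]
    linarith
  have hs1 := sum_one_div_sqrt_le n
  have hs2 := sum_one_div_mul_sqrt_le n
  have hs3 := sum_ite_one_add_one_div_sqrt_le (K := 4 * u / δ) (a := 16 / δ) (b := 128 * u / δ)
    (by positivity) (by positivity) (by positivity) n
  have b1 : 4 * u / δ * ∑ t ∈ Finset.Icc 1 n, 1 / √(t : ℝ) ≤ 8 * u * √(n : ℝ) / δ := by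
    calc _ ≤ 4 * u / δ * (2 * √(n : ℝ)) := by gcongr
      _ = _ := by ring
  -- This is `8/u` times `√n/δ`, far below `24L` since both `u` and `L` are at least `8`.
  have b2 : 4 / (δ * u) * ∑ t ∈ Finset.Icc 1 n, 1 / √(t : ℝ) ≤ 24 * L * √(n : ℝ) / δ := by
    calc _ ≤ 4 / (δ * u) * (2 * √(n : ℝ)) := by gcongr
      _ = 8 / u * √(n : ℝ) / δ := by field_simp; ring
      _ ≤ _ := by
        gcongr
        rw [div_le_iff₀ (by linarith)]
        have := mul_le_mul hL8 hu8 (by norm_num) hL.le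
        linarith
  have b3 : 64 * u / δ * ∑ t ∈ Finset.Icc 1 n, 1 / ((t : ℝ) * √(t : ℝ)) ≤ 192 * u / δ := by
    calc _ ≤ 64 * u / δ * 3 := by gcongr
      _ = _ := by ring
  have b4 := regret_constants_le hδ hδ1 hu8
  have b5 : 0 ≤ u * √(n : ℝ) := by positivity
  linarith

end IsInteraction

end Regret

/-! ### Exponential drift of the dual variable -/

section Drift

/-- `exp x ≤ 1 + x + x²` for `|x| ≤ 1`. The range `3/2` covers an estimated cost in `[-1, 1]` plus a
tightness of at most `1/2`. -/
theorem exp_mul_le {r y : ℝ} (hr0 : 0 ≤ r) (hr : r ≤ 1 / 36) (hy : |y| ≤ 3 / 2) :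
    Real.exp (r * y) ≤ 1 + r * y + 9 / 4 * r ^ 2 := by
  have h1 : |r * y| ≤ r * (3 / 2) := by
    rw [abs_mul, abs_of_nonneg hr0]
    exact mul_le_mul_of_nonneg_left hy hr0
  have h2 := Real.abs_exp_sub_one_sub_id_le (x := r * y) (by linarith)
  have h3 : (r * y) ^ 2 ≤ (r * (3 / 2)) ^ 2 := sq_le_sq' (by linarith [(abs_le.1 h1).1])
    (abs_le.1 h1).2
  have h4 := (abs_le.1 h2).2
  nlinarith

variable {X Ω : Type*} {J d : ℕ} [Countable X] [MeasurableSpace X] [MeasurableSingletonClass X]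
  [mΩ : MeasurableSpace Ω] {P : Measure Ω} [IsProbabilityMeasure P] {M : Model X J d} {T : ℕ}
  {c : ℕ → Ω → X} {A : ℕ → Ω → Fin J} {R W : ℕ → Ω → ℝ}

omit [Countable X] [MeasurableSpace X] [MeasurableSingletonClass X] in
/-- In a good round, a large dual variable decreases up to the cost of any policy. -/
theorem IsGood.costEstimate_le_of_le_dual {c : ℕ → X} {A : ℕ → Fin J} {R W : ℕ → ℝ}
    (hM : M.Bounded) (hd : 0 < d) (hT : 0 < T)
    {δ : ℝ} (hδ : 0 < δ) {t : ℕ} (ht : t ∈ Finset.Icc 1 T) (h : IsGood M T c A R W t)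
    (hA : FollowsAlgorithm M T δ c A R W) {x : X → Fin J → ℝ} (hx : Model.IsPolicy x)
    {b θ : ℝ} (hθ : 0 < θ) (hb : 0 ≤ b) (hVθ : weight d T δ t ≤ b * θ)
    (hQ : θ ≤ dual M T c A W t) :
    costEstimate M T c A W t (c t) (A t) ≤ b + M.contextCost x (c t) := by
  have ht1 : 1 ≤ t := (Finset.mem_Icc.1 ht).1
  have hV := weight_pos (d := d) hd hT hδ ht1
  have h1 := h.le_pseudoValue hM hd hT hδ ht hA hx
  have h2 := rewardEstimate_le_one (M := M) (T := T) (c := c) (A := A) (R := R) t (c t) (A t)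
  have h3 := (Model.contextReward_mem hM hx (c t)).1
  set Q := dual M T c A W t
  set V := weight d T δ t
  have hQ0 : 0 < Q := hθ.trans_le hQ
  have h4 : Q / V * (costEstimate M T c A W t (c t) (A t) - M.contextCost x (c t)) ≤ 1 := by
    rw [mul_sub]; linarith
  have h5 : V ≤ b * Q := hVθ.trans (mul_le_mul_of_nonneg_left hQ hb)
  rw [div_mul_eq_mul_div, div_le_one hV] at h4
  have h6 := le_of_mul_le_mul_left (by linarith : Q * (costEstimate M T c A W t (c t) (A t)
    - M.contextCost x (c t)) ≤ Q * b) hQ0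
  linarith

omit [Countable X] [MeasurableSpace X] [MeasurableSingletonClass X] in
/-- One step of the exponential drift along a trajectory. -/
theorem IsGood.exp_dual_succ_le {c : ℕ → X} {A : ℕ → Fin J} {R W : ℕ → ℝ}
    (hM : M.Bounded) (hd : 0 < d) (hT : 0 < T)
    {δ : ℝ} (hδ : 0 < δ) (hδ1 : δ ≤ 1) {t : ℕ} (ht : t ∈ Finset.Icc 1 T)
    (h : IsGood M T c A R W t) (hA : FollowsAlgorithm M T δ c A R W) {x : X → Fin J → ℝ}
    (hx : Model.IsPolicy x) {r θ : ℝ} (hr0 : 0 ≤ r) (hr : r ≤ 1 / 36) (hθ : 1 ≤ θ)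
    (hVθ : weight d T δ t ≤ 3 / 8 * δ * θ) (hε : tightness d T t ≤ δ / 2) :
    Real.exp (r * dual M T c A W (t + 1))
      ≤ (1 + r * (7 / 8 * δ) + 9 / 4 * r ^ 2 + r * M.contextCost x (c t))
        * {q : ℝ | θ ≤ q}.indicator (fun q => Real.exp (r * q)) (dual M T c A W t)
        + Real.exp (r * (θ + 2)) := by
  have ht1 : 1 ≤ t := (Finset.mem_Icc.1 ht).1
  have hε0 := tightness_nonneg d T t
  have hw1 := neg_one_le_costEstimate (M := M) (T := T) (c := c) (A := A) (W := W) t (c t) (A t)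
  have hw2 := costEstimate_le_one (M := M) (T := T) (c := c) (A := A) (W := W) t (c t) (A t)
  have hQ0 := dual_nonneg (M := M) (T := T) (c := c) (A := A) (W := W) t
  rw [dual_succ ht1]
  by_cases hQ : θ ≤ dual M T c A W t
  · have hw := h.costEstimate_le_of_le_dual hM hd hT hδ ht hA hx (by linarith) (by linarith)
      hVθ hQ
    rw [Set.indicator_of_mem (by exact hQ)]
    set Q := dual M T c A W t
    set w := costEstimate M T c A W t (c t) (A t)
    set ε := tightness d T t
    rw [max_eq_left (by linarith)]
    have h1 : Real.exp (r * (w + ε)) ≤ 1 + r * (w + ε) + 9 / 4 * r ^ 2 :=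
      exp_mul_le hr0 hr (abs_le.2 ⟨by linarith, by linarith⟩)
    have h2 : r * (w + ε) ≤ r * (7 / 8 * δ) + r * M.contextCost x (c t) := by
      rw [← mul_add]
      exact mul_le_mul_of_nonneg_left (by linarith) hr0
    have h3 : Real.exp (r * (Q + w + ε)) = Real.exp (r * (w + ε)) * Real.exp (r * Q) := by
      rw [← Real.exp_add]; ring_nf
    rw [h3]
    have h4 : Real.exp (r * (w + ε)) ≤
        1 + r * (7 / 8 * δ) + 9 / 4 * r ^ 2 + r * M.contextCost x (c t) := by linarith
    have h5 := mul_le_mul_of_nonneg_right h4 (Real.exp_pos (r * Q)).le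
    have h6 := Real.exp_pos (r * (θ + 2))
    linarith
  · rw [Set.indicator_of_notMem (by exact hQ), mul_zero, zero_add]
    rw [not_le] at hQ
    -- Below `θ` one step adds at most `1 + δ/2`, so the next value is at most `θ + 2`.
    refine Real.exp_le_exp.2 (mul_le_mul_of_nonneg_left (max_le (by linarith) (by linarith)) hr0)

namespace IsInteraction

theorem integrable_exp_dualVariable (h : IsInteraction M T P c A R W) {t : ℕ}
    (ht : t ∈ Finset.Icc 1 (T + 1)) {r : ℝ} (hr : 0 ≤ r) :
    Integrable (fun ω => Real.exp (r * dualVariable M T c A W t ω)) P := by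
  refine Integrable.of_bound ((h.measurable_dualVariable ht).const_mul r).exp.aestronglyMeasurable
    (Real.exp (r * (t + 8 * d * Real.log (1 + T) * √(t : ℝ))))
    (Filter.Eventually.of_forall fun ω => ?_)
  rw [Real.norm_of_nonneg (Real.exp_pos _).le]
  exact Real.exp_le_exp.2 (mul_le_mul_of_nonneg_left
    (dualVariable_mem (Finset.mem_Icc.1 ht).1 ω).2 hr)

/-- Above `θ` the exponential moment contracts on average; below `θ` it is bounded by a constant.
The trajectory bound only involves the cost of the policy on the current context, which becomes `-δ`
after averaging. -/
theorem exp_drift (h : IsInteraction M T P c A R W) (hM : M.Bounded) (hd : 0 < d)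
    {δ : ℝ} (hδ : 0 < δ) (hδ1 : δ ≤ 1)
    (hA : ∀ᵐ ω ∂P, FollowsAlgorithm M T δ (fun t => c t ω) (fun t => A t ω) (fun t => R t ω)
      (fun t => W t ω)) {t : ℕ} (ht : t ∈ Finset.Icc 1 T) {x : X → Fin J → ℝ}
    (hx : Model.IsPolicy x) (hxδ : M.policyCost x ≤ -δ) {θ : ℝ} (hθ : 1 ≤ θ)
    (hVθ : weight d T δ t ≤ 3 / 8 * δ * θ) (hε : tightness d T t ≤ δ / 2) :
    ∫ ω in goodEvent M T c A R W (t + 1), Real.exp (δ / 36 * dualVariable M T c A W (t + 1) ω) ∂P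
      ≤ (1 - δ ^ 2 / 576)
          * ∫ ω in goodEvent M T c A R W t, Real.exp (δ / 36 * dualVariable M T c A W t ω) ∂P
        + Real.exp (δ / 36 * (θ + 2)) := by
  have ht' := Finset.mem_Icc.1 ht
  have hT : 0 < T := by omega
  set r := δ / 36 with hr
  have hr0 : 0 ≤ r := by positivity
  have hr1 : r ≤ 1 / 36 := by rw [hr]; linarith
  set H := goodEvent M T c A R W t with hH
  have hle : history c A R W t ≤ mΩ := h.history_le (by omega)
  have hHm' : MeasurableSet[history c A R W t] H := measurableSet_goodEvent t
  have hHm : MeasurableSet H := hle _ hHm'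
  have hQm' : Measurable[history c A R W t] (dualVariable M T c A W t) := measurable_dual ht'.1
  have ht1 : t ∈ Finset.Icc 1 (T + 1) := by simp; omega
  have ht2 : t + 1 ∈ Finset.Icc 1 (T + 1) := by simp; omega
  have iE := h.integrable_exp_dualVariable (M := M) ht1 hr0
  have iE' := h.integrable_exp_dualVariable (M := M) ht2 hr0
  have hcm : Measurable (c t) := h.measurable_context t ht
  -- The contracting part of the moment. It is history-measurable, so the context cost factors out
  -- of the product.
  let U : Ω → ℝ := H.indicator fun ω =>
    {q : ℝ | θ ≤ q}.indicator (fun q => Real.exp (r * q)) (dualVariable M T c A W t ω)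
  have hUm' : Measurable[history c A R W t] U := by
    refine Measurable.indicator ?_ hHm'
    have : Measurable ({q : ℝ | θ ≤ q}.indicator fun q => Real.exp (r * q)) :=
      Measurable.indicator (by fun_prop) measurableSet_Ici
    exact this.comp hQm'
  have hU0 : ∀ ω, 0 ≤ U ω := fun ω =>
    Set.indicator_nonneg (fun _ _ => Set.indicator_nonneg (fun _ _ => (Real.exp_pos _).le) _) _
  have hUle : ∀ ω, U ω ≤ H.indicator (fun ω => Real.exp (r * dualVariable M T c A W t ω)) ω :=
    fun ω => Set.indicator_le_indicator
      (Set.indicator_apply_le' (fun _ => le_rfl) fun _ => (Real.exp_pos _).le)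
  have iU : Integrable U P := by
    refine (iE.indicator hHm).mono' (hUm'.mono hle le_rfl).aestronglyMeasurable
      (Filter.Eventually.of_forall fun ω => ?_)
    rw [Real.norm_of_nonneg (hU0 ω)]
    exact hUle ω
  have icU : Integrable (fun ω => M.contextCost x (c t ω) * U ω) P :=
    iU.bdd_mul (c := 1) ((measurable_of_countable (M.contextCost x)).comp hcm).aestronglyMeasurable
      (Filter.Eventually.of_forall fun ω => Model.abs_contextCost_le hM hx _)
  have hpt : ∀ᵐ ω ∂P, H.indicator (fun ω => Real.exp (r * dualVariable M T c A W (t + 1) ω)) ω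
      ≤ (1 + r * (7 / 8 * δ) + 9 / 4 * r ^ 2) * U ω + r * (M.contextCost x (c t ω) * U ω)
        + Real.exp (r * (θ + 2)) := by
    filter_upwards [hA] with ω hAω
    by_cases hω : ω ∈ H
    · have h1 := IsGood.exp_dual_succ_le hM hd hT hδ hδ1 ht hω hAω hx hr0 hr1 hθ hVθ hε
      simp only [U, Set.indicator_of_mem hω]
      simp only [dualVariable]
      linarith
    · have : 0 < Real.exp (r * (θ + 2)) := Real.exp_pos _
      simp only [U, Set.indicator_of_notMem hω]
      linarith
  have j1 : Integrable (fun ω => (1 + r * (7 / 8 * δ) + 9 / 4 * r ^ 2) * U ω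
      + r * (M.contextCost x (c t ω) * U ω)) P := (iU.const_mul _).add (icU.const_mul _)
  have hint := integral_mono_ae (iE'.indicator hHm) (j1.add (integrable_const _)) hpt
  simp only [Pi.add_apply] at hint
  rw [integral_add j1 (integrable_const _), integral_add (iU.const_mul _) (icU.const_mul _),
    integral_const_mul, integral_const_mul,
    h.integral_context_mul ht (Model.abs_contextCost_le hM hx) hUm', integral_indicator hHm,
    integral_const, probReal_univ, one_smul] at hint
  change _ ≤ _ + r * (M.policyCost x * _) + _ at hint
  have e1 : ∫ ω in goodEvent M T c A R W (t + 1),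
        Real.exp (r * dualVariable M T c A W (t + 1) ω) ∂P
      ≤ ∫ ω in H, Real.exp (r * dualVariable M T c A W (t + 1) ω) ∂P :=
    setIntegral_mono_set iE'.integrableOn (Filter.Eventually.of_forall fun ω => (Real.exp_pos _).le)
      (goodEvent_anti (Nat.le_succ t)).eventuallyLE
  have e2 : ∫ ω, U ω ∂P ≤ ∫ ω in H, Real.exp (r * dualVariable M T c A W t ω) ∂P := by
    rw [← integral_indicator hHm]
    exact integral_mono iU (iE.indicator hHm) hUle
  have e3 : 0 ≤ ∫ ω, U ω ∂P := integral_nonneg hU0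
  -- The rate `r = δ/36` minimizes `-rδ/8 + (9/4)r²`, with value `-δ²/576`.
  have e4 : (1 + r * (7 / 8 * δ) + 9 / 4 * r ^ 2) * ∫ ω, U ω ∂P
      + r * (M.policyCost x * ∫ ω, U ω ∂P) ≤ (1 - δ ^ 2 / 576) * ∫ ω, U ω ∂P := by
    have h1 : r * (M.policyCost x * ∫ ω, U ω ∂P) ≤ r * (-δ * ∫ ω, U ω ∂P) :=
      mul_le_mul_of_nonneg_left (mul_le_mul_of_nonneg_right hxδ e3) hr0
    refine (add_le_add_right h1 _).trans (le_of_eq ?_)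
    rw [hr]; ring
  have e5 : (1 - δ ^ 2 / 576) * ∫ ω, U ω ∂P
      ≤ (1 - δ ^ 2 / 576) * ∫ ω in H, Real.exp (r * dualVariable M T c A W t ω) ∂P := by
    refine mul_le_mul_of_nonneg_left e2 ?_
    have : δ ^ 2 ≤ 1 := pow_le_one₀ hδ.le hδ1
    linarith
  linarith

/-- The expected dual variable on the good event. -/
theorem integral_dualVariable_le (h : IsInteraction M T P c A R W) (hM : M.Bounded)
    {δ : ℝ} (hδ : 0 < δ) (hδ1 : δ ≤ 1) (hS : M.Slater δ)
    (hA : ∀ᵐ ω ∂P, FollowsAlgorithm M T δ (fun t => c t ω) (fun t => A t ω) (fun t => R t ω)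
      (fun t => W t ω)) {n : ℕ} (hn : n ∈ Finset.Icc 1 T) (hu : 8 ≤ d * Real.log (1 + T))
    (hlarge : 64 * (d * Real.log (1 + T)) ^ 2 / δ ^ 2 < n) :
    ∫ ω in goodEvent M T c A R W (n + 1), dualVariable M T c A W (n + 1) ω ∂P
      ≤ max (128 * (d * Real.log (1 + T)) ^ 2 / δ ^ 2)
        (2 / 3 * (d * Real.log (1 + T)) * √(n : ℝ) + 2 + 36 / δ * Real.log (576 / δ ^ 2)) := by
  have hd := hS.pos_dim hδ
  obtain ⟨y, hy, hyδ⟩ := hS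
  have hn' := Finset.mem_Icc.1 hn
  have hT : 0 < T := by omega
  have hn1 : (1 : ℝ) ≤ n := by exact_mod_cast hn'.1
  set u := d * Real.log (1 + T) with hudef
  have hu0 : 0 < u := by linarith
  set B := max (128 * u ^ 2 / δ ^ 2)
    (2 / 3 * u * √(n : ℝ) + 2 + 36 / δ * Real.log (576 / δ ^ 2)) with hB
  set r := δ / 36 with hr
  have hr0 : 0 < r := by positivity
  -- Chosen so that `V_n = (3/8)δθ`; by monotonicity one threshold serves all rounds up to `n`.
  set θ := 2 / 3 * u * √(n : ℝ) with hθdef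
  have hsn1 : 1 ≤ √(n : ℝ) := Real.one_le_sqrt.2 hn1
  have hθ : 1 ≤ θ := by
    rw [hθdef]
    nlinarith
  have hB1 : 128 * u ^ 2 / δ ^ 2 ≤ B := le_max_left _ _
  have hB2 : θ + 2 + 36 / δ * Real.log (576 / δ ^ 2) ≤ B := le_max_right _ _
  -- From this round on `√t ≥ 8u/δ`, which is `ε_t ≤ δ/2`.
  set t₁ := ⌈64 * u ^ 2 / δ ^ 2⌉₊ with ht₁
  have ht₁pos : 1 ≤ t₁ := Nat.ceil_pos.2 (by positivity)
  have ht₁n : t₁ ≤ n := Nat.ceil_le.2 hlarge.le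
  -- `B` is large enough that `exp(rB)` is preserved by the affine recursion of `exp_drift`.
  have hexp : Real.exp (r * (θ + 2)) ≤ δ ^ 2 / 576 * Real.exp (r * B) := by
    have h1 : r * (θ + 2) + Real.log (576 / δ ^ 2) ≤ r * B := by
      have : r * (36 / δ * Real.log (576 / δ ^ 2)) = Real.log (576 / δ ^ 2) := by
        rw [hr]; field_simp
      calc _ = r * (θ + 2 + 36 / δ * Real.log (576 / δ ^ 2)) := by rw [mul_add r (θ + 2), this]
        _ ≤ _ := mul_le_mul_of_nonneg_left hB2 hr0.le
    have h2 := Real.exp_le_exp.2 h1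
    rw [Real.exp_add, Real.exp_log (by positivity), mul_div_assoc', div_le_iff₀ (by positivity)] at h2
    linarith
  have key : ∀ t, t₁ ≤ t → t ≤ n + 1 →
      ∫ ω in goodEvent M T c A R W t, Real.exp (r * dualVariable M T c A W t ω) ∂P
        ≤ Real.exp (r * B) := by
    intro t ht
    induction t, ht using Nat.le_induction with
    | base =>
      intro _
      have hint := h.integrable_exp_dualVariable (M := M) (t := t₁) (by simp; omega) hr0.le
      -- At the start only `s = t₁ - 1 < 64u²/δ²` rounds have acted, so the deterministic bound
      -- gives at most `128u²/δ² ≤ B`.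
      have hbound : ∀ ω, dualVariable M T c A W t₁ ω ≤ B := by
        intro ω
        obtain ⟨s, hs⟩ := Nat.exists_eq_add_of_le' ht₁pos
        have h1 := dual_succ_le (M := M) (T := T) (c := fun s => c s ω) (A := fun s => A s ω)
          (W := fun s => W s ω) s
        rw [dualVariable, hs]
        refine h1.trans (le_trans ?_ hB1)
        have hs1 : (s : ℝ) ≤ 64 * u ^ 2 / δ ^ 2 := by
          have : s < t₁ := by omega
          exact (Nat.lt_ceil.1 this).le
        have hs2 : √(s : ℝ) ≤ 8 * u / δ := by
          rw [Real.sqrt_le_iff]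
          refine ⟨by positivity, hs1.trans (le_of_eq ?_)⟩
          rw [div_pow]; ring
        calc s + 8 * d * Real.log (1 + T) * √(s : ℝ) = s + 8 * u * √(s : ℝ) := by
              rw [hudef]; ring
          _ ≤ 64 * u ^ 2 / δ ^ 2 + 8 * u * (8 * u / δ) := by gcongr
          _ ≤ 64 * u ^ 2 / δ ^ 2 + 64 * u ^ 2 / δ ^ 2 := by
              have : 8 * u * (8 * u / δ) = 64 * u ^ 2 / δ ^ 2 * δ := by field_simp; ring
              rw [this]
              gcongr
              exact mul_le_of_le_one_right (by positivity) hδ1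
          _ = _ := by ring
      calc _ ≤ ∫ ω, Real.exp (r * dualVariable M T c A W t₁ ω) ∂P :=
            setIntegral_le_integral hint (Filter.Eventually.of_forall fun ω => (Real.exp_pos _).le)
        _ ≤ ∫ _ω, Real.exp (r * B) ∂P := integral_mono hint (integrable_const _) fun ω =>
            Real.exp_le_exp.2 (mul_le_mul_of_nonneg_left (hbound ω) hr0.le)
        _ = _ := by simp
    | succ t ht ih =>
      intro htn
      have ht1 : 1 ≤ t := ht₁pos.trans ht
      have htpos : (0 : ℝ) < t := by exact_mod_cast ht1
      have htn' : (t : ℝ) ≤ n := by exact_mod_cast (by omega : t ≤ n)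
      have hst : 8 * u / δ ≤ √(t : ℝ) := by
        apply Real.le_sqrt_of_sq_le
        have h1 : 64 * u ^ 2 / δ ^ 2 ≤ t := (Nat.le_ceil _).trans (by exact_mod_cast ht)
        refine le_trans (le_of_eq ?_) h1
        rw [div_pow]; ring
      have hVθ : weight d T δ t ≤ 3 / 8 * δ * θ := by
        rw [weight_eq, ← hudef, hθdef]
        calc δ * u * √(t : ℝ) / 4 ≤ δ * u * √(n : ℝ) / 4 := by gcongr
          _ = _ := by ring
      have hε : tightness d T t ≤ δ / 2 := by
        rw [tightness_eq_div, ← hudef, div_le_iff₀ (Real.sqrt_pos.2 htpos)]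
        rw [div_le_iff₀ hδ] at hst
        linarith
      have hstep := h.exp_drift hM hd hδ hδ1 hA (t := t) (by simp; omega) hy hyδ hθ hVθ hε
      have h2 : (1 - δ ^ 2 / 576)
          * ∫ ω in goodEvent M T c A R W t, Real.exp (r * dualVariable M T c A W t ω) ∂P
          ≤ (1 - δ ^ 2 / 576) * Real.exp (r * B) := by
        refine mul_le_mul_of_nonneg_left (ih (by omega)) ?_
        have : δ ^ 2 ≤ 1 := pow_le_one₀ hδ.le hδ1
        linarith
      linarith
  have hZ := key (n + 1) (by omega) le_rfl
  have hmem : n + 1 ∈ Finset.Icc 1 (T + 1) := by simp; omega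
  have iQ : Integrable (dualVariable M T c A W (n + 1)) P := by
    simpa using h.integrable_dualVariable_pow (M := M) hmem 1
  have iE := h.integrable_exp_dualVariable (M := M) hmem hr0.le
  -- Makes `rB - 1` nonnegative, so that multiplying it by the probability of the good event can
  -- only decrease it.
  have hrB : 1 ≤ r * B := by
    have h1 : r * (128 * u ^ 2 / δ ^ 2) ≤ r * B := mul_le_mul_of_nonneg_left hB1 hr0.le
    refine le_trans ?_ h1
    rw [hr, div_mul_div_comm, le_div_iff₀ (by positivity)]
    have h2 : δ * δ ≤ δ * 1 := mul_le_mul_of_nonneg_left hδ1 hδ.le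
    have h3 : 36 ≤ 128 * u ^ 2 := by nlinarith
    have h4 := mul_le_mul_of_nonneg_left h3 hδ.le
    linarith
  -- The tangent line of `exp` replaces Jensen's inequality, which would need a normalized measure
  -- on the good event.
  have hpt : ∀ ω, r * dualVariable M T c A W (n + 1) ω
      ≤ Real.exp (-(r * B)) * Real.exp (r * dualVariable M T c A W (n + 1) ω) + (r * B - 1) := by
    intro ω
    rw [← Real.exp_add]
    have := Real.add_one_le_exp (-(r * B) + r * dualVariable M T c A W (n + 1) ω)
    linarith
  have hint := integral_mono (μ := P.restrict (goodEvent M T c A R W (n + 1)))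
    (iQ.restrict.const_mul r)
    ((iE.restrict.const_mul (Real.exp (-(r * B)))).add (integrable_const (r * B - 1))) hpt
  simp only [Pi.add_apply] at hint
  rw [integral_const_mul, integral_add (iE.restrict.const_mul _) (integrable_const _),
    integral_const_mul, setIntegral_const, smul_eq_mul] at hint
  have h1 : Real.exp (-(r * B)) * ∫ ω in goodEvent M T c A R W (n + 1),
      Real.exp (r * dualVariable M T c A W (n + 1) ω) ∂P ≤ 1 := by
    calc _ ≤ Real.exp (-(r * B)) * Real.exp (r * B) := by gcongr
      _ = 1 := by rw [← Real.exp_add]; simp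
  have h2 : P.real (goodEvent M T c A R W (n + 1)) * (r * B - 1) ≤ r * B - 1 :=
    mul_le_of_le_one_left (by linarith) measureReal_le_one
  exact le_of_mul_le_mul_left (by linarith) hr0

end IsInteraction

end Drift

/-! ### Constraint violation -/

section Violation

theorem log_sixteen_div_nonneg {δ : ℝ} (hδ : 0 < δ) (hδ1 : δ ≤ 1) : 0 ≤ Real.log (16 / δ) :=
  Real.log_nonneg (by rw [le_div_iff₀ hδ]; linarith)

/-- In the second case of the maximum the coefficient of `uq` is `2/3 + 5.2 - 8 < -2`, and the
logarithm is absorbed: `(36/δ) log(576/δ²) ≤ 1728/δ² ≤ 128u²/δ²` for `u ≥ 8`. -/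
theorem violation_constants_le {u δ q conf Q : ℝ} (hδ : 0 < δ) (hδ1 : δ ≤ 1) (hu : 8 ≤ u)
    (hq : 0 ≤ q) (hconf : conf ≤ 5.2 * u * q)
    (hQ : Q ≤ max (128 * u ^ 2 / δ ^ 2) (2 / 3 * u * q + 2 + 36 / δ * Real.log (576 / δ ^ 2))) :
    Q + conf - 8 * u * (q - 1) + 4 ≤ 128 * u ^ 2 / δ ^ 2 + 12 / δ + 2 * u * (4 - q) := by
  have huq : 0 ≤ u * q := by positivity
  have h12 : 12 ≤ 12 / δ := by rw [le_div_iff₀ hδ]; linarith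
  rcases le_max_iff.1 hQ with h | h
  · linarith
  · have h1 : Real.log (576 / δ ^ 2) ≤ 48 / δ := by
      have e : 576 / δ ^ 2 = (24 / δ) ^ 2 := by rw [div_pow]; norm_num
      rw [e, Real.log_pow]
      have := Real.log_le_sub_one_of_pos (show 0 < 24 / δ by positivity)
      have e2 : 48 / δ = 2 * (24 / δ) := by ring
      rw [e2]
      push_cast
      linarith
    have h2 : 36 / δ * Real.log (576 / δ ^ 2) ≤ 128 * u ^ 2 / δ ^ 2 := by
      calc _ ≤ 36 / δ * (48 / δ) := by gcongr
        _ = 1728 / δ ^ 2 := by field_simp; norm_num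
        _ ≤ _ := by
          gcongr
          nlinarith
    linarith

/-- For `T ≥ 2`, `log(1+T) ≤ 2 log T`, so the hypothesis gives `√τ ≥ 500u/δ²` and the negative term
is at least `1000u²/δ²`. The positive ones are at most `(128 + 768 + 12 + 8)u²/δ²`. -/
theorem violation_bound_nonpos {T d : ℕ} {δ τ : ℝ} (hδ : 0 < δ) (hδ1 : δ ≤ 1) (hT : 2 ≤ T)
    (hd : 0 < d) (hτ : 1000000 * ((d : ℝ) ^ 2 * Real.log T ^ 2 / δ ^ 4) ≤ τ) :
    128 * (d : ℝ) ^ 2 * Real.log (1 + T) ^ 2 / δ ^ 2 + 48 / δ * Real.log (16 / δ) + 12 / δ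
      + 2 * d * (4 - √τ) * Real.log (1 + T) ≤ 0 := by
  have hd1 : (1 : ℝ) ≤ d := by exact_mod_cast hd
  have hT2 : (2 : ℝ) ≤ T := by exact_mod_cast hT
  have hL1 : 1 ≤ Real.log (1 + T) := by
    rw [Real.le_log_iff_exp_le (by linarith)]
    linarith [Real.exp_one_lt_d9]
  have hL2 : Real.log (1 + T) ≤ 2 * Real.log T := by
    have : (2 : ℝ) * Real.log T = Real.log ((T : ℝ) ^ 2) := by rw [Real.log_pow]; norm_num
    rw [this]
    exact Real.log_le_log (by linarith) (by nlinarith)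
  have hsq : 500 * (d * Real.log (1 + T)) / δ ^ 2 ≤ √τ := by
    apply Real.le_sqrt_of_sq_le
    refine le_trans ?_ hτ
    have e : 1000000 * ((d : ℝ) ^ 2 * Real.log T ^ 2 / δ ^ 4)
        = (500 * (d * (2 * Real.log T)) / δ ^ 2) ^ 2 := by field_simp; ring
    rw [e]
    gcongr
  have e1 : 128 * (d : ℝ) ^ 2 * Real.log (1 + T) ^ 2 / δ ^ 2
      = 128 * (d * Real.log (1 + T)) ^ 2 / δ ^ 2 := by ring
  have e2 : 2 * d * (4 - √τ) * Real.log (1 + T)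
      = 8 * (d * Real.log (1 + T)) - 2 * (d * Real.log (1 + T)) * √τ := by ring
  have hu1 : 1 ≤ d * Real.log (1 + T) := by nlinarith
  rw [e1, e2]
  set u := d * Real.log (1 + T)
  have h1 : 1000 * u ^ 2 / δ ^ 2 ≤ 2 * u * √τ := by
    calc 1000 * u ^ 2 / δ ^ 2 = 2 * u * (500 * u / δ ^ 2) := by ring
      _ ≤ _ := by gcongr
  have hlog : Real.log (16 / δ) ≤ 16 / δ := by
    have := Real.log_le_sub_one_of_pos (show 0 < 16 / δ by positivity)
    linarith
  have h2 : 48 / δ * Real.log (16 / δ) ≤ 768 * u ^ 2 / δ ^ 2 := by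
    calc _ ≤ 48 / δ * (16 / δ) := by gcongr
      _ = 768 / δ ^ 2 := by field_simp; norm_num
      _ ≤ _ := by
        gcongr
        nlinarith
  have hδ2 : δ ^ 2 ≤ 1 := pow_le_one₀ hδ.le hδ1
  have h3 : 12 / δ ≤ 12 * u ^ 2 / δ ^ 2 := by
    rw [div_le_div_iff₀ hδ (by positivity)]
    have : δ ^ 2 ≤ u ^ 2 * δ := by
      have h5 : δ * δ ≤ 1 * δ := mul_le_mul_of_nonneg_right hδ1 hδ.le
      have h6 : 1 * δ ≤ u ^ 2 * δ := mul_le_mul_of_nonneg_right (by nlinarith) hδ.le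
      linarith
    linarith
  have h4 : 8 * u ≤ 8 * u ^ 2 / δ ^ 2 := by
    rw [le_div_iff₀ (by positivity)]
    nlinarith
  have h5 : 0 ≤ u ^ 2 / δ ^ 2 := by positivity
  have e3 : ∀ k : ℝ, k * u ^ 2 / δ ^ 2 = k * (u ^ 2 / δ ^ 2) := fun k => by ring
  rw [e3] at h1 h2 h3 h4 ⊢
  linarith

variable {X Ω : Type*} {J d : ℕ} [Countable X] [MeasurableSpace X] [MeasurableSingletonClass X]
  [mΩ : MeasurableSpace Ω] {P : Measure Ω} [IsProbabilityMeasure P] {M : Model X J d} {T : ℕ}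
  {c : ℕ → Ω → X} {A : ℕ → Ω → Fin J} {R W : ℕ → Ω → ℝ}

namespace IsInteraction

/-- Along a good trajectory the accumulated cost is controlled by the dual variable. -/
theorem _root_.ConstrainedBandit.sum_meanCost_le_of_isGood {X : Type*} {M : Model X J d}
    {c : ℕ → X} {A : ℕ → Fin J} {R W : ℕ → ℝ} (hM : M.Bounded) (hd : 0 < d) (hT : 0 < T) (n : ℕ)
    (h : IsGood M T c A R W (n + 1)) :
    ∑ t ∈ Finset.Icc 1 n, M.meanCost (c t) (A t)
      ≤ dual M T c A W (n + 1) + ∑ t ∈ Finset.Icc 1 n,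
        (2 * (radius d T t * confWidth (fun s => M.psi (c s) (A s)) t (M.psi (c t) (A t)))
          - tightness d T t) := by
  induction n with
  | zero => simp [dual]
  | succ n ih =>
    rw [Finset.sum_Icc_succ_top (by omega), Finset.sum_Icc_succ_top (by omega)]
    have h1 := ih (h.anti (by omega))
    have h2 := IsGood.meanCost_le hM hd hT (t := n + 1) (by omega) (h.anti (by omega)) (c (n + 1))
      (A (n + 1))
    have h3 := dual_succ (M := M) (T := T) (c := c) (A := A) (W := W) (t := n + 1) (by omega)
    have h4 := le_max_left (dual M T c A W (n + 1)
      + costEstimate M T c A W (n + 1) (c (n + 1)) (A (n + 1)) + tightness d T (n + 1)) 0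
    rw [← h3] at h4
    linarith

theorem integral_sum_cost_le_self (h : IsInteraction M T P c A R W) (hM : M.Bounded) {n : ℕ}
    (hn : n ≤ T) : ∫ ω, ∑ t ∈ Finset.Icc 1 n, W t ω ∂P ≤ n := by
  rw [h.integral_sum_cost hM hn]
  calc ∑ t ∈ Finset.Icc 1 n, ∫ ω, M.meanCost (c t ω) (A t ω) ∂P
      ≤ ∑ t ∈ Finset.Icc 1 n, (1 : ℝ) := by
        refine Finset.sum_le_sum fun t ht => ?_
        refine (integral_mono (h.integrable_meanCost hM ?_) (integrable_const 1) fun ω =>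
          (hM.meanCost_mem _ _).2).trans (by simp)
        simp only [Finset.mem_Icc] at *; omega
    _ = n := by simp

/-- On the good event the unrolled recursion applies. On its complement the cost is at most `n`, and
the tightening that is missing there is added back; this is the `2/T` term. -/
theorem integral_sum_cost_le_dual (h : IsInteraction M T P c A R W) (hM : M.Bounded)
    (hd : 0 < d) {n : ℕ} (hn : n ∈ Finset.Icc 1 T) :
    ∫ ω, ∑ t ∈ Finset.Icc 1 n, W t ω ∂P
      ≤ ∫ ω in goodEvent M T c A R W (n + 1), dualVariable M T c A W (n + 1) ω ∂P
        + 2 * ((1 + √((2 + d) * Real.log (1 + T))) * √(3 / 2 * (d * n * Real.log (1 + T))))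
        - 8 * (d * Real.log (1 + T)) * (√(n : ℝ) - 1)
        + 2 / T * (8 * (d * Real.log (1 + T)) * √(n : ℝ) + n) := by
  have hn' := Finset.mem_Icc.1 hn
  have hT : 0 < T := by omega
  have hmem : ∀ t ∈ Finset.Icc 1 n, t ∈ Finset.Icc 1 T := by
    intro t ht; simp only [Finset.mem_Icc] at *; omega
  have hw : ∀ t ∈ Finset.Icc 1 n, Integrable (fun ω => M.meanCost (c t ω) (A t ω)) P :=
    fun t ht => h.integrable_meanCost hM (hmem t ht)
  set conf := 2 * ((1 + √((2 + d) * Real.log (1 + T))) * √(3 / 2 * (d * n * Real.log (1 + T))))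
    with hconf
  have hconf0 : 0 ≤ conf := by positivity
  set H := goodEvent M T c A R W (n + 1) with hH
  have hHm : MeasurableSet H := h.history_le (by omega) _ (measurableSet_goodEvent (n + 1))
  have iQ : Integrable (dualVariable M T c A W (n + 1)) P := by
    simpa using h.integrable_dualVariable_pow (M := M) (t := n + 1) (by simp; omega) 1
  set E := ∑ t ∈ Finset.Icc 1 n, tightness d T t with hE
  have hE1 : E ≤ 8 * (d * Real.log (1 + T)) * √(n : ℝ) := by
    rw [← mul_assoc]; exact sum_tightness_le d T n
  have hE2 : 8 * (d * Real.log (1 + T)) * (√(n : ℝ) - 1) ≤ E := by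
    rw [← mul_assoc 8]; exact le_sum_tightness d T n
  rw [h.integral_sum_cost hM hn'.2, ← integral_finsetSum _ hw]
  have iw : Integrable (fun ω => ∑ t ∈ Finset.Icc 1 n, M.meanCost (c t ω) (A t ω)) P :=
    integrable_finsetSum _ hw
  have h1 : ∫ ω in H, ∑ t ∈ Finset.Icc 1 n, M.meanCost (c t ω) (A t ω) ∂P
      ≤ ∫ ω in H, dualVariable M T c A W (n + 1) ω ∂P + P.real H * (conf - E) := by
    have h2 := setIntegral_mono_on iw.integrableOn
      (iQ.integrableOn.add (integrable_const (conf - E)).integrableOn) hHm fun ω hω => by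
        have h3 := sum_meanCost_le_of_isGood hM hd hT n hω
        have h4 := sum_radius_mul_confWidth_le hd hn'.2 (fun s => M.psi (c s ω) (A s ω))
          fun _ _ => hM.norm_psi_le _ _
        rw [Finset.sum_sub_distrib] at h3
        change _ ≤ dualVariable M T c A W (n + 1) ω + (conf - E)
        simp only [dualVariable]
        linarith
    simp only [Pi.add_apply] at h2
    rwa [integral_add iQ.integrableOn (integrable_const _).integrableOn, setIntegral_const,
      smul_eq_mul] at h2
  have h2 : ∫ ω in Hᶜ, ∑ t ∈ Finset.Icc 1 n, M.meanCost (c t ω) (A t ω) ∂P ≤ P.real Hᶜ * n := by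
    have h3 := setIntegral_mono_on (s := Hᶜ) iw.integrableOn
      (integrable_const (n : ℝ)).integrableOn hHm.compl fun ω _ => by
        calc ∑ t ∈ Finset.Icc 1 n, M.meanCost (c t ω) (A t ω) ≤ ∑ t ∈ Finset.Icc 1 n, (1 : ℝ) :=
              Finset.sum_le_sum fun t _ => (hM.meanCost_mem _ _).2
          _ = n := by simp
    rwa [setIntegral_const, smul_eq_mul] at h3
  rw [← integral_add_compl hHm iw]
  have hbad : P.real Hᶜ ≤ 2 / T := h.measure_compl_goodEvent_le hT (by omega)
  have hcompl : P.real H = 1 - P.real Hᶜ := by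
    rw [probReal_compl_eq_one_sub hHm]; ring
  have hP0 : 0 ≤ P.real Hᶜ := measureReal_nonneg
  have hE0 : 0 ≤ E := Finset.sum_nonneg fun _ _ => tightness_nonneg _ _ _
  have h5 : P.real Hᶜ * (E + n) ≤ 2 / T * (8 * (d * Real.log (1 + T)) * √(n : ℝ) + n) := by
    gcongr
  rw [hcompl] at h1
  have h6 := mul_nonneg hP0 hconf0
  linarith

theorem integral_sum_cost_le (h : IsInteraction M T P c A R W) (hM : M.Bounded) {δ : ℝ}
    (hδ : 0 < δ) (hδ1 : δ ≤ 1) (hS : M.Slater δ)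
    (hA : ∀ᵐ ω ∂P, FollowsAlgorithm M T δ (fun t => c t ω) (fun t => A t ω) (fun t => R t ω)
      (fun t => W t ω)) {n : ℕ} (hn : n ∈ Finset.Icc 1 T) :
    ∫ ω, ∑ t ∈ Finset.Icc 1 n, W t ω ∂P ≤ 128 * (d : ℝ) ^ 2 * Real.log (1 + T) ^ 2 / δ ^ 2
      + 48 / δ * Real.log (16 / δ) + 12 / δ + 2 * d * (4 - √(n : ℝ)) * Real.log (1 + T) := by
  have hd := hS.pos_dim hδ
  have hn' := Finset.mem_Icc.1 hn
  have hT : 0 < T := by omega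
  have hT1 : (1 : ℝ) ≤ T := by exact_mod_cast hT
  have hnT : (n : ℝ) ≤ T := by exact_mod_cast hn'.2
  have hd1 : (1 : ℝ) ≤ d := by exact_mod_cast hd
  have hL : 0 < Real.log (1 + T) := Real.log_pos (by linarith)
  have hn0 : (0 : ℝ) < n := by exact_mod_cast hn'.1
  have hsn : 0 < √(n : ℝ) := Real.sqrt_pos.2 hn0
  have hsn2 : √(n : ℝ) * √(n : ℝ) = n := Real.mul_self_sqrt hn0.le
  -- This term of the bound is pure slack: only its sign is needed.
  have hlog := mul_nonneg (by positivity : 0 ≤ 48 / δ) (log_sixteen_div_nonneg hδ hδ1)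
  have hLu : Real.log (1 + T) ≤ d * Real.log (1 + T) := by nlinarith
  have e1 : 128 * (d : ℝ) ^ 2 * Real.log (1 + T) ^ 2 / δ ^ 2
      = 128 * (d * Real.log (1 + T)) ^ 2 / δ ^ 2 := by ring
  have e2 : 2 * d * (4 - √(n : ℝ)) * Real.log (1 + T)
      = 2 * (d * Real.log (1 + T)) * (4 - √(n : ℝ)) := by ring
  rw [e1, e2]
  have hδ2 : δ ^ 2 ≤ 1 := pow_le_one₀ hδ.le hδ1
  rcases le_or_gt (n : ℝ) (64 * (d * Real.log (1 + T)) ^ 2 / δ ^ 2) with hsmall | hlarge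
  · refine (h.integral_sum_cost_le_self hM hn'.2).trans ?_
    set u := d * Real.log (1 + T) with hu
    have hu0 : 0 < u := by positivity
    have h1 : √(n : ℝ) ≤ 8 * u / δ := by
      rw [Real.sqrt_le_iff]
      refine ⟨by positivity, hsmall.trans (le_of_eq ?_)⟩
      rw [div_pow]; ring
    have h2 : 2 * u * √(n : ℝ) ≤ 16 * u ^ 2 / δ ^ 2 := by
      calc 2 * u * √(n : ℝ) ≤ 2 * u * (8 * u / δ) := by gcongr
        _ = 16 * u ^ 2 / δ ^ 2 * δ := by field_simp; ring
        _ ≤ _ := mul_le_of_le_one_right (by positivity) hδ1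
    have h3 : 0 ≤ 12 / δ := by positivity
    have h4 : 0 ≤ u ^ 2 / δ ^ 2 := by positivity
    have e3 : ∀ k : ℝ, k * u ^ 2 / δ ^ 2 = k * (u ^ 2 / δ ^ 2) := fun k => by ring
    rw [e3] at hsmall h2 ⊢
    linarith
  · have hL8 : 8 ≤ Real.log (1 + T) := by
      refine eight_le_log_of_lt hT (lt_of_le_of_lt ?_ (hlarge.trans_le hnT))
      rw [le_div_iff₀ (by positivity)]
      have h2 : Real.log (1 + T) ^ 2 ≤ (d * Real.log (1 + T)) ^ 2 := pow_le_pow_left₀ hL.le hLu 2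
      have h3 := mul_le_mul_of_nonneg_left hδ2 (sq_nonneg (Real.log (1 + T)))
      linarith
    have hu8 : 8 ≤ d * Real.log (1 + T) := hL8.trans hLu
    have hQ := h.integral_dualVariable_le hM hδ hδ1 hS hA hn hu8 hlarge
    have hconf := confidence_sum_le hd1 hL8 hn0.le
    have hfin := violation_constants_le hδ hδ1 hu8 hsn.le hconf hQ
    refine (h.integral_sum_cost_le_dual hM hd hn).trans ?_
    set u := d * Real.log (1 + T) with hu
    have h1 : 8 * u ≤ √(n : ℝ) := by
      apply Real.le_sqrt_of_sq_le
      refine le_trans ?_ hlarge.le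
      rw [le_div_iff₀ (by positivity)]
      have h3 := mul_le_mul_of_nonneg_left hδ2 (by positivity : 0 ≤ 64 * u ^ 2)
      linarith
    -- For long horizons `8u ≤ √n`, so the bad event contributes at most `2/T · 2n ≤ 4`.
    have h2 : 2 / (T : ℝ) * (8 * u * √(n : ℝ) + n) ≤ 4 := by
      have h3 : 8 * u * √(n : ℝ) ≤ n :=
        (mul_le_mul_of_nonneg_right h1 hsn.le).trans hsn2.le
      rw [div_mul_eq_mul_div, div_le_iff₀ (by linarith)]
      linarith
    linarith

end IsInteraction

end Violation

end ConstrainedBandit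

/-! ### Conclusion -/

theorem mainTheorem3 :
    ∃ κ : ℝ, 0 < κ ∧
      ∀ (X : Type*) [Countable X] [MeasurableSpace X] [MeasurableSingletonClass X]
        (Ω : Type*) [MeasurableSpace Ω] (P : Measure Ω) [IsProbabilityMeasure P]
        (J d T : ℕ) (M : ConstrainedBandit.Model X J d) (δ : ℝ)
        (c : ℕ → Ω → X) (A : ℕ → Ω → Fin J) (R W : ℕ → Ω → ℝ),
        0 < δ → δ ≤ 1 → M.Bounded → M.Slater δ →
        ConstrainedBandit.IsInteraction M T P c A R W →
        (∀ᵐ ω ∂P, ConstrainedBandit.FollowsAlgorithm M T δ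
          (fun t => c t ω) (fun t => A t ω) (fun t => R t ω) (fun t => W t ω)) →
        ∀ τ ∈ Finset.Icc 1 T,
          ConstrainedBandit.regret M P R τ ≤
              235 * (d : ℝ) ^ 4 * Real.log (1 + T) ^ 4 / δ ^ 3
                + (8 * d + 24) * √(τ : ℝ) * Real.log (1 + T) / δ
                + 2 + 10 * d * √(τ : ℝ) * Real.log (1 + T) ∧
          ConstrainedBandit.violation P W τ ≤
              max (128 * (d : ℝ) ^ 2 * Real.log (1 + T) ^ 2 / δ ^ 2
                + 48 / δ * Real.log (16 / δ) + 12 / δ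
                + 2 * d * (4 - √(τ : ℝ)) * Real.log (1 + T)) 0 ∧
          (2 ≤ T → κ * ((d : ℝ) ^ 2 * Real.log T ^ 2 / δ ^ 4) ≤ τ →
            ConstrainedBandit.violation P W τ = 0) := by
  -- `κ = 10⁶` is `(2·500)²`: the factor `500` of `violation_bound_nonpos` and the `2` from
  -- `log(1+T) ≤ 2 log T`.
  refine ⟨1000000, by norm_num, ?_⟩
  intro X _ _ _ Ω _ P _ J d T M δ c A R W hδ hδ1 hM hS h hA τ hτ
  have hviol := max_le_max_right 0 (h.integral_sum_cost_le hM hδ hδ1 hS hA hτ)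
  refine ⟨h.regret_le hM hδ hδ1 hS hA hτ, hviol, fun hT hκ => ?_⟩
  have hneg := ConstrainedBandit.violation_bound_nonpos hδ hδ1 hT (hS.pos_dim hδ) hκ
  rw [max_eq_right hneg] at hviol
  exact le_antisymm hviol (le_max_right _ _)
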